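/- **Setting.** Let $d\ge 0$ be the dimension and $\vec p=(p_1,\dots,p_d)\in\mathbb Z_{>0}^d$; write $\mathbb Z_{\vec p}=\prod_j\mathbb Z/p_j$ and $\mathbb C^{\otimes\vec p}=\ell^2(\mathbb Z_{\vec p})$ with coordinates $\pi_\sigma$. *Environment.* $\Omega$ is a compact Hausdorff space with a regular Borel probability measure $\mu$, and $\tau_x$ $(x\in\mathbb Z^d)$ are $\mu$-preserving maps with $\tau_0=\mathrm{id}$, $\tau_{x+y}=\tau_x\circ\tau_y$. For $\alpha\in\Omega$ let $\mathbb P_\alpha$ be the law, depending measurably on $\alpha$, of an $\Omega$-valued process $(\omega(t))_{t\ge0}$ with right-continuous paths and $\omega(0)=\alpha$, such that: $\mathbb P_{\tau_x\alpha}$ is the law of $(\tau_x\omega(t))_t$ under $\mathbb P_\alpha$; there is a filtration $(\mathcal F_t)$ to which $\omega$ is adapted with $\mathbb P_\alpha((\omega(t+s))_{t\ge0}\in\mathcal E\mid\mathcal F_s)=\mathbb P_{\omega(s)}(\mathcal E)$ for all $\alpha$, $s>0$ and measurable $\mathcal E$; and $\int\mathbb P_\alpha(\omega(t)\in A)\,\mu(d\alpha)=\mu(A)$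 for $t>0$ and Borel $A$. With $\mathbb E$ the expectation for the process with initial law $\mu$, let $S_tf(\alpha)=\mathbb E(f(\omega(0))\mid\omega(t)=\alpha)$ on $L^2(\Omega)$ and $Bf=\lim_{t\downarrow0}\frac1t(f-S_tf)$, with domain $\mathcal D(B)$ the set of $f$ for which this limit exists in $L^2$. Assume that there are $b,\gamma\ge0$ and $T>0$ with, for all $f\in\mathcal D(B)$, $$|\mathrm{Im}\langle f,Bf\rangle|\le\gamma\,\mathrm{Re}\langle f,Bf\rangle+b\|f\|^2,\qquad \mathrm{Re}\langle f,Bf\rangle\ge\tfrac1T\Big\|f-\int_\Omega f\,d\mu\Big\|^2 .$$ *Potentials and hopping.* $v\in L^\infty(\Omega;\mathbb R)$ with $\|v\|_\infty=1$, $\int v\,d\mu=0$, and there is $\chi>0$ with $\|B^{-1}(v\circ\tau_x-v\circ\tau_y)\|_{L^2(\Omega)}\ge\chi$ for all $x\ne y$, where $B^{-1}$ is the inverse of $B$ on mean-zero functions. $u:\mathbb Z^d\to\mathbb R$ satisfies $u(x+p_je_j)=u(x)$ for all $x,j$. $h:\mathbb Z^d\setminus\{0\}\to\mathbb C$ satisfies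 $h(-\xi)=\overline{h(\xi)}$ and $\sum_\xi|\xi|^2|h(\xi)|<\infty$, and $\{\xi:h(\xi)\ne0\}$ generates $\mathbb Z^d$. Put $\hat h(k)=\sum_{\xi\ne0}e^{-ik\cdot\xi}h(\xi)$ and let $$c_0=\min\Big\{\sum_{\xi\neq0}|h(\xi)|^2\sum_{\sigma\in\mathbb Z_{\vec p}}|w_\sigma-w_{\sigma-\xi}|^2:\ w\in\mathbb C^{\otimes\vec p},\ \sum_\sigma w_\sigma=0,\ \sum_\sigma|w_\sigma|^2=1\Big\}$$ (to be ignored if $\vec p=(1,\dots,1)$). *Fibre operator.* On $L^2(\mathbb Z^d\times\Omega;\mathbb C^{\otimes\vec p})$ let $$\pi_\sigma(\hat K_0\phi)(x,\omega)=\sum_{\xi\ne0}h(\xi)\big[\pi_\sigma\phi(x-\xi,\omega)-\pi_{\sigma-\xi}\phi(x-\xi,\tau_\xi\omega)\big],$$ $$\pi_\sigma(\hat U\phi)(x,\omega)=\big(u(x-\sigma)-u(-\sigma)\big)\pi_\sigma\phi(x,\omega),\qquad (\hat V\phi)(x,\omega)=\big(v(\tau_x\omega)-v(\omega)\big)\phi(x,\omega),$$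 let $B$ also denote the generator of the semigroup $\pi_\sigma\phi(x,\cdot)\mapsto S_t\,\pi_\sigma\phi(x,\cdot)$ on this space, and for $\lambda>0$ put $\hat L_0=i\hat K_0+i\hat U+i\lambda\hat V+B$ with domain $\mathcal D(B)$. **Lemma.** For every $\lambda>0$, $0$ is a non-degenerate (algebraically simple) eigenvalue of $\hat L_0$, and there is $g>0$ such that $$\sigma(\hat L_0)=\{0\}\cup\Sigma_+\quad\text{with}\quad\Sigma_+\subset\{z:\mathrm{Re}\,z>g\}.$$ Moreover there are $c>0$ and $\lambda_0>0$, depending only on $\vec p$, $\|\hat h\|_\infty$, $c_0$, $\|u\|_\infty$, $\gamma$, $T$, $b$ and $\chi$, such that $g$ can be chosen with $g\ge c\lambda^2$ whenever $0<\lambda<\lambda_0$. -/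

import Mathlib

open MeasureTheory ProbabilityTheory Filter Topology
open scoped ENNReal NNReal

noncomputable section

namespace PeriodicMarkov

universe u

/-! ### Unbounded operators: generator of a semigroup, spectrum, simple eigenvalues -/

section Operators

variable {E : Type*} [NormedAddCommGroup E] [NormedSpace ℂ E]

/-- The generator `B f = lim_{t ↓ 0} (f - S_t f) / t` of a one-parameter family of operators,
defined for those `f` for which the limit exists in norm. -/
def generator (S : ℝ≥0 → E →L[ℂ] E) : E →ₗ.[ℂ] E where
  domain :=
    { carrier := {f | ∃ g, Tendsto (fun t : ℝ≥0 => ((t : ℝ) : ℂ)⁻¹ • (f - S t f))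
        (𝓝[>] 0) (𝓝 g)}
      zero_mem' := ⟨0, by simp⟩
      add_mem' := by
        rintro f₁ f₂ ⟨g₁, h₁⟩ ⟨g₂, h₂⟩
        refine ⟨g₁ + g₂, (h₁.add h₂).congr fun t => ?_⟩
        rw [map_add, ← smul_add]
        congr 1
        abel
      smul_mem' := by
        rintro c f ⟨g, h⟩
        refine ⟨c • g, (h.const_smul c).congr fun t => ?_⟩
        rw [map_smul, ← smul_sub, smul_comm] }
  toFun :=
    { toFun := fun f => f.2.choose
      map_add' := by
        intro f₁ f₂
        refine tendsto_nhds_unique (f₁ + f₂).2.choose_spec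
          ((f₁.2.choose_spec.add f₂.2.choose_spec).congr fun t => ?_)
        rw [Submodule.coe_add, map_add, ← smul_add]
        congr 1
        abel
      map_smul' := by
        intro c f
        refine tendsto_nhds_unique (c • f).2.choose_spec
          ((f.2.choose_spec.const_smul c).congr fun t => ?_)
        rw [Submodule.coe_smul, map_smul, ← smul_sub, smul_comm] }

/-- `z` belongs to the resolvent set of `A` if `A - z : D(A) → E` is a bijection with a bounded
(everywhere defined) inverse `R`. -/
def InResolventSet (A : E →ₗ.[ℂ] E) (z : ℂ) : Prop :=
  ∃ R : E →L[ℂ] E,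
    (∀ y : E, ∃ hy : R y ∈ A.domain, A ⟨R y, hy⟩ - z • R y = y) ∧
    ∀ x : A.domain, R (A x - z • (x : E)) = x

/-- The spectrum `σ(A)` of an unbounded operator: the complement of its resolvent set. -/
def unboundedSpectrum (A : E →ₗ.[ℂ] E) : Set ℂ :=
  {z | ¬ InResolventSet A z}

/-- `z` is a non-degenerate (simple) eigenvalue of `A`: the eigenspace is spanned by one non-zero
vector `φ`, and there is no generalized eigenvector above `φ`. -/
def IsNondegenerateEigenvalue (A : E →ₗ.[ℂ] E) (z : ℂ) : Prop :=
  ∃ φ : A.domain, φ ≠ 0 ∧ A φ = z • (φ : E) ∧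
    (∀ ψ : A.domain, A ψ = z • (ψ : E) → ∃ a : ℂ, ψ = a • φ) ∧
    ∀ ψ : A.domain, A ψ - z • (ψ : E) ≠ (φ : E)

end Operators

/-! ### Random environment and Markov dynamics -/

/-- A stationary Markov dynamics on the compact probability space `(Ω, μ)` together with a
measure-preserving action `τ` of `ℤ^d` that leaves the law of the dynamics invariant. Paths are
elements of `Ω^[0,∞)`, with the `σ`-algebra generated by the Borel cylinder sets. -/
structure MarkovEnvironment (d : ℕ) {Ω : Type u} [TopologicalSpace Ω] [MeasurableSpace Ω]
    (μ : Measure Ω) where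
  /-- The disorder translations. -/
  τ : (Fin d → ℤ) → Ω → Ω
  τ_measurePreserving : ∀ x, MeasurePreserving (τ x) μ μ
  τ_zero : τ 0 = id
  τ_add : ∀ x y, τ (x + y) = τ x ∘ τ y
  /-- `path α` is the law `ℙ_α` of the process started at `α`. -/
  path : Kernel Ω (ℝ≥0 → Ω)
  path_prob : IsMarkovKernel path
  /-- With `ℙ_α`-probability one the path is right continuous and starts at `α`. The set of right
  continuous paths is not in the cylinder `σ`-algebra; the measure of a set is its outer measure,
  so this says that every event containing all right continuous paths from `α` has probability
  one, i.e. that `ℙ_α` is the law of a process with right continuous paths. -/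
  path_rightContinuous : ∀ α,
    path α {w | (∀ t, ContinuousWithinAt w (Set.Ici t) t) ∧ w 0 = α} = 1
  path_shift : ∀ x α, path (τ x α) = (path α).map (fun w t => τ x (w t))
  /-- The Markov property with respect to some filtration to which the process is adapted. -/
  path_markov : ∃ 𝓕 : Filtration ℝ≥0 (MeasurableSpace.pi : MeasurableSpace (ℝ≥0 → Ω)),
    (∀ t, Measurable[𝓕 t] fun w : ℝ≥0 → Ω => w t) ∧
    ∀ α s, 0 < s → ∀ A : Set (ℝ≥0 → Ω), MeasurableSet A →
      (path α)[Set.indicator {w | (fun t => w (t + s)) ∈ A} (fun _ => (1 : ℝ)) | 𝓕 s]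
        =ᵐ[path α] fun w => (path (w s)).real A
  /-- Invariance of `μ`. -/
  path_invariant : ∀ t, 0 < t → ∀ A : Set Ω, MeasurableSet A →
    ∫⁻ α, path α {w | w t ∈ A} ∂μ = μ A

namespace MarkovEnvironment

variable {d : ℕ} {Ω : Type u} [TopologicalSpace Ω] [MeasurableSpace Ω] {μ : Measure Ω}

/-- The law on path space of the stationary process (initial law `μ`); `𝔼(·)` is the expectation
with respect to this measure. -/
def law (M : MarkovEnvironment d μ) : Measure (ℝ≥0 → Ω) := μ.bind M.path

variable (M : MarkovEnvironment d μ)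

theorem path_zero (α : Ω) {A : Set Ω} (hA : MeasurableSet A) :
    M.path α {w | w 0 ∈ A} = A.indicator 1 α := by
  have := M.path_prob
  have key : ∀ {C : Set Ω}, MeasurableSet C → α ∈ C → M.path α {w | w 0 ∈ C} = 1 := by
    intro C _ hα
    refine le_antisymm prob_le_one ?_
    rw [← M.path_rightContinuous α]
    refine measure_mono fun w hw => ?_
    simpa [hw.2] using hα
  by_cases hα : α ∈ A
  · simp [hα, key hA hα]
  · have h1 := key hA.compl hα
    have hm : MeasurableSet {w : ℝ≥0 → Ω | w 0 ∈ A} := measurable_pi_apply 0 hA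
    have h2 : {w : ℝ≥0 → Ω | w 0 ∈ Aᶜ} = {w : ℝ≥0 → Ω | w 0 ∈ A}ᶜ := rfl
    rw [h2, prob_compl_eq_one_iff hm] at h1
    simp [hα, h1]

/-- At every time the stationary process has law `μ`. -/
theorem measurePreserving_eval (t : ℝ≥0) :
    MeasurePreserving (fun w : ℝ≥0 → Ω => w t) M.law μ := by
  refine ⟨measurable_pi_apply t, ?_⟩
  ext A hA
  rw [Measure.map_apply (measurable_pi_apply t) hA, law,
    Measure.bind_apply (measurable_pi_apply t hA) M.path.measurable.aemeasurable]
  change ∫⁻ α, M.path α {w | w t ∈ A} ∂μ = μ A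
  rcases eq_or_lt_of_le (zero_le : (0 : ℝ≥0) ≤ t) with rfl | ht
  · simp_rw [M.path_zero _ hA]
    simp [lintegral_indicator_one hA]
  · exact M.path_invariant t ht A hA

/-- `f ↦ f(ω(t))`, an isometry from `L²(Ω)` into `L²` of path space. -/
def evalL2 (t : ℝ≥0) : Lp ℂ 2 μ →ₗᵢ[ℂ] Lp ℂ 2 M.law :=
  Lp.compMeasurePreservingₗᵢ ℂ (fun w : ℝ≥0 → Ω => w t) (M.measurePreserving_eval t)

/-- The Markov semigroup `S_t f(α) = 𝔼(f(ω(0)) | ω(t) = α)` on `L²(Ω)`. Since `g ↦ g(ω(t))` is an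
isometry onto the `σ(ω(t))`-measurable functions, its adjoint is the conditional expectation given
`ω(t)`, written as a function of the value of `ω(t)`; see `semigroup_eq_condExp`. -/
def semigroup (t : ℝ≥0) : Lp ℂ 2 μ →L[ℂ] Lp ℂ 2 μ :=
  ContinuousLinearMap.adjoint (M.evalL2 t).toContinuousLinearMap ∘L
    (M.evalL2 0).toContinuousLinearMap

/-- The generator `B` of the Markov semigroup on `L²(Ω)`. -/
def B : Lp ℂ 2 μ →ₗ.[ℂ] Lp ℂ 2 μ := generator M.semigroup

/-- The operator `f ↦ f ∘ τ_x` on `L²(Ω)`. -/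
def koopman (x : Fin d → ℤ) : Lp ℂ 2 μ →ₗᵢ[ℂ] Lp ℂ 2 μ :=
  Lp.compMeasurePreservingₗᵢ ℂ (M.τ x) (M.τ_measurePreserving x)

/-- Sectoriality of `B` with constants `b, γ`. -/
def IsSectorial (b γ : ℝ) : Prop :=
  ∀ f : M.B.domain, |(inner ℂ (f : Lp ℂ 2 μ) (M.B f)).im| ≤
    γ * (inner ℂ (f : Lp ℂ 2 μ) (M.B f)).re + b * ‖(f : Lp ℂ 2 μ)‖ ^ 2

/-- Gap condition for `B` with constant `T`. -/
def HasGap [IsFiniteMeasure μ] (T : ℝ) : Prop :=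
  ∀ f : M.B.domain,
    1 / T * ‖(f : Lp ℂ 2 μ) - Lp.const 2 μ (∫ ω, (f : Lp ℂ 2 μ) ω ∂μ)‖ ^ 2 ≤
      (inner ℂ (f : Lp ℂ 2 μ) (M.B f)).re

/-- Assumptions on `v`: `‖v‖_∞ = 1`, mean zero, and non-degeneracy
`‖B⁻¹(v ∘ τ_x - v ∘ τ_y)‖ ≥ χ` for `x ≠ y`. Here `B⁻¹` is the inverse of the restriction of `B` to
the mean zero functions `L²₀(Ω)`, so `B⁻¹(v ∘ τ_x - v ∘ τ_y)` is the mean zero `f ∈ D(B)` with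
`B f = v ∘ τ_x - v ∘ τ_y`. -/
structure IsNondegeneratePotential (v : Lp ℝ ∞ μ) (χ : ℝ) : Prop where
  norm_eq_one : ‖v‖ = 1
  mean_zero : ∫ ω, v ω ∂μ = 0
  nondegenerate : ∀ x y : Fin d → ℤ, x ≠ y → ∀ f : M.B.domain,
    ∫ ω, (f : Lp ℂ 2 μ) ω ∂μ = 0 →
    (M.B f =ᵐ[μ] fun ω => ((v (M.τ x ω) - v (M.τ y ω) : ℝ) : ℂ)) → χ ≤ ‖(f : Lp ℂ 2 μ)‖

/-- `S_t f(ω(t)) = 𝔼(f(ω(0)) | ω(t))` almost surely. -/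
theorem semigroup_eq_condExp [IsProbabilityMeasure μ] (t : ℝ≥0) (f : Lp ℂ 2 μ) :
    (fun w : ℝ≥0 → Ω => M.semigroup t f (w t)) =ᵐ[M.law]
      M.law[fun w : ℝ≥0 → Ω => f (w 0) |
        MeasurableSpace.comap (fun w : ℝ≥0 → Ω => w t) inferInstance] := by
  have := M.path_prob
  have hprob : IsProbabilityMeasure M.law := by unfold law; infer_instance
  have hm : MeasurableSpace.comap (fun w : ℝ≥0 → Ω => w t) inferInstance ≤
      (MeasurableSpace.pi : MeasurableSpace (ℝ≥0 → Ω)) :=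
    (measurable_pi_apply t).comap_le
  have hint : ∀ (s : ℝ≥0) (g : Lp ℂ 2 μ), Integrable (fun w : ℝ≥0 → Ω => g (w s)) M.law :=
    fun s g => ((M.measurePreserving_eval s).integrable_comp
      (Lp.aestronglyMeasurable g)).2 ((Lp.memLp g).integrable one_le_two)
  have hae : ∀ (s : ℝ≥0) (g : Lp ℂ 2 μ), M.evalL2 s g =ᵐ[M.law] fun w => g (w s) :=
    fun s g => Lp.coeFn_compMeasurePreserving g (M.measurePreserving_eval s)
  refine ae_eq_condExp_of_forall_setIntegral_eq hm (hint 0 f)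
    (fun _ _ _ => (hint t _).integrableOn) ?_ ?_
  · rintro _ ⟨A, hA, rfl⟩ -
    have hA' : MeasurableSet ((fun w : ℝ≥0 → Ω => w t) ⁻¹' A) := measurable_pi_apply t hA
    have h1 : inner ℂ (indicatorConstLp 2 hA (measure_ne_top μ A) (1 : ℂ)) (M.semigroup t f) =
        inner ℂ (M.evalL2 t (indicatorConstLp 2 hA (measure_ne_top μ A) (1 : ℂ)))
          (M.evalL2 0 f) := by
      rw [semigroup, ContinuousLinearMap.comp_apply, ContinuousLinearMap.adjoint_inner_right]
      rfl
    have h2 : M.evalL2 t (indicatorConstLp 2 hA (measure_ne_top μ A) (1 : ℂ)) =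
        indicatorConstLp 2 hA' (measure_ne_top _ _) (1 : ℂ) :=
      Lp.indicatorConstLp_compMeasurePreserving hA (measure_ne_top μ A) 1
        (M.measurePreserving_eval t)
    rw [← (M.evalL2 t).inner_map_map, h2, L2.inner_indicatorConstLp_one,
      L2.inner_indicatorConstLp_one] at h1
    rw [← setIntegral_congr_ae hA' ((hae 0 f).mono fun w hw _ => hw), ← h1]
    exact (setIntegral_congr_ae hA' ((hae t _).mono fun w hw _ => hw)).symm
  · obtain ⟨g, hg, hfg⟩ := Lp.aestronglyMeasurable (M.semigroup t f)
    exact ⟨fun w => g (w t), hg.comp_measurable (comap_measurable _),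
      (M.measurePreserving_eval t).quasiMeasurePreserving.ae_eq_comp hfg⟩

end MarkovEnvironment

/-! ### Hopping and periodic potential -/

/-- A hopping kernel on `ℤ^d \ {0}`, extended by `h 0 = 0`: self-adjoint, short range, and with
support generating `ℤ^d`. -/
structure IsHoppingKernel {d : ℕ} (h : (Fin d → ℤ) → ℂ) : Prop where
  zero : h 0 = 0
  selfAdjoint : ∀ ξ, h (-ξ) = star (h ξ)
  shortRange : Summable fun ξ => (∑ j, (ξ j : ℝ) ^ 2) * ‖h ξ‖
  nondegenerate : AddSubgroup.closure (Function.support h) = ⊤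

/-- `‖ĥ‖_∞`, where `ĥ(k) = ∑_ξ e^{-i k·ξ} h(ξ)`. -/
def hopNorm {d : ℕ} (h : (Fin d → ℤ) → ℂ) : ℝ :=
  ⨆ k : Fin d → ℝ, ‖∑' ξ, Complex.exp (-Complex.I * ∑ j, (k j : ℂ) * (ξ j : ℂ)) * h ξ‖

/-- The period cell `ℤ_p = ℤ/p₁ × ⋯ × ℤ/p_d`; `ℂ^{⊗p}` is the space of functions on it. -/
abbrev Cell {d : ℕ} (p : Fin d → ℕ) : Type := ∀ j, ZMod (p j)

/-- The class of `ξ ∈ ℤ^d` in the period cell. -/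
def toCell {d : ℕ} (p : Fin d → ℕ) (ξ : Fin d → ℤ) : Cell p := fun j => (ξ j : ZMod (p j))

/-- The representative of `σ ∈ ℤ_p` in `{0, …, p₁ - 1} × ⋯ × {0, …, p_d - 1}`. -/
def ofCell {d : ℕ} {p : Fin d → ℕ} (σ : Cell p) : Fin d → ℤ := fun j => ((σ j).val : ℤ)

/-- The smallest eigenvalue on `{1}^⊥ ⊆ ℂ^{⊗p}` of the quadratic form
`Q(w) = ∑_ξ |h(ξ)|² ∑_σ |w(σ) - w(σ - ξ)|²`. (For `p = (1, …, 1)`, where `{1}^⊥ = 0`, the value is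
irrelevant.) -/
def hoppingConstant {d : ℕ} (p : Fin d → ℕ) [∀ j, NeZero (p j)] (h : (Fin d → ℤ) → ℂ) : ℝ :=
  ⨅ w : {w : Cell p → ℂ // ∑ σ, w σ = 0 ∧ ∑ σ, ‖w σ‖ ^ 2 = 1},
    ∑' ξ, ‖h ξ‖ ^ 2 * ∑ σ, ‖w.1 σ - w.1 (σ - toCell p ξ)‖ ^ 2

/-- A real `p`-periodic potential on `ℤ^d`: `u(x + p_j e_j) = u(x)`. -/
structure PeriodicPotential {d : ℕ} (p : Fin d → ℕ) where
  toFun : (Fin d → ℤ) → ℝ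
  periodic : ∀ j x, toFun (x + Pi.single j (p j : ℤ)) = toFun x

/-- `‖u‖_∞`. -/
def PeriodicPotential.supNorm {d : ℕ} {p : Fin d → ℕ} (u : PeriodicPotential p) : ℝ :=
  ⨆ x, |u.toFun x|

theorem PeriodicPotential.bddAbove {d : ℕ} {p : Fin d → ℕ} [∀ j, NeZero (p j)]
    (u : PeriodicPotential p) : BddAbove (Set.range fun x => |u.toFun x|) := by
  have hper : ∀ (n : Fin d → ℤ) (s : Finset (Fin d)),
      Function.Periodic u.toFun (∑ j ∈ s, n j • Pi.single j (p j : ℤ)) := by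
    intro n s
    classical
    induction s using Finset.induction_on with
    | empty => intro x; simp
    | insert j s hj ih =>
      rw [Finset.sum_insert hj]
      exact Function.Periodic.add_period
        (Function.Periodic.zsmul (fun x => u.periodic j x) (n j)) ih
  have hfin : (Set.pi Set.univ fun j => Set.Ico (0 : ℤ) (p j)).Finite :=
    Set.Finite.pi fun j => Set.finite_Ico _ _
  refine ((hfin.image fun x => |u.toFun x|).subset ?_).bddAbove
  rintro _ ⟨x, rfl⟩
  have hp : ∀ j, (0 : ℤ) < p j := fun j => by exact_mod_cast Nat.pos_of_neZero (p j)
  refine ⟨fun j => x j % p j,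
    fun j _ => ⟨Int.emod_nonneg _ (hp j).ne', Int.emod_lt_of_pos _ (hp j)⟩, ?_⟩
  have hx := hper (fun j => x j / p j) Finset.univ (fun j => x j % p j)
  simp only
  rw [← hx]
  congr 2
  ext i
  simp [Finset.sum_apply, Pi.single_apply, Int.emod_add_mul_ediv, mul_comm]

theorem PeriodicPotential.supNorm_nonneg {d : ℕ} {p : Fin d → ℕ} (u : PeriodicPotential p) :
    0 ≤ u.supNorm := Real.iSup_nonneg fun _ => abs_nonneg _

/-! ### The fibre operator at zero quasi-momentum -/

/-- Multiplication by a bounded real function on `L²(Ω)`. -/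
def mulOp {Ω : Type u} [MeasurableSpace Ω] {μ : Measure Ω} (a : Lp ℝ ∞ μ) : Lp ℂ 2 μ →L[ℂ] Lp ℂ 2 μ :=
  LinearMap.mkContinuous
    { toFun := fun f => (a • f : Lp ℂ 2 μ)
      map_add' := fun f g => Lp.add_smul a f g
      map_smul' := fun c f => by
        apply Lp.ext
        filter_upwards [Lp.coeFn_lpSMul (r := 2) a (c • f), Lp.coeFn_smul c (a • f : Lp ℂ 2 μ),
          Lp.coeFn_lpSMul (r := 2) a f, Lp.coeFn_smul c f] with ω h1 h2 h3 h4
        simp only [RingHom.id_apply]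
        rw [h1, h2, Pi.smul_apply', Pi.smul_apply, h3, h4, Pi.smul_apply', Pi.smul_apply,
          smul_comm] } ‖a‖ (fun f => Lp.norm_smul_le a f)

theorem norm_mulOp_le {Ω : Type u} [MeasurableSpace Ω] {μ : Measure Ω} (a : Lp ℝ ∞ μ) : ‖mulOp a‖ ≤ ‖a‖ :=
  LinearMap.mkContinuous_norm_le _ (norm_nonneg a) _

section Fibre

variable {d : ℕ} {Ω : Type u} [TopologicalSpace Ω] [MeasurableSpace Ω] {μ : Measure Ω}

/-- The Hilbert space `L²(ℤ^d × Ω; ℂ^{⊗p}) = ℓ²(ℤ^d × ℤ_p; L²(Ω))`; the component of `φ` at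
`(x, σ)` is the function `ω ↦ π_σ φ(x, ω)`. -/
abbrev FibreSpace {d : ℕ} (p : Fin d → ℕ) {Ω : Type u} [MeasurableSpace Ω] (μ : Measure Ω) :
    Type u :=
  lp (fun _ : (Fin d → ℤ) × Cell p => Lp ℂ 2 μ) 2

/-- Relabelling `φ ↦ φ ∘ e` of the index set of a vector valued `ℓ²` space. -/
def reindex {X E : Type*} [NormedAddCommGroup E] [NormedSpace ℂ E] (e : X ≃ X) :
    lp (fun _ : X => E) 2 →L[ℂ] lp (fun _ : X => E) 2 :=
  LinearMap.mkContinuous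
    { toFun := fun φ => ⟨fun i => φ (e i), by
        have h := (memℓp_gen_iff (p := 2) (by norm_num)).1 (lp.memℓp φ)
        exact (memℓp_gen_iff (p := 2) (by norm_num)).2 (e.summable_iff.2 h)⟩
      map_add' := fun _ _ => rfl
      map_smul' := fun _ _ => rfl } 1 (by
    intro φ
    rw [one_mul]
    refine lp.norm_le_of_tsum_le (p := 2) (by norm_num) (norm_nonneg _) ?_
    rw [lp.norm_rpow_eq_tsum (by norm_num) φ]
    exact (e.tsum_eq (fun i => ‖φ i‖ ^ (2 : ℝ≥0∞).toReal)).le)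

variable (M : MarkovEnvironment d μ) (p : Fin d → ℕ)

/-- `π_σ(K̂₀ φ)(x, ω) = ∑_ξ h(ξ) [π_σ φ(x - ξ, ω) - π_{σ - ξ} φ(x - ξ, τ_ξ ω)]`, as a norm
convergent sum of bounded operators. -/
def kHat (h : (Fin d → ℤ) → ℂ) : FibreSpace p μ →L[ℂ] FibreSpace p μ :=
  ∑' ξ : Fin d → ℤ, h ξ •
    (reindex (Equiv.subRight (ξ, 0)) -
      lp.mapCLM 2 (fun _ => (M.koopman ξ).toContinuousLinearMap) zero_le_one
          (fun _ => (M.koopman ξ).norm_toContinuousLinearMap_le) ∘L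
        reindex (Equiv.subRight (ξ, toCell p ξ)))

variable {p}

/-- `π_σ(Û φ)(x, ω) = (u(x - σ) - u(-σ)) π_σ φ(x, ω)`. -/
def uHat [∀ j, NeZero (p j)] (u : PeriodicPotential p) :
    FibreSpace p μ →L[ℂ] FibreSpace p μ :=
  lp.mapCLM 2
    (fun i : (Fin d → ℤ) × Cell p =>
      ((u.toFun (i.1 - ofCell i.2) - u.toFun (-ofCell i.2) : ℝ) : ℂ) •
        ContinuousLinearMap.id ℂ (Lp ℂ 2 μ))
    (K := 2 * u.supNorm) (mul_nonneg zero_le_two u.supNorm_nonneg) (by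
      intro i
      have hu : ∀ x, |u.toFun x| ≤ u.supNorm := fun x => le_ciSup u.bddAbove x
      refine (norm_smul_le _ _).trans ((mul_le_of_le_one_right (norm_nonneg _)
        ContinuousLinearMap.norm_id_le).trans ?_)
      rw [Complex.norm_real, Real.norm_eq_abs, two_mul]
      exact (abs_sub _ _).trans (add_le_add (hu _) (hu _)))

variable (p)

/-- `π_σ(V̂ φ)(x, ω) = (v(τ_x ω) - v(ω)) π_σ φ(x, ω)`. -/
def vHat (v : Lp ℝ ∞ μ) : FibreSpace p μ →L[ℂ] FibreSpace p μ :=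
  lp.mapCLM 2
    (fun i : (Fin d → ℤ) × Cell p =>
      mulOp (Lp.compMeasurePreserving (M.τ i.1) (M.τ_measurePreserving i.1) v - v))
    (K := 2 * ‖v‖) (mul_nonneg zero_le_two (norm_nonneg v)) (by
      intro i
      refine (norm_mulOp_le _).trans ((norm_sub_le _ _).trans ?_)
      rw [Lp.norm_compMeasurePreserving, two_mul])

/-- The Markov semigroup lifted to the fibre space,
`e^{-tB} φ(x, α) = 𝔼(φ(x, ω(0)) | ω(t) = α)`. -/
def liftedSemigroup (t : ℝ≥0) : FibreSpace p μ →L[ℂ] FibreSpace p μ :=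
  lp.mapCLM 2 (fun _ => M.semigroup t) (norm_nonneg (M.semigroup t)) (fun _ => le_rfl)

/-- The generator `B` of the lifted Markov semigroup. -/
def bHat : FibreSpace p μ →ₗ.[ℂ] FibreSpace p μ := generator (liftedSemigroup M p)

variable {p}

/-- `L̂₀ = i K̂₀ + i Û + i lam V̂ + B` on the domain of `B`. -/
def fibreL [∀ j, NeZero (p j)] (h : (Fin d → ℤ) → ℂ) (u : PeriodicPotential p) (v : Lp ℝ ∞ μ)
    (lam : ℝ) : FibreSpace p μ →ₗ.[ℂ] FibreSpace p μ :=
  (Complex.I • (kHat M p h + uHat u + (lam : ℂ) • vHat M p v)).toLinearMap +ᵥ bHat M p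

end Fibre

end PeriodicMarkov

end

open PeriodicMarkov

/-! The proof is a hypocoercivity argument. Let `H = K̂₀ + Û + λV̂` be the bounded symmetric part,
`P` the projection onto functions constant in `ω`, and `e₀` the ground state `δ₀ ⊗ 1 ⊗ 1`, which is
annihilated by `B` and by `H` and is orthogonal to the ranges of both. On the orthogonal complement
of `e₀` it suffices to bound `B + iH - z` below, uniformly for `Re z ≤ g`. Put `η = (B + iH - z)φ`,
`f = Pφ`, `ψ = (1 - P)φ`.

Dissipation alone controls `ψ`. Since `⟨φ, Hφ⟩` is real, the gap of `B` gives `‖ψ‖²/T ≤ ‖η‖‖φ‖ +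
g‖φ‖²`. The main point is the converse control of `f` by `ψ` and `η`, with a loss of only one factor
`1/λ`: `λ‖φ‖ ≤ D(‖ψ‖ + ‖η‖)` (`mul_norm_le_couplingConst`). For large `|z|` it is read off from the
mean part of the equation. For bounded `|z|` the function `f` is split by position. Where `x ≠ 0`,
the fluctuating part reads `Bφ + iλV̂f = ρ`, with `ρ` controlled by `ψ` and `η`. Applying `B⁻¹`, of
norm at most `T` on mean zero functions, and using `‖B⁻¹(v∘τ_x - v)‖ ≥ χ` bounds `λχ|f(x,σ)|`
(`norm_awayHat_meanHat_le`). Where `x = 0`, both potentials vanish, but `K̂₀` carries `f(0,·)` to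
sites `x ≠ 0` with squared norm given by the quadratic form whose minimum is `c₀`. Orthogonality to
`e₀` is exactly the condition `∑ w_σ = 0` for that form (`norm_kHat_originHat_meanHat_ge`,
`norm_originHat_meanHat_le`). Combining both directions with `g = λ²/(4D²T)` closes the estimate
(`lower_bound_of_hypocoercive`).

A lower bound on a left half-plane becomes surjectivity by continuation in `z` from far left, where
`B` plus a large constant dominates. A rank-one perturbation that moves the eigenvalue `0` out of
the half-plane transfers the result from the complement of `e₀` to the whole space
(`IsContractionSemigroup.spectral_gap`). All this requires that the conditional expectations form a
strongly continuous contraction semigroup, which follows from the Markov property, invariance and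
right continuity of paths. -/

namespace PeriodicMarkov

open MeasureTheory ProbabilityTheory Filter Topology
open scoped ENNReal NNReal

universe u

/-! ### Contraction semigroups, their generators and resolvents. -/

section Semigroups

/-- A strongly continuous semigroup of contractions. -/
structure IsContractionSemigroup {E : Type*} [NormedAddCommGroup E] [NormedSpace ℂ E]
    (S : ℝ≥0 → E →L[ℂ] E) : Prop where
  zero : S 0 = 1
  add : ∀ s t, S (s + t) = S s * S t
  norm_le : ∀ t, ‖S t‖ ≤ 1
  tendsto : ∀ f, Tendsto (fun t => S t f) (𝓝[>] 0) (𝓝 f)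

section Normed

variable {E : Type*} [NormedAddCommGroup E] [NormedSpace ℂ E]

theorem generator_tendsto {S : ℝ≥0 → E →L[ℂ] E} (f : (generator S).domain) :
    Tendsto (fun t : ℝ≥0 => ((t : ℝ) : ℂ)⁻¹ • ((f : E) - S t f)) (𝓝[>] 0)
      (𝓝 (generator S f)) :=
  f.2.choose_spec

theorem exists_generator_eq {S : ℝ≥0 → E →L[ℂ] E} {f g : E}
    (h : Tendsto (fun t : ℝ≥0 => ((t : ℝ) : ℂ)⁻¹ • (f - S t f)) (𝓝[>] 0) (𝓝 g)) :
    ∃ hf : f ∈ (generator S).domain, generator S ⟨f, hf⟩ = g :=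
  ⟨⟨g, h⟩, tendsto_nhds_unique (generator_tendsto (S := S) ⟨f, ⟨g, h⟩⟩) h⟩

theorem IsContractionSemigroup.norm_apply_le {S : ℝ≥0 → E →L[ℂ] E}
    (hS : IsContractionSemigroup S) (t : ℝ≥0) (f : E) : ‖S t f‖ ≤ ‖f‖ := by
  simpa using (S t).le_of_opNorm_le (hS.norm_le t) f

theorem IsContractionSemigroup.continuous_orbit {S : ℝ≥0 → E →L[ℂ] E}
    (hS : IsContractionSemigroup S) (f : E) : Continuous fun t => S t f := by
  have key : ∀ s t : ℝ≥0, s ≤ t → ‖S s f - S t f‖ ≤ ‖S (t - s) f - f‖ := by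
    intro s t hst
    have h : S t f = S s (S (t - s) f) := by
      rw [← mul_apply_eq_comp, ← hS.add, add_tsub_cancel_of_le hst]
    rw [h, ← map_sub, norm_sub_rev _ f]
    exact hS.norm_apply_le s (f - S (t - s) f)
  have h0 : Tendsto (fun t => ‖S t f - f‖) (𝓝 0) (𝓝 0) := by
    have h1 : Tendsto (fun t => S t f) (𝓝 (0 : ℝ≥0)) (𝓝 f) := by
      have h2 : 𝓝 (0 : ℝ≥0) = pure 0 ⊔ 𝓝[>] 0 := by
        rw [← nhdsWithin_insert, Set.insert_eq, Set.union_comm, Set.Ioi_union_left,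
          show Set.Ici (0 : ℝ≥0) = Set.univ from by ext; simp, nhdsWithin_univ]
      rw [h2, tendsto_sup]
      refine ⟨?_, hS.tendsto f⟩
      rw [tendsto_pure_left]
      intro s hs
      simpa [hS.zero] using mem_of_mem_nhds hs
    simpa using (h1.sub_const f).norm
  rw [continuous_iff_continuousAt]
  intro s
  rw [ContinuousAt, tendsto_iff_norm_sub_tendsto_zero]
  -- Subtraction in `ℝ≥0` is truncated, so this sum is `|t - s|`, with one summand zero in each
  -- case.
  have hc : Tendsto (fun t : ℝ≥0 => (t - s) + (s - t)) (𝓝 s) (𝓝 0) := by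
    have : Continuous fun t : ℝ≥0 => (t - s) + (s - t) := by fun_prop
    simpa using this.tendsto s
  refine squeeze_zero (fun _ => norm_nonneg _) (fun t => ?_) (h0.comp hc)
  rcases le_total s t with h | h
  · rw [norm_sub_rev]
    simpa [tsub_eq_zero_of_le h] using key s t h
  · simpa [tsub_eq_zero_of_le h] using key t s h

end Normed

section Resolvent

variable {E : Type*} [NormedAddCommGroup E] [NormedSpace ℂ E]

/-- A bijective operator `B + C` that is bounded below has a bounded inverse. -/
theorem exists_bounded_inverse {B : E →ₗ.[ℂ] E} {C : E →L[ℂ] E} {δ : ℝ} (hδ : 0 < δ)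
    (hlow : ∀ f : B.domain, δ * ‖(f : E)‖ ≤ ‖B f + C f‖)
    (hsurj : ∀ y, ∃ f : B.domain, B f + C f = y) :
    ∃ R : E →L[ℂ] E, (∀ y, ∃ hy : R y ∈ B.domain, B ⟨R y, hy⟩ + C (R y) = y) ∧
      (∀ f : B.domain, R (B f + C f) = f) ∧ ‖R‖ ≤ δ⁻¹ := by
  choose r hr using hsurj
  have hinj : ∀ f f' : B.domain, B f + C f = B f' + C f' → f = f' := by
    intro f f' h
    have h1 := hlow (f - f')
    have h2 : B (f - f') + C ((f - f' : B.domain) : E) = 0 := by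
      rw [B.map_sub, Submodule.coe_sub, map_sub, sub_add_sub_comm, h, sub_self]
    rw [h2, norm_zero] at h1
    have h3 : ‖((f - f' : B.domain) : E)‖ ≤ 0 := by
      by_contra hcon
      push Not at hcon
      exact absurd h1 (not_le.2 (mul_pos hδ hcon))
    have h4 : ((f - f' : B.domain) : E) = 0 := norm_le_zero_iff.1 h3
    exact sub_eq_zero.1 (Subtype.ext h4)
  let R₀ : E →ₗ[ℂ] E :=
    { toFun := fun y => (r y : E)
      map_add' := fun y y' => by
        rw [← Submodule.coe_add]
        congr 1
        apply hinj
        rw [hr, B.map_add, Submodule.coe_add, map_add, add_add_add_comm, hr, hr]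
      map_smul' := fun c y => by
        rw [RingHom.id_apply, ← Submodule.coe_smul]
        congr 1
        apply hinj
        rw [hr, B.map_smul, Submodule.coe_smul, map_smul, ← smul_add, hr] }
  have hb : ∀ y, ‖R₀ y‖ ≤ δ⁻¹ * ‖y‖ := by
    intro y
    have := hlow (r y)
    rw [hr] at this
    rw [inv_mul_eq_div, le_div_iff₀ hδ, mul_comm]
    exact this
  refine ⟨R₀.mkContinuous δ⁻¹ hb, fun y => ⟨(r y).2, hr y⟩, fun f => ?_,
    LinearMap.mkContinuous_norm_le _ (inv_nonneg.2 hδ.le) hb⟩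
  have : r (B f + C f) = f := hinj _ _ (hr _)
  exact congrArg Subtype.val this

/-- Neumann series: if `R` inverts `B + C`, then `B + C' = (1 + (C' - C)R)(B + C)` on the domain,
and `‖R‖ ≤ δ⁻¹`. This is one step of the continuation method. -/
theorem surjective_of_norm_sub_lt [CompleteSpace E] {B : E →ₗ.[ℂ] E} {C C' : E →L[ℂ] E} {δ : ℝ}
    (hδ : 0 < δ) (hlow : ∀ f : B.domain, δ * ‖(f : E)‖ ≤ ‖B f + C f‖)
    (hsurj : ∀ y, ∃ f : B.domain, B f + C f = y) (hC : ‖C' - C‖ < δ) (y : E) :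
    ∃ f : B.domain, B f + C' f = y := by
  obtain ⟨R, hR, -, hn⟩ := exists_bounded_inverse hδ hlow hsurj
  have h1 : ‖-((C' - C) * R)‖ < 1 := by
    rw [norm_neg]
    calc ‖(C' - C) * R‖ ≤ ‖C' - C‖ * ‖R‖ := norm_mul_le _ _
      _ ≤ ‖C' - C‖ * δ⁻¹ := by gcongr
      _ < δ * δ⁻¹ := by gcongr
      _ = 1 := mul_inv_cancel₀ hδ.ne'
  obtain ⟨u, hu⟩ := isUnit_one_sub_of_norm_lt_one h1
  obtain ⟨hy, hy'⟩ := hR ((↑u⁻¹ : E →L[ℂ] E) y)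
  refine ⟨⟨_, hy⟩, ?_⟩
  have h2 : (u : E →L[ℂ] E) ((↑u⁻¹ : E →L[ℂ] E) y) = y := by
    rw [← mul_apply_eq_comp, u.mul_inv, one_apply_eq_self]
  rw [hu] at h2
  simp only [sub_neg_eq_add, add_apply, one_apply_eq_self,
    mul_apply_eq_comp, sub_apply] at h2
  refine Eq.trans ?_ h2
  refine Eq.trans ?_ (congrArg (· + _) hy')
  abel

end Resolvent

section Accretive

variable {E : Type*} [NormedAddCommGroup E] [InnerProductSpace ℂ E]

theorem IsContractionSemigroup.re_inner_generator_nonneg {S : ℝ≥0 → E →L[ℂ] E}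
    (hS : IsContractionSemigroup S) (f : (generator S).domain) :
    0 ≤ (inner ℂ (f : E) (generator S f)).re := by
  have h := (Complex.continuous_re.tendsto _).comp
    (((innerSL ℂ (f : E)).continuous.tendsto _).comp (generator_tendsto f))
  refine ge_of_tendsto' h fun t => ?_
  have h1 : (inner ℂ (f : E) (S t f)).re ≤ ‖(f : E)‖ * ‖(f : E)‖ :=
    (re_inner_le_norm (𝕜 := ℂ) _ _).trans
      (mul_le_mul_of_nonneg_left (hS.norm_apply_le t f) (norm_nonneg _))
  have h2 : (inner ℂ (f : E) (f : E)).re = ‖(f : E)‖ * ‖(f : E)‖ :=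
    inner_self_eq_norm_mul_norm (𝕜 := ℂ) _
  simp only [Function.comp_apply, innerSL_apply_apply]
  rw [inner_smul_right, ← Complex.ofReal_inv, Complex.re_ofReal_mul, inner_sub_right,
    Complex.sub_re, h2]
  exact mul_nonneg (by positivity) (sub_nonneg.2 h1)

variable [CompleteSpace E]

/-- A Laplace transform truncated at time `1`: for `f = ∫₀¹ e^{-ms} S_s y' ds` one has `(B + m)f =
y' - e^{-m} S_1 y'`. Since `‖e^{-m} S_1‖ < 1`, some `y'` makes the right side equal to `y`, and no
improper integral is needed. -/
theorem IsContractionSemigroup.generator_add_pos_surjective {S : ℝ≥0 → E →L[ℂ] E}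
    (hS : IsContractionSemigroup S) {m : ℝ} (hm : 0 < m) (y : E) :
    ∃ f : (generator S).domain, generator S f + ((m : ℂ) • (1 : E →L[ℂ] E)) f = y := by
  have hn : ‖(Real.exp (-m) : ℂ) • S 1‖ < 1 := by
    rw [norm_smul, Complex.norm_real, Real.norm_eq_abs, abs_of_pos (Real.exp_pos _)]
    calc Real.exp (-m) * ‖S 1‖ ≤ Real.exp (-m) * 1 := by
          gcongr; exact hS.norm_le 1
      _ < 1 := by simpa using hm
  obtain ⟨u, hu⟩ := isUnit_one_sub_of_norm_lt_one hn
  set y' : E := (↑u⁻¹ : E →L[ℂ] E) y with hy'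
  have huy : y' - (Real.exp (-m) : ℂ) • S 1 y' = y := by
    have h2 : (u : E →L[ℂ] E) ((↑u⁻¹ : E →L[ℂ] E) y) = y := by
      rw [← mul_apply_eq_comp, u.mul_inv, one_apply_eq_self]
    rw [hu] at h2
    simpa using h2
  set F : ℝ → E := fun s => (Real.exp (-m * s)) • S s.toNNReal y' with hF
  have hFc : Continuous F := by
    have : Continuous fun s : ℝ => S s.toNNReal y' :=
      (hS.continuous_orbit y').comp continuous_real_toNNReal
    exact (by fun_prop : Continuous fun s : ℝ => Real.exp (-m * s)).smul this
  set G : ℝ → E := fun t => ∫ s in (0 : ℝ)..t, F s with hG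
  have hGd : ∀ t, HasDerivAt G (F t) t := fun t =>
    intervalIntegral.integral_hasDerivAt_right (hFc.intervalIntegrable _ _)
      (hFc.stronglyMeasurableAtFilter _ _) hFc.continuousAt
  -- The semigroup shifts the window of integration, so the orbit of `G 1` is explicit and
  -- differentiable at `t = 0`.
  have hSt : ∀ t : ℝ≥0, S t (G 1) = Real.exp (m * t) • (G (1 + t) - G t) := by
    intro t
    have h1 : S t (G 1) = ∫ s in (0 : ℝ)..1, S t (F s) :=
      ((S t).intervalIntegral_comp_comm (hFc.intervalIntegrable _ _)).symm
    have h2 : ∫ s in (0 : ℝ)..1, S t (F s) = ∫ s in (0 : ℝ)..1, Real.exp (m * t) • F (s + t) := by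
      refine intervalIntegral.integral_congr fun s hs => ?_
      rw [Set.uIcc_of_le zero_le_one] at hs
      have h3 : (s + t).toNNReal = t + s.toNNReal := by
        rw [Real.toNNReal_add hs.1 t.coe_nonneg, Real.toNNReal_coe, add_comm]
      simp only [hF]
      rw [h3, hS.add, mul_apply_eq_comp, smul_smul, ← Real.exp_add,
        ContinuousLinearMap.map_smul_of_tower]
      congr 2
      ring
    rw [h1, h2, intervalIntegral.integral_smul, intervalIntegral.integral_comp_add_right F,
      zero_add, ← intervalIntegral.integral_interval_sub_left (hFc.intervalIntegrable _ _)
        (hFc.intervalIntegrable _ _)]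
  have hζ : HasDerivAt (fun t : ℝ => G 1 - Real.exp (m * t) • (G (1 + t) - G t))
      (y - m • G 1) 0 := by
    have h1 : HasDerivAt (fun t : ℝ => Real.exp (m * t)) m 0 := by
      simpa using ((hasDerivAt_id (0 : ℝ)).const_mul m).exp
    have h2 : HasDerivAt (fun t : ℝ => G (1 + t) - G t) (F 1 - F 0) 0 := by
      refine HasDerivAt.sub ?_ (hGd 0)
      have := HasDerivAt.comp_const_add (1 : ℝ) 0 (by simpa using hGd 1) (f := G)
      simpa using this
    refine ((h1.smul h2).const_sub (G 1)).congr_deriv ?_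
    have hG0 : G 0 = 0 := by simp [hG]
    have hF0 : F 0 = y' := by simp [hF, hS.zero]
    have hF1 : F 1 = (Real.exp (-m) : ℂ) • S 1 y' := by
      simp only [hF, mul_one, Real.toNNReal_one]
      exact (Complex.coe_smul _ _).symm
    rw [hF0, hF1, hG0, ← huy]
    simp
    abel
  have hlim : Tendsto (fun t : ℝ≥0 => ((t : ℝ) : ℂ)⁻¹ • (G 1 - S t (G 1))) (𝓝[>] 0)
      (𝓝 (y - m • G 1)) := by
    have h1 := hζ.tendsto_slope_zero_right
    have h2 : Tendsto (fun t : ℝ≥0 => (t : ℝ)) (𝓝[>] 0) (𝓝[>] 0) := by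
      refine tendsto_nhdsWithin_iff.2 ⟨?_, ?_⟩
      · exact (NNReal.continuous_coe.tendsto' 0 0 rfl).mono_left nhdsWithin_le_nhds
      · filter_upwards [self_mem_nhdsWithin] with t ht using ht
    refine (h1.comp h2).congr fun t => ?_
    simp only [Function.comp_apply, zero_add, mul_zero, Real.exp_zero, add_zero, one_smul]
    rw [hSt t, ← Complex.ofReal_inv, Complex.coe_smul]
    simp [hG]
  obtain ⟨hf, hf'⟩ := exists_generator_eq hlim
  refine ⟨⟨_, hf⟩, ?_⟩
  rw [hf', smul_apply, one_apply_eq_self, Complex.coe_smul,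
    sub_add_cancel]

/-- If `generator S + C - z` is bounded below uniformly on a left half-plane, it is surjective
there. -/
theorem IsContractionSemigroup.surjective_of_uniform_lower_bound {S : ℝ≥0 → E →L[ℂ] E}
    (hS : IsContractionSemigroup S) (C : E →L[ℂ] E) {g δ : ℝ} (hδ : 0 < δ)
    (hlow : ∀ z : ℂ, z.re ≤ g → ∀ f : (generator S).domain,
      δ * ‖(f : E)‖ ≤ ‖generator S f + (C - z • (1 : E →L[ℂ] E)) f‖)
    {z : ℂ} (hz : z.re ≤ g) (y : E) :
    ∃ f : (generator S).domain, generator S f + (C - z • (1 : E →L[ℂ] E)) f = y := by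
  -- Large enough that `C` is a perturbation of `B + m` of size less than `m`, and that `-m` lies in
  -- the half-plane `Re z ≤ g`.
  set m : ℝ := ‖C‖ + 1 + |g| with hmdef
  have hm : 0 < m := by positivity
  have hstart : ∀ y, ∃ f : (generator S).domain,
      generator S f + (C - (-(m : ℂ)) • (1 : E →L[ℂ] E)) f = y := by
    refine surjective_of_norm_sub_lt hm (C := (m : ℂ) • (1 : E →L[ℂ] E)) ?_
      (fun y => hS.generator_add_pos_surjective hm y) ?_
    · intro f
      rcases (norm_nonneg (f : E)).eq_or_lt with h0 | h0
      · rw [← h0, mul_zero]; exact norm_nonneg _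
      have h1 := hS.re_inner_generator_nonneg f
      have h2 : (inner ℂ (f : E) (generator S f + ((m : ℂ) • (1 : E →L[ℂ] E)) f)).re ≤
          ‖(f : E)‖ * ‖generator S f + ((m : ℂ) • (1 : E →L[ℂ] E)) f‖ :=
        re_inner_le_norm (𝕜 := ℂ) _ _
      have h3 : (inner ℂ (f : E) (f : E)).re = ‖(f : E)‖ * ‖(f : E)‖ :=
        inner_self_eq_norm_mul_norm (𝕜 := ℂ) _
      have h4 : (inner ℂ (f : E) (generator S f + ((m : ℂ) • (1 : E →L[ℂ] E)) f)).re =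
          (inner ℂ (f : E) (generator S f)).re + m * (‖(f : E)‖ * ‖(f : E)‖) := by
        rw [inner_add_right, smul_apply, one_apply_eq_self,
          inner_smul_right, Complex.add_re, Complex.re_ofReal_mul, h3]
      rw [h4] at h2
      refine le_of_mul_le_mul_left ?_ h0
      linarith
    · have : C - (-(m : ℂ)) • (1 : E →L[ℂ] E) - (m : ℂ) • (1 : E →L[ℂ] E) = C := by
        rw [neg_smul]; abel
      rw [this, hmdef]
      have := abs_nonneg g
      linarith
  -- The segment from `-m` to `z` stays in the half-plane. It is cut into `n` steps shorter than
  -- `δ`, and each step preserves surjectivity.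
  obtain ⟨n, hn⟩ := exists_nat_gt (‖z + m‖ / δ)
  have hn0 : (0 : ℝ) < n := lt_of_le_of_lt (by positivity) hn
  have hpath : ∀ k : ℕ, k ≤ n → ∀ y, ∃ f : (generator S).domain,
      generator S f + (C - (-(m : ℂ) + ((k / n : ℝ) : ℂ) * (z + m)) • (1 : E →L[ℂ] E)) f = y := by
    intro k
    induction k with
    | zero =>
      intro _
      simpa using hstart
    | succ k ih =>
      intro hk
      refine surjective_of_norm_sub_lt hδ (hlow _ ?_) (ih (by omega)) ?_
      · have h1 : (k / n : ℝ) ≤ 1 := by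
          rw [div_le_one hn0]; exact_mod_cast (by omega : k ≤ n)
        have h2 : (0 : ℝ) ≤ k / n := by positivity
        have h3 : -m ≤ g := by
          have := neg_abs_le g
          have := norm_nonneg C
          linarith
        simp only [Complex.add_re, Complex.neg_re, Complex.ofReal_re, Complex.re_ofReal_mul]
        nlinarith
      · have h1 : (C - (-(m : ℂ) + (((k + 1 : ℕ) / n : ℝ) : ℂ) * (z + m)) • (1 : E →L[ℂ] E)) -
            (C - (-(m : ℂ) + ((k / n : ℝ) : ℂ) * (z + m)) • (1 : E →L[ℂ] E)) =
            (-((1 / n : ℝ) : ℂ) * (z + m)) • (1 : E →L[ℂ] E) := by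
          rw [sub_sub_sub_cancel_left, ← sub_smul]
          congr 1
          push_cast
          ring
        rw [h1, norm_smul, norm_mul, norm_neg, Complex.norm_real, Real.norm_eq_abs,
          abs_of_pos (by positivity)]
        have h2 : ‖(1 : E →L[ℂ] E)‖ ≤ 1 := ContinuousLinearMap.norm_id_le
        calc 1 / (n : ℝ) * ‖z + m‖ * ‖(1 : E →L[ℂ] E)‖ ≤ 1 / (n : ℝ) * ‖z + m‖ * 1 := by gcongr
          _ < δ := by
            rw [mul_one, one_div, inv_mul_lt_iff₀ hn0]
            rwa [div_lt_iff₀ hδ] at hn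
  have := hpath n le_rfl y
  rw [div_self hn0.ne'] at this
  simpa using this

end Accretive

end Semigroups

/-! ### Strong convergence of contractions, and the constant function. -/

section Contractions

variable {E ι : Type*} [NormedAddCommGroup E] [InnerProductSpace ℂ E] {l : Filter ι}

/-- For a contraction, `‖Tf - f‖² ≤ 2‖f‖² - 2 Re⟨f, Tf⟩`, so weak convergence tested on `f` alone
gives strong convergence. -/
theorem tendsto_of_inner_self_tendsto {T : ι → E →L[ℂ] E} (hT : ∀ i, ‖T i‖ ≤ 1) {f : E}
    (h : Tendsto (fun i => inner ℂ f (T i f)) l (𝓝 (inner ℂ f f))) :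
    Tendsto (fun i => T i f) l (𝓝 f) := by
  rw [tendsto_iff_norm_sub_tendsto_zero]
  have h1 : Tendsto (fun i => 2 * ‖f‖ ^ 2 - 2 * (inner ℂ f (T i f)).re) l (𝓝 0) := by
    have h2 := (((Complex.continuous_re.tendsto _).comp h).const_mul 2).const_sub (2 * ‖f‖ ^ 2)
    have h3 : (inner ℂ f f).re = ‖f‖ ^ 2 := inner_self_eq_norm_sq (𝕜 := ℂ) f
    simpa only [h3, Function.comp_apply, sub_self] using h2
  have h4 : Tendsto (fun i => ‖T i f - f‖ ^ 2) l (𝓝 0) := by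
    refine squeeze_zero (fun _ => by positivity) (fun i => ?_) h1
    have h5 : ‖T i f‖ ≤ ‖f‖ := by simpa using (T i).le_of_opNorm_le (hT i) f
    have h6 := norm_sub_sq (𝕜 := ℂ) (T i f) f
    have h7 : RCLike.re (inner ℂ (T i f) f) = (inner ℂ f (T i f)).re := inner_re_symm _ _
    rw [h7] at h6
    have h8 : ‖T i f‖ ^ 2 ≤ ‖f‖ ^ 2 := by gcongr
    linarith
  simpa using h4.sqrt

theorem tendsto_of_dense_of_norm_le {D : Type*} {T : ι → E →L[ℂ] E} (hT : ∀ i, ‖T i‖ ≤ 1)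
    {e : D → E} (he : DenseRange e) (h : ∀ x, Tendsto (fun i => T i (e x)) l (𝓝 (e x))) (f : E) :
    Tendsto (fun i => T i f) l (𝓝 f) := by
  rw [Metric.tendsto_nhds]
  intro ε hε
  obtain ⟨x, hx⟩ := he.exists_dist_lt f (by positivity : 0 < ε / 3)
  filter_upwards [Metric.tendsto_nhds.1 (h x) (ε / 3) (by positivity)] with i hi
  have h1 : dist (T i f) (T i (e x)) ≤ dist f (e x) := by
    rw [dist_eq_norm, dist_eq_norm, ← map_sub]
    simpa using (T i).le_of_opNorm_le (hT i) (f - e x)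
  have h2 := dist_triangle4 (T i f) (T i (e x)) (e x) f
  rw [dist_comm (e x) f] at h2
  linarith

end Contractions

section Mean

variable {Ω : Type*} [MeasurableSpace Ω] {μ : Measure Ω} [IsProbabilityMeasure μ]

/-- The constant function `1` in `L²(μ)`. -/
noncomputable def oneL2 (μ : Measure Ω) [IsProbabilityMeasure μ] : Lp ℂ 2 μ := Lp.const 2 μ (1 : ℂ)

theorem norm_oneL2 : ‖oneL2 μ‖ = 1 := by
  simp [oneL2, Lp.norm_const]

theorem inner_oneL2 (f : Lp ℂ 2 μ) : inner ℂ (oneL2 μ) f = ∫ ω, f ω ∂μ := by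
  rw [oneL2, ← indicatorConstLp_univ, L2.inner_indicatorConstLp_one, Measure.restrict_univ]

theorem const_eq_smul_oneL2 (c : ℂ) : Lp.const 2 μ c = c • oneL2 μ := by
  have := (Lp.constₗ (E := ℂ) 2 μ ℂ).map_smul c 1
  simpa [oneL2] using this

end Mean

/-! ### The Markov semigroup on `L²(Ω)`. -/

namespace MarkovEnvironment

variable {d : ℕ} {Ω : Type u} [TopologicalSpace Ω] [MeasurableSpace Ω] {μ : Measure Ω}
  (M : MarkovEnvironment d μ)

/-- The transition kernel at time `t`. -/
noncomputable def transition (t : ℝ≥0) : Kernel Ω Ω := M.path.map fun w => w t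

instance (t : ℝ≥0) : IsMarkovKernel (M.transition t) := by
  have := M.path_prob
  exact Kernel.IsMarkovKernel.map _ (measurable_pi_apply t)

theorem law_isProbabilityMeasure [IsProbabilityMeasure μ] : IsProbabilityMeasure M.law := by
  have := M.path_prob
  unfold law
  infer_instance

theorem ae_path_zero [MeasurableSingletonClass Ω] (α : Ω) : ∀ᵐ w ∂M.path α, w 0 = α := by
  have := M.path_prob
  have h := M.path_zero α (measurableSet_singleton α)
  simp only [Set.indicator_of_mem (Set.mem_singleton α), Pi.one_apply] at h
  exact (mem_ae_iff_prob_eq_one (measurable_pi_apply 0 (measurableSet_singleton α))).2 h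

theorem transition_apply (t : ℝ≥0) (α : Ω) {A : Set Ω} (hA : MeasurableSet A) :
    M.transition t α A = M.path α {w | w t ∈ A} :=
  Kernel.map_apply' _ (measurable_pi_apply t) _ hA

theorem integral_transition (t : ℝ≥0) (α : Ω) {g : Ω → ℂ} (hg : StronglyMeasurable g) :
    ∫ β, g β ∂M.transition t α = ∫ w, g (w t) ∂M.path α := by
  rw [transition, Kernel.map_apply _ (measurable_pi_apply t),
    integral_map (measurable_pi_apply t).aemeasurable hg.aestronglyMeasurable]

/-- The Chapman–Kolmogorov equation. -/
theorem transition_add [MeasurableSingletonClass Ω] (s t : ℝ≥0) :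
    M.transition (t + s) = M.transition t ∘ₖ M.transition s := by
  have hprob := M.path_prob
  ext α C hC
  rw [Kernel.comp_apply' _ _ _ hC, M.transition_apply _ _ hC]
  have h0 : ∫⁻ β, M.transition t β C ∂M.transition s α =
      ∫⁻ w, M.path (w s) {w' | w' t ∈ C} ∂M.path α := by
    rw [transition, transition, Kernel.map_apply _ (measurable_pi_apply s),
      lintegral_map (Kernel.measurable_coe _ hC) (measurable_pi_apply s)]
    exact lintegral_congr fun w => Kernel.map_apply' _ (measurable_pi_apply t) _ hC
  rw [h0]
  -- The Markov property is available only for `s > 0`; at `s = 0` the path starts at `α` almost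
  -- surely. For `s > 0`, integrating the conditional expectation gives the identity.
  rcases eq_zero_or_pos s with rfl | hs
  · rw [lintegral_congr_ae (g := fun _ => M.path α {w' | w' t ∈ C})
      ((M.ae_path_zero α).mono fun w hw => by simp only [hw])]
    simp
  · obtain ⟨𝓕, -, h⟩ := M.path_markov
    have hA : MeasurableSet {w : ℝ≥0 → Ω | w t ∈ C} := measurable_pi_apply t hC
    have hB : MeasurableSet {w : ℝ≥0 → Ω | w (t + s) ∈ C} := measurable_pi_apply (t + s) hC
    have h1 := h α s hs _ hA
    have h2 := integral_congr_ae h1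
    rw [integral_condExp (𝓕.le s)] at h2
    have h3 : {w : ℝ≥0 → Ω | (fun t => w (t + s)) ∈ {w : ℝ≥0 → Ω | w t ∈ C}} =
        {w | w (t + s) ∈ C} := rfl
    rw [h3, integral_indicator hB] at h2
    simp only [integral_const, smul_eq_mul, mul_one, measureReal_def,
      Measure.restrict_apply_univ] at h2
    rw [integral_toReal] at h2
    · exact (ENNReal.toReal_eq_toReal_iff' (measure_ne_top _ _) (ne_of_lt
        (lt_of_le_of_lt (lintegral_mono fun _ => prob_le_one) (by simp)))).1 h2
    · exact ((Kernel.measurable_coe M.path hA).comp (measurable_pi_apply s)).aemeasurable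
    · exact Eventually.of_forall fun _ => measure_lt_top _ _

theorem semigroup_norm_le (t : ℝ≥0) : ‖M.semigroup t‖ ≤ 1 := by
  refine (ContinuousLinearMap.opNorm_comp_le _ _).trans ?_
  rw [LinearIsometryEquiv.norm_map]
  exact mul_le_one₀ (LinearIsometry.norm_toContinuousLinearMap_le _) (norm_nonneg _)
    (LinearIsometry.norm_toContinuousLinearMap_le _)

theorem inner_semigroup (t : ℝ≥0) (f g : Lp ℂ 2 μ) :
    inner ℂ g (M.semigroup t f) = inner ℂ (M.evalL2 t g) (M.evalL2 0 f) := by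
  rw [semigroup, ContinuousLinearMap.comp_apply, ContinuousLinearMap.adjoint_inner_right]
  rfl

theorem semigroup_zero : M.semigroup 0 = 1 := by
  ext1 f
  refine ext_inner_left ℂ fun g => ?_
  rw [inner_semigroup, LinearIsometry.inner_map_map, one_apply_eq_self]

/-- The adjoint of the Markov semigroup. -/
noncomputable def dualSemigroup (t : ℝ≥0) : Lp ℂ 2 μ →L[ℂ] Lp ℂ 2 μ :=
  ContinuousLinearMap.adjoint (M.semigroup t)

theorem inner_dualSemigroup (t : ℝ≥0) (f g : Lp ℂ 2 μ) :
    inner ℂ f (M.dualSemigroup t g) = inner ℂ (M.evalL2 0 f) (M.evalL2 t g) := by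
  rw [dualSemigroup, ContinuousLinearMap.adjoint_inner_right, ← inner_conj_symm,
    inner_semigroup, inner_conj_symm]

/-- Evaluation at time `0` and at time `t` send `1` to the same constant on path space. -/
theorem semigroup_oneL2 [IsProbabilityMeasure μ] (t : ℝ≥0) :
    M.semigroup t (oneL2 μ) = oneL2 μ := by
  have := M.law_isProbabilityMeasure
  refine ext_inner_left ℂ fun g => ?_
  rw [inner_semigroup]
  exact (M.evalL2 t).inner_map_map g (oneL2 μ)

theorem inner_oneL2_semigroup [IsProbabilityMeasure μ] (t : ℝ≥0) (f : Lp ℂ 2 μ) :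
    inner ℂ (oneL2 μ) (M.semigroup t f) = inner ℂ (oneL2 μ) f := by
  have := M.law_isProbabilityMeasure
  rw [inner_semigroup]
  exact (M.evalL2 0).inner_map_map (oneL2 μ) f

theorem stronglyMeasurable_integral_transition {g : Ω → ℂ} (hg : StronglyMeasurable g)
    (t : ℝ≥0) : StronglyMeasurable fun α => ∫ β, g β ∂M.transition t α :=
  hg.integral_kernel

theorem norm_integral_transition_le {g : Ω → ℂ} {C : ℝ} (hC : ∀ β, ‖g β‖ ≤ C) (t : ℝ≥0) (α : Ω) :
    ‖∫ β, g β ∂M.transition t α‖ ≤ C := by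
  simpa using norm_integral_le_of_norm_le_const (μ := M.transition t α) (.of_forall hC)

/-- Along a sequence of times, convergence of `g(ω(u n))` is a measurable event of the cylinder
`σ`-algebra. It contains every right continuous path from `α`, so the outer measure condition gives
it probability one, and dominated convergence applies. -/
theorem tendsto_integral_transition [CompactSpace Ω] [BorelSpace Ω]
    [MeasurableSingletonClass Ω] (g : C(Ω, ℂ)) (α : Ω) {u : ℕ → ℝ≥0}
    (hu : Tendsto u atTop (𝓝 0)) :
    Tendsto (fun n => ∫ β, g β ∂M.transition (u n) α) atTop (𝓝 (g α)) := by
  have hprob := M.path_prob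
  have hg : StronglyMeasurable (g : Ω → ℂ) := g.continuous.stronglyMeasurable
  simp_rw [M.integral_transition _ α hg]
  have hmeas : MeasurableSet {w : ℝ≥0 → Ω | Tendsto (fun n => g (w (u n))) atTop (𝓝 (g α))} := by
    refine measurableSet_tendsto_fun (fun n => ?_) measurable_const
    exact hg.measurable.comp (measurable_pi_apply _)
  have hae : ∀ᵐ w ∂M.path α, Tendsto (fun n => g (w (u n))) atTop (𝓝 (g α)) := by
    refine (mem_ae_iff_prob_eq_one hmeas).2 (le_antisymm prob_le_one ?_)
    rw [← M.path_rightContinuous α]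
    refine measure_mono fun w hw => ?_
    have h1 : Tendsto w (𝓝 0) (𝓝 α) := by
      have := hw.1 0
      rw [ContinuousWithinAt, hw.2, show Set.Ici (0 : ℝ≥0) = Set.univ from by ext; simp,
        nhdsWithin_univ] at this
      exact this
    exact ((g.continuous.tendsto α).comp (h1.comp hu))
  have h := tendsto_integral_of_dominated_convergence (μ := M.path α) (fun _ => ‖g‖)
    (F := fun n w => g (w (u n))) (f := fun _ => g α)
    (fun n => (hg.comp_measurable (measurable_pi_apply _)).aestronglyMeasurable)
    (integrable_const _) (fun n => .of_forall fun w => g.norm_coe_le_norm _) hae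
  simpa using h

section Bounded

variable [IsProbabilityMeasure μ]

theorem memLp_integral_transition {g : Ω → ℂ} (hg : StronglyMeasurable g) {C : ℝ}
    (hC : ∀ β, ‖g β‖ ≤ C) (t : ℝ≥0) : MemLp (fun α => ∫ β, g β ∂M.transition t α) 2 μ :=
  MemLp.of_bound (M.stronglyMeasurable_integral_transition hg t).aestronglyMeasurable C
    (.of_forall (M.norm_integral_transition_le hC t))

/-- On bounded functions the dual semigroup is given by the transition kernel. -/
theorem dualSemigroup_toLp [MeasurableSingletonClass Ω] {g : Ω → ℂ} (hg : StronglyMeasurable g)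
    {C : ℝ} (hC : ∀ β, ‖g β‖ ≤ C) (hgm : MemLp g 2 μ) (t : ℝ≥0) :
    M.dualSemigroup t (hgm.toLp g) = (M.memLp_integral_transition hg hC t).toLp _ := by
  have := M.law_isProbabilityMeasure
  have hprob := M.path_prob
  refine ext_inner_left ℂ fun f => ?_
  have hf : StronglyMeasurable f := Lp.stronglyMeasurable f
  rw [inner_dualSemigroup, L2.inner_def, L2.inner_def]
  have h1 : (fun w => inner ℂ (M.evalL2 0 f w) (M.evalL2 t (hgm.toLp g) w)) =ᵐ[M.law]
      fun w => inner ℂ (f (w 0)) (g (w t)) := by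
    filter_upwards [Lp.coeFn_compMeasurePreserving f (M.measurePreserving_eval 0),
      Lp.coeFn_compMeasurePreserving (hgm.toLp g) (M.measurePreserving_eval t),
      (M.measurePreserving_eval t).quasiMeasurePreserving.ae_eq_comp hgm.coeFn_toLp] with w h1 h2 h3
    simp only [Function.comp_apply] at h1 h2 h3
    have h1' : M.evalL2 0 f w = f (w 0) := h1
    have h2' : M.evalL2 t (hgm.toLp g) w = (hgm.toLp g) (w t) := h2
    rw [h1', h2', h3]
  have hint : Integrable (fun w : ℝ≥0 → Ω => inner ℂ (f (w 0)) (g (w t))) M.law :=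
    (L2.integrable_inner (𝕜 := ℂ) (M.evalL2 0 f) (M.evalL2 t (hgm.toLp g))).congr h1
  rw [integral_congr_ae h1]
  -- Disintegrating the stationary law over the starting point turns the inner product into an
  -- integral of `ℙ_α`-expectations.
  have hlaw : M.law = (M.path ∘ₖ Kernel.const Unit μ) () := by
    rw [Kernel.comp_apply, Kernel.const_apply, law]
  rw [hlaw] at hint ⊢
  rw [Kernel.integral_comp hint, Kernel.const_apply]
  refine integral_congr_ae ?_
  filter_upwards [(M.memLp_integral_transition hg hC t).coeFn_toLp] with α hα
  rw [hα, M.integral_transition t α hg]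
  rw [integral_congr_ae (g := fun w => inner ℂ (f α) (g (w t)))
    ((M.ae_path_zero α).mono fun w hw => by simp only [hw])]
  refine integral_inner (𝕜 := ℂ) ?_ (f α)
  exact Integrable.of_bound (hg.comp_measurable (measurable_pi_apply t)).aestronglyMeasurable C
    (.of_forall fun w => hC _)

end Bounded

section Semigroup

variable [IsProbabilityMeasure μ] [CompactSpace Ω] [T2Space Ω] [BorelSpace Ω]

theorem inner_dualSemigroup_tendsto (g : C(Ω, ℂ)) {u : ℕ → ℝ≥0} (hu : Tendsto u atTop (𝓝 0)) :
    Tendsto (fun n => inner ℂ (ContinuousMap.toLp 2 μ ℂ g)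
      (M.dualSemigroup (u n) (ContinuousMap.toLp 2 μ ℂ g))) atTop
      (𝓝 (inner ℂ (ContinuousMap.toLp 2 μ ℂ g) (ContinuousMap.toLp 2 μ ℂ g))) := by
  have hg : StronglyMeasurable (g : Ω → ℂ) := g.continuous.stronglyMeasurable
  have hC : ∀ β, ‖g β‖ ≤ ‖g‖ := g.norm_coe_le_norm
  have hgm : MemLp g 2 μ := MemLp.of_bound hg.aestronglyMeasurable ‖g‖ (.of_forall hC)
  have hgl : ContinuousMap.toLp 2 μ ℂ g = hgm.toLp g := rfl
  have h1 : ∀ (q : Ω → ℂ) (hq : MemLp q 2 μ), inner ℂ (hgm.toLp g) (hq.toLp q) =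
      ∫ α, inner ℂ (g α) (q α) ∂μ := by
    intro q hq
    rw [L2.inner_def]
    refine integral_congr_ae ?_
    filter_upwards [hgm.coeFn_toLp, hq.coeFn_toLp] with α h1 h2
    rw [h1, h2]
  rw [hgl]
  simp_rw [M.dualSemigroup_toLp hg hC hgm, h1]
  refine tendsto_integral_of_dominated_convergence (fun _ => ‖g‖ * ‖g‖) (fun n => ?_)
    (integrable_const _) (fun n => .of_forall fun α => ?_) (.of_forall fun α => ?_)
  · exact hg.aestronglyMeasurable.inner
      (M.stronglyMeasurable_integral_transition hg _).aestronglyMeasurable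
  · exact (norm_inner_le_norm _ _).trans (mul_le_mul (hC α)
      (M.norm_integral_transition_le hC _ α) (norm_nonneg _) (norm_nonneg _))
  · exact tendsto_const_nhds.inner (M.tendsto_integral_transition g α hu)

variable [μ.Regular]

/-- Continuous functions are dense, and on them the law is Chapman–Kolmogorov. After one application
of the kernel only boundedness and measurability survive, which is why `dualSemigroup_toLp` does not
ask for continuity. -/
theorem dualSemigroup_add (s t : ℝ≥0) :
    M.dualSemigroup (t + s) = M.dualSemigroup s * M.dualSemigroup t := by
  refine ContinuousLinearMap.ext fun f => ?_
  refine DenseRange.induction_on (ContinuousMap.toLp_denseRange ℂ μ ℂ (p := 2) (by simp)) f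
    (isClosed_eq (ContinuousLinearMap.continuous _) (ContinuousLinearMap.continuous _)) fun g => ?_
  have hg : StronglyMeasurable (g : Ω → ℂ) := g.continuous.stronglyMeasurable
  have hC : ∀ β, ‖g β‖ ≤ ‖g‖ := g.norm_coe_le_norm
  have hgm : MemLp g 2 μ := MemLp.of_bound hg.aestronglyMeasurable ‖g‖ (.of_forall hC)
  have hgl : ContinuousMap.toLp 2 μ ℂ g = hgm.toLp g := rfl
  rw [hgl, mul_apply_eq_comp, M.dualSemigroup_toLp hg hC hgm, M.dualSemigroup_toLp hg hC hgm,
    M.dualSemigroup_toLp (M.stronglyMeasurable_integral_transition hg t)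
      (M.norm_integral_transition_le hC t)]
  congr 1
  ext α
  rw [M.transition_add, Kernel.integral_comp]
  exact Integrable.of_bound hg.aestronglyMeasurable ‖g‖ (.of_forall hC)

theorem semigroup_add (s t : ℝ≥0) : M.semigroup (s + t) = M.semigroup s * M.semigroup t := by
  have h : ∀ r, M.semigroup r = star (M.dualSemigroup r) := fun r =>
    (ContinuousLinearMap.adjoint_adjoint (M.semigroup r)).symm
  rw [h, h, h, ← star_mul, ← M.dualSemigroup_add t s]

theorem isContractionSemigroup : IsContractionSemigroup M.semigroup where
  zero := M.semigroup_zero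
  add := M.semigroup_add
  norm_le := M.semigroup_norm_le
  tendsto := by
    refine tendsto_of_dense_of_norm_le M.semigroup_norm_le
      (ContinuousMap.toLp_denseRange ℂ μ ℂ (p := 2) (by simp)) fun g => ?_
    refine tendsto_of_seq_tendsto fun u hu => ?_
    refine tendsto_of_inner_self_tendsto (fun n => M.semigroup_norm_le (u n)) ?_
    -- The diagonal matrix elements of the semigroup and of its adjoint are conjugate, so the
    -- convergence shown for the adjoint transfers.
    have h := (Complex.continuous_conj.tendsto _).comp
      (M.inner_dualSemigroup_tendsto g (hu.mono_right nhdsWithin_le_nhds))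
    rw [inner_conj_symm] at h
    refine h.congr fun n => ?_
    rw [Function.comp_apply, inner_conj_symm, dualSemigroup,
      ContinuousLinearMap.adjoint_inner_left]

end Semigroup

end MarkovEnvironment

/-! ### The norm of a convolution operator is at most `‖ĥ‖_∞`. -/

section HopNorm

variable {d : ℕ} {h : (Fin d → ℤ) → ℂ}

theorem IsHoppingKernel.summable_norm (hh : IsHoppingKernel h) : Summable fun ξ => ‖h ξ‖ := by
  refine Summable.of_nonneg_of_le (fun _ => norm_nonneg _) (fun ξ => ?_) hh.shortRange
  by_cases hξ : ξ = 0
  · simp [hξ, hh.zero]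
  · obtain ⟨j, hj⟩ := Function.ne_iff.1 hξ
    refine le_mul_of_one_le_left (norm_nonneg _) ?_
    calc (1 : ℝ) ≤ (ξ j : ℝ) ^ 2 := by
          have : 1 ≤ |ξ j| := Int.one_le_abs hj
          rw [← sq_abs]
          have h2 : (1 : ℝ) ≤ |(ξ j : ℝ)| := by exact_mod_cast this
          nlinarith
      _ ≤ ∑ j, (ξ j : ℝ) ^ 2 :=
          Finset.single_le_sum (f := fun j => (ξ j : ℝ) ^ 2) (fun _ _ => sq_nonneg _)
            (Finset.mem_univ j)

theorem norm_exp_phase (k : Fin d → ℝ) (ξ : Fin d → ℤ) :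
    ‖Complex.exp (-Complex.I * ∑ j, (k j : ℂ) * (ξ j : ℂ))‖ = 1 := by
  have : -Complex.I * ∑ j, (k j : ℂ) * (ξ j : ℂ) =
      ((-∑ j, k j * ξ j : ℝ) : ℂ) * Complex.I := by
    push_cast
    ring
  rw [this, Complex.norm_exp_ofReal_mul_I]

theorem hopNorm_nonneg (h : (Fin d → ℤ) → ℂ) : 0 ≤ hopNorm h :=
  Real.iSup_nonneg fun _ => norm_nonneg _

theorem norm_tsum_phase_le_hopNorm (hs : Summable fun ξ => ‖h ξ‖) (k : Fin d → ℝ) :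
    ‖∑' ξ, Complex.exp (-Complex.I * ∑ j, (k j : ℂ) * (ξ j : ℂ)) * h ξ‖ ≤ hopNorm h := by
  refine le_ciSup (f := fun k : Fin d → ℝ =>
    ‖∑' ξ, Complex.exp (-Complex.I * ∑ j, (k j : ℂ) * (ξ j : ℂ)) * h ξ‖)
    ⟨∑' ξ, ‖h ξ‖, ?_⟩ k
  rintro _ ⟨k, rfl⟩
  refine (norm_tsum_le_tsum_norm ?_).trans_eq ?_
  · simpa only [norm_mul, norm_exp_phase, one_mul] using hs
  · simp only [norm_mul, norm_exp_phase, one_mul]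

/-- Every unitary character of `ℤ^d` is `ξ ↦ e^{-i k·ξ}` for some `k`. -/
theorem exists_phase {f : (Fin d → ℤ) → ℂ} (h0 : f 0 = 1) (hadd : ∀ ξ η, f (ξ + η) = f ξ * f η)
    (hn : ∀ ξ, ‖f ξ‖ = 1) :
    ∃ k : Fin d → ℝ, ∀ ξ, f ξ = Complex.exp (-Complex.I * ∑ j, (k j : ℂ) * (ξ j : ℂ)) := by
  refine ⟨fun j => -Complex.arg (f (Pi.single j 1)), fun ξ => ?_⟩
  -- Both sides are homomorphisms on `ℤ^d`, so they need only be compared on the unit vectors.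
  let F₁ : (Fin d → ℤ) →+ Additive ℂ :=
    { toFun := fun ξ => Additive.ofMul (f ξ)
      map_zero' := congrArg _ h0
      map_add' := fun ξ η => congrArg _ (hadd ξ η) }
  let F₂ : (Fin d → ℤ) →+ Additive ℂ :=
    { toFun := fun ξ => Additive.ofMul (Complex.exp (-Complex.I *
        ∑ j, ((-Complex.arg (f (Pi.single j 1)) : ℝ) : ℂ) * (ξ j : ℂ)))
      map_zero' := by simp
      map_add' := fun ξ η => by
        rw [← ofMul_mul, ← Complex.exp_add, ← mul_add, ← Finset.sum_add_distrib]
        simp only [Pi.add_apply, Int.cast_add, mul_add] }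
  have key : F₁ = F₂ := by
    refine AddMonoidHom.functions_ext' _ _ _ fun j => AddMonoidHom.ext_int ?_
    change Additive.ofMul (f (Pi.single j 1)) = Additive.ofMul _
    congr 1
    have h1 : ∑ i, ((-Complex.arg (f (Pi.single i 1)) : ℝ) : ℂ) *
        (((Pi.single j 1 : Fin d → ℤ) i : ℤ) : ℂ) = -(Complex.arg (f (Pi.single j 1)) : ℂ) := by
      rw [Finset.sum_eq_single j]
      · simp
      · intro i _ hi
        simp [Pi.single_eq_of_ne hi]
      · simp
    have h2 := Complex.norm_mul_exp_arg_mul_I (f (Pi.single j 1))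
    rw [hn, Complex.ofReal_one, one_mul] at h2
    refine Eq.trans h2.symm (congrArg Complex.exp ?_)
    refine Eq.trans ?_ (congrArg (-Complex.I * ·) h1.symm)
    ring
  exact congrArg (fun F : (Fin d → ℤ) →+ Additive ℂ => (F ξ).toMul) key

/-- The `C*`-norm of a convolution operator in a commutative unitary representation. -/
theorem norm_tsum_smul_le_hopNorm_of_comm {A : Type*} [CommCStarAlgebra A]
    {W : (Fin d → ℤ) → A} (h0 : W 0 = 1) (hadd : ∀ ξ η, W (ξ + η) = W ξ * W η)
    (hstar : ∀ ξ, star (W ξ) = W (-ξ)) (hs : Summable fun ξ => ‖h ξ‖) {a : A}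
    (ha : HasSum (fun ξ => h ξ • W ξ) a) : ‖a‖ ≤ hopNorm h := by
  -- By Gelfand duality it suffices to bound `φ(a)` for every character `φ`. The map `ξ ↦ φ(W ξ)` is
  -- a unitary character of `ℤ^d`, so `φ(a)` is a value of `ĥ`.
  have hiso := (AddMonoidHomClass.isometry_iff_norm _).1
    (gelfandTransform_isometry A) a
  rw [← hiso, ContinuousMap.norm_le _ (hopNorm_nonneg h)]
  intro φ
  rw [WeakDual.gelfandTransform_apply_apply]
  obtain ⟨k, hk⟩ := exists_phase (f := fun ξ => φ (W ξ)) (by rw [h0, map_one])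
    (fun ξ η => by rw [hadd, map_mul]) (fun ξ => by
      have h1 : φ (star (W ξ)) * φ (W ξ) = 1 := by
        rw [← map_mul, hstar, ← hadd, neg_add_cancel, h0, map_one]
      rw [map_star] at h1
      have h2 := congrArg norm h1
      rw [norm_mul, norm_star, norm_one] at h2
      nlinarith [norm_nonneg (φ (W ξ))])
  have hφ : HasSum (fun ξ => φ (h ξ • W ξ)) (φ a) := ha.map φ (map_continuous φ)
  rw [← hφ.tsum_eq]
  refine le_trans (le_of_eq ?_) (norm_tsum_phase_le_hopNorm hs k)
  congr 2
  ext ξ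
  rw [map_smul, hk, smul_eq_mul, mul_comm]

/-- The operators `W ξ` and their adjoints commute, so their closed star-subalgebra is commutative;
it contains `a`, and the commutative case applies there. -/
theorem norm_tsum_smul_le_hopNorm {A : Type*} [CStarAlgebra A]
    {W : (Fin d → ℤ) → A} (h0 : W 0 = 1) (hadd : ∀ ξ η, W (ξ + η) = W ξ * W η)
    (hstar : ∀ ξ, star (W ξ) = W (-ξ)) (hs : Summable fun ξ => ‖h ξ‖) {a : A}
    (ha : HasSum (fun ξ => h ξ • W ξ) a) : ‖a‖ ≤ hopNorm h := by
  have hcomm : ∀ ξ η, W ξ * W η = W η * W ξ := fun ξ η => by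
    rw [← hadd, ← hadd, add_comm]
  have hadj : IsMulCommutative (StarAlgebra.adjoin ℂ (Set.range W)) := by
    refine StarAlgebra.isMulCommutative_adjoin ℂ ?_ ?_
    · rintro _ ⟨ξ, rfl⟩ _ ⟨η, rfl⟩
      exact hcomm ξ η
    · rintro _ ⟨ξ, rfl⟩ _ ⟨η, rfl⟩
      rw [hstar]
      exact hcomm ξ (-η)
  set A₀ := (StarAlgebra.adjoin ℂ (Set.range W)).topologicalClosure with hA₀
  have hcl : IsClosed (A₀ : Set A) := StarSubalgebra.isClosed_topologicalClosure _
  let : CommCStarAlgebra A₀ :=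
    { StarSubalgebra.cstarAlgebra A₀ with
      mul_comm := (StarSubalgebra.commRingTopologicalClosure _
        (fun x y => hadj.is_comm.comm x y)).mul_comm }
  have hmem : ∀ ξ, W ξ ∈ A₀ := fun ξ =>
    StarSubalgebra.le_topologicalClosure _ (StarAlgebra.subset_adjoin ℂ _ ⟨ξ, rfl⟩)
  have hamem : a ∈ A₀ := by
    refine hcl.mem_of_tendsto ha (.of_forall fun s => ?_)
    exact sum_mem fun ξ _ => A₀.smul_mem (hmem ξ) (h ξ)
  have ha' : HasSum (fun ξ => h ξ • (⟨W ξ, hmem ξ⟩ : A₀)) ⟨a, hamem⟩ := by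
    rw [← Topology.IsInducing.subtypeVal.hasSum_iff (f := fun ξ => h ξ • (⟨W ξ, hmem ξ⟩ : A₀))
      (g := A₀.subtype)]
    exact ha
  exact norm_tsum_smul_le_hopNorm_of_comm (A := A₀) (W := fun ξ => ⟨W ξ, hmem ξ⟩)
    (Subtype.ext h0) (fun ξ η => Subtype.ext (hadd ξ η)) (fun ξ => Subtype.ext (hstar ξ)) hs ha'

end HopNorm

/-! ### Operators on vector-valued `ℓ²` spaces. -/

section HilbertSum

variable {I E : Type*} [NormedAddCommGroup E]

theorem hasSum_norm_sq (φ : lp (fun _ : I => E) 2) : HasSum (fun i => ‖φ i‖ ^ 2) (‖φ‖ ^ 2) := by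
  have := lp.hasSum_norm (p := 2) (by norm_num) φ
  simpa using this

theorem lp_norm_le_of_le {φ ψ : lp (fun _ : I => E) 2} (h : ∀ i, ‖φ i‖ ≤ ‖ψ i‖) : ‖φ‖ ≤ ‖ψ‖ := by
  have h1 := hasSum_le (fun i => pow_le_pow_left₀ (norm_nonneg _) (h i) 2)
    (hasSum_norm_sq φ) (hasSum_norm_sq ψ)
  exact (sq_le_sq₀ (norm_nonneg _) (norm_nonneg _)).1 h1

theorem lp_norm_le_two_mul_add {φ ψ ρ : lp (fun _ : I => E) 2} {a b : ℝ} (ha : 0 ≤ a) (hb : 0 ≤ b)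
    (h : ∀ i, a * ‖φ i‖ ≤ ‖ψ i‖ + b * ‖ρ i‖) : a * ‖φ‖ ≤ 2 * (‖ψ‖ + b * ‖ρ‖) := by
  have h1 : ∀ i, a ^ 2 * ‖φ i‖ ^ 2 ≤ 2 * ‖ψ i‖ ^ 2 + 2 * b ^ 2 * ‖ρ i‖ ^ 2 := fun i => by
    have h2 := pow_le_pow_left₀ (by positivity) (h i) 2
    nlinarith [sq_nonneg (‖ψ i‖ - b * ‖ρ i‖)]
  have h2 := hasSum_le h1 ((hasSum_norm_sq φ).mul_left (a ^ 2))
    (((hasSum_norm_sq ψ).mul_left 2).add ((hasSum_norm_sq ρ).mul_left (2 * b ^ 2)))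
  refine (sq_le_sq₀ (by positivity) (by positivity)).1 ?_
  nlinarith [sq_nonneg (‖ψ‖ + b * ‖ρ‖), mul_nonneg (norm_nonneg ψ) (mul_nonneg hb (norm_nonneg ρ))]

variable [InnerProductSpace ℂ E]

theorem im_inner_mapCLM_eq_zero {T : I → E →L[ℂ] E} {K : ℝ} (hK : 0 ≤ K) (hT : ∀ i, ‖T i‖ ≤ K)
    (h : ∀ i f, (inner ℂ f (T i f)).im = 0) (φ : lp (fun _ : I => E) 2) :
    (inner ℂ φ (lp.mapCLM 2 T hK hT φ)).im = 0 := by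
  have h1 := Complex.hasSum_im (lp.hasSum_inner (𝕜 := ℂ) φ (lp.mapCLM 2 T hK hT φ))
  refine h1.unique ?_
  convert hasSum_zero with i
  exact h i (φ i)

/-- Strong continuity reduces to convergence of `∑ ⟨φ i, S_t (φ i)⟩`, which is dominated by `∑ ‖φ
i‖²`. -/
theorem IsContractionSemigroup.lift {S : ℝ≥0 → E →L[ℂ] E} (hS : IsContractionSemigroup S) :
    IsContractionSemigroup fun t : ℝ≥0 =>
      lp.mapCLM 2 (fun _ : I => S t) (norm_nonneg (S t)) (fun _ => le_rfl) where
  zero := by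
    ext φ i
    change S 0 (φ i) = φ i
    rw [hS.zero, one_apply_eq_self]
  add s t := by
    ext φ i
    change S (s + t) (φ i) = S s (S t (φ i))
    rw [hS.add, mul_apply_eq_comp]
  norm_le t := (lp.norm_mapCLM_le 2 (fun _ : I => S t) _ _).trans (hS.norm_le t)
  tendsto φ := by
    have hn : ∀ t, ‖lp.mapCLM 2 (fun _ : I => S t) (norm_nonneg (S t)) (fun _ => le_rfl)‖ ≤ 1 :=
      fun t => (lp.norm_mapCLM_le 2 (fun _ : I => S t) _ _).trans (hS.norm_le t)
    refine tendsto_of_inner_self_tendsto hn ?_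
    have hc : ∀ t, inner ℂ φ (lp.mapCLM 2 (fun _ : I => S t) (norm_nonneg (S t))
        (fun _ => le_rfl) φ) = ∑' i, inner ℂ (φ i) (S t (φ i)) := fun t => lp.inner_eq_tsum _ _
    simp_rw [hc]
    rw [lp.inner_eq_tsum]
    refine tendsto_tsum_of_dominated_convergence (f := fun t i => inner ℂ (φ i) (S t (φ i)))
      (hasSum_norm_sq φ).summable (fun i => ?_) (.of_forall fun t i => ?_)
    · exact tendsto_const_nhds.inner (hS.tendsto (φ i))
    · rw [sq]
      exact (norm_inner_le_norm _ _).trans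
        (mul_le_mul_of_nonneg_left (hS.norm_apply_le t _) (norm_nonneg _))

theorem lift_generator_apply {S : ℝ≥0 → E →L[ℂ] E}
    (φ : (generator fun t : ℝ≥0 =>
      lp.mapCLM 2 (fun _ : I => S t) (norm_nonneg (S t)) (fun _ => le_rfl)).domain) (i : I) :
    ∃ hi : (φ : lp (fun _ : I => E) 2) i ∈ (generator S).domain,
      generator S ⟨(φ : lp (fun _ : I => E) 2) i, hi⟩ = generator (fun t : ℝ≥0 =>
        lp.mapCLM 2 (fun _ : I => S t) (norm_nonneg (S t)) (fun _ => le_rfl)) φ i := by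
  have h := ((lp.evalCLM ℂ (fun _ : I => E) 2 i).continuous.tendsto _).comp (generator_tendsto φ)
  exact exists_generator_eq h

end HilbertSum

/-! ### The hopping operator as a combination of unitary translations. -/

section UnitaryRepresentation

variable {E G : Type*} [NormedAddCommGroup E] [InnerProductSpace ℂ E] [CompleteSpace E]
  [AddCommGroup G]

/-- A contraction whose inverse is a contraction is isometric; being invertible it is unitary, so
its adjoint is its inverse. -/
theorem star_eq_neg_of_norm_le_one {W : G → E →L[ℂ] E} (h0 : W 0 = 1)
    (hadd : ∀ ξ η, W (ξ + η) = W ξ * W η) (hn : ∀ ξ, ‖W ξ‖ ≤ 1) (ξ : G) : star (W ξ) = W (-ξ) := by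
  have hle : ∀ ξ f, ‖W ξ f‖ ≤ ‖f‖ := fun ξ f => by simpa using (W ξ).le_of_opNorm_le (hn ξ) f
  have hiso : ∀ f, ‖W ξ f‖ = ‖f‖ := fun f => by
    refine le_antisymm (hle ξ f) ?_
    have h1 := hle (-ξ) (W ξ f)
    rwa [← mul_apply_eq_comp, ← hadd, neg_add_cancel, h0, one_apply_eq_self] at h1
  have h1 : star (W ξ) * W ξ = 1 :=
    (ContinuousLinearMap.norm_map_iff_adjoint_comp_self (W ξ)).1 hiso
  calc star (W ξ) = star (W ξ) * (W ξ * W (-ξ)) := by rw [← hadd, add_neg_cancel, h0, mul_one]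
    _ = W (-ξ) := by rw [← mul_assoc, h1, one_mul]

end UnitaryRepresentation

section Hopping

variable {d : ℕ} {Ω : Type u} [MeasurableSpace Ω] {μ : Measure Ω}

/-- The translation `φ(x, σ) ↦ φ(x - ξ, σ)`. -/
noncomputable def shiftOp (p : Fin d → ℕ) (μ : Measure Ω) (ξ : Fin d → ℤ) : FibreSpace p μ →L[ℂ] FibreSpace p μ :=
  reindex (Equiv.subRight (ξ, 0))

theorem shiftOp_apply {p : Fin d → ℕ} (ξ : Fin d → ℤ) (φ : FibreSpace p μ) (x : Fin d → ℤ) (σ : Cell p) :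
    shiftOp p μ ξ φ (x, σ) = φ (x - ξ, σ) := by
  change φ (x - ξ, σ - 0) = _
  rw [sub_zero]

theorem norm_reindex_le {X E : Type*} [NormedAddCommGroup E] [NormedSpace ℂ E] (e : X ≃ X) :
    ‖(reindex e : lp (fun _ : X => E) 2 →L[ℂ] lp (fun _ : X => E) 2)‖ ≤ 1 :=
  LinearMap.mkContinuous_norm_le _ zero_le_one _

theorem norm_shiftOp_le (p : Fin d → ℕ) (ξ : Fin d → ℤ) : ‖shiftOp p μ ξ‖ ≤ 1 := norm_reindex_le _

theorem shiftOp_zero (p : Fin d → ℕ) : shiftOp p μ 0 = 1 := by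
  ext φ ⟨x, σ⟩
  rw [shiftOp_apply, sub_zero, one_apply_eq_self]

theorem shiftOp_add (p : Fin d → ℕ) (ξ η : Fin d → ℤ) :
    shiftOp p μ (ξ + η) = shiftOp p μ ξ * shiftOp p μ η := by
  refine ContinuousLinearMap.ext fun φ => lp.ext (funext fun ⟨x, σ⟩ => ?_)
  rw [mul_apply_eq_comp, shiftOp_apply, shiftOp_apply, shiftOp_apply, sub_sub]

theorem toCell_zero (p : Fin d → ℕ) : toCell p 0 = 0 := by
  ext j; simp [toCell]

theorem toCell_add (p : Fin d → ℕ) (ξ η : Fin d → ℤ) : toCell p (ξ + η) = toCell p ξ + toCell p η := by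
  ext j; simp [toCell]

variable [TopologicalSpace Ω] (M : MarkovEnvironment d μ) (p : Fin d → ℕ)

/-- The twisted translation `φ(x, σ) ↦ φ(x - ξ, σ - ξ) ∘ τ_ξ`. -/
noncomputable def twistedShiftOp (ξ : Fin d → ℤ) : FibreSpace p μ →L[ℂ] FibreSpace p μ :=
  lp.mapCLM 2 (fun _ => (M.koopman ξ).toContinuousLinearMap) zero_le_one
    (fun _ => (M.koopman ξ).norm_toContinuousLinearMap_le) ∘L
      reindex (Equiv.subRight (ξ, toCell p ξ))

theorem twistedShiftOp_apply (ξ : Fin d → ℤ) (φ : FibreSpace p μ) (x : Fin d → ℤ) (σ : Cell p) :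
    twistedShiftOp M p ξ φ (x, σ) = M.koopman ξ (φ (x - ξ, σ - toCell p ξ)) := rfl

theorem norm_twistedShiftOp_le (ξ : Fin d → ℤ) : ‖twistedShiftOp M p ξ‖ ≤ 1 :=
  (ContinuousLinearMap.opNorm_comp_le _ _).trans
    (mul_le_one₀ (lp.norm_mapCLM_le _ _ _ _) (norm_nonneg _) (norm_reindex_le _))

theorem koopman_zero : M.koopman 0 = LinearIsometry.id := by
  ext1 f
  apply Lp.ext
  refine (Lp.coeFn_compMeasurePreserving f (M.τ_measurePreserving 0)).trans ?_
  rw [M.τ_zero]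
  rfl

theorem koopman_add (ξ η : Fin d → ℤ) (f : Lp ℂ 2 μ) :
    M.koopman (ξ + η) f = M.koopman ξ (M.koopman η f) := by
  apply Lp.ext
  refine (Lp.coeFn_compMeasurePreserving f (M.τ_measurePreserving (ξ + η))).trans ?_
  refine EventuallyEq.trans ?_
    (Lp.coeFn_compMeasurePreserving (M.koopman η f) (M.τ_measurePreserving ξ)).symm
  refine EventuallyEq.trans ?_ ((M.τ_measurePreserving ξ).quasiMeasurePreserving.ae_eq_comp
    (Lp.coeFn_compMeasurePreserving f (M.τ_measurePreserving η))).symm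
  -- Composition reverses the order of the translations; commutativity of `ℤ^d` restores it.
  rw [add_comm ξ η, M.τ_add]
  rfl

theorem twistedShiftOp_zero : twistedShiftOp M p 0 = 1 := by
  refine ContinuousLinearMap.ext fun φ => lp.ext (funext fun ⟨x, σ⟩ => ?_)
  rw [twistedShiftOp_apply, toCell_zero, sub_zero, sub_zero, koopman_zero, one_apply_eq_self]
  rfl

theorem twistedShiftOp_add (ξ η : Fin d → ℤ) :
    twistedShiftOp M p (ξ + η) = twistedShiftOp M p ξ * twistedShiftOp M p η := by
  refine ContinuousLinearMap.ext fun φ => lp.ext (funext fun ⟨x, σ⟩ => ?_)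
  rw [mul_apply_eq_comp, twistedShiftOp_apply, twistedShiftOp_apply, twistedShiftOp_apply,
    koopman_add, toCell_add, sub_sub, sub_sub]

variable {p} {h : (Fin d → ℤ) → ℂ}

theorem summable_smul_of_norm_le {A : Type*} [NormedAddCommGroup A] [NormedSpace ℂ A]
    [CompleteSpace A] (hs : Summable fun ξ => ‖h ξ‖)
    {W : (Fin d → ℤ) → A} (hW : ∀ ξ, ‖W ξ‖ ≤ 1) : Summable fun ξ => h ξ • W ξ := by
  refine Summable.of_norm_bounded hs fun ξ => ?_
  rw [norm_smul]
  exact mul_le_of_le_one_right (norm_nonneg _) (hW ξ)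

theorem hasSum_kHat (hs : Summable fun ξ => ‖h ξ‖) :
    HasSum (fun ξ => h ξ • (shiftOp p μ ξ - twistedShiftOp M p ξ)) (kHat M p h) := by
  have h1 := (summable_smul_of_norm_le hs (norm_shiftOp_le p (μ := μ))).sub
    (summable_smul_of_norm_le hs (norm_twistedShiftOp_le M p))
  simp_rw [← smul_sub] at h1
  exact h1.hasSum

theorem hasSum_kHat_apply (hs : Summable fun ξ => ‖h ξ‖) (φ : FibreSpace p μ) (x : Fin d → ℤ)
    (σ : Cell p) :
    HasSum (fun ξ => h ξ • (φ (x - ξ, σ) - M.koopman ξ (φ (x - ξ, σ - toCell p ξ))))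
      (kHat M p h φ (x, σ)) := by
  have h1 := ((ContinuousLinearMap.apply ℂ (FibreSpace p μ) φ).hasSum
    (hasSum_kHat M (p := p) hs)).mapL (lp.evalCLM ℂ _ 2 (x, σ))
  refine HasSum.congr_fun (f := fun ξ => h ξ • (shiftOp p μ ξ φ (x, σ) -
    twistedShiftOp M p ξ φ (x, σ))) h1 fun ξ => ?_
  rw [shiftOp_apply, twistedShiftOp_apply]

/-- The plain and the twisted translations are two unitary representations of `ℤ^d`, and each
contributes `hopNorm h`. -/
theorem norm_kHat_le (hs : Summable fun ξ => ‖h ξ‖) : ‖kHat M p h‖ ≤ 2 * hopNorm h := by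
  have h1 := (summable_smul_of_norm_le hs (norm_shiftOp_le p (μ := μ))).hasSum
  have h2 := (summable_smul_of_norm_le hs (norm_twistedShiftOp_le M p)).hasSum
  have h3 := (hasSum_kHat M (p := p) hs)
  simp_rw [smul_sub] at h3
  rw [h3.unique (h1.sub h2), two_mul]
  refine (norm_sub_le _ _).trans (add_le_add ?_ ?_)
  · exact norm_tsum_smul_le_hopNorm (shiftOp_zero p) (shiftOp_add p)
      (star_eq_neg_of_norm_le_one (shiftOp_zero p) (shiftOp_add p) (norm_shiftOp_le p)) hs h1
  · exact norm_tsum_smul_le_hopNorm (twistedShiftOp_zero M p) (twistedShiftOp_add M p)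
      (star_eq_neg_of_norm_le_one (twistedShiftOp_zero M p) (twistedShiftOp_add M p)
        (norm_twistedShiftOp_le M p)) hs h2

theorem isSelfAdjoint_kHat (hh : IsHoppingKernel h) : IsSelfAdjoint (kHat M p h) := by
  have h1 := hasSum_kHat M (p := p) hh.summable_norm
  have h2 := (Equiv.neg (Fin d → ℤ)).hasSum_iff.2 h1
  refine h1.star.unique (h2.congr_fun fun ξ => ?_)
  rw [star_smul, star_sub, star_eq_neg_of_norm_le_one (shiftOp_zero p) (shiftOp_add p)
    (norm_shiftOp_le p), star_eq_neg_of_norm_le_one (twistedShiftOp_zero M p)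
    (twistedShiftOp_add M p) (norm_twistedShiftOp_le M p), ← hh.selfAdjoint]
  rfl

theorem im_inner_kHat (hh : IsHoppingKernel h) (φ : FibreSpace p μ) :
    (inner ℂ φ (kHat M p h φ)).im = 0 := by
  have h1 := (ContinuousLinearMap.isSelfAdjoint_iff_isSymmetric.1
    (isSelfAdjoint_kHat M (p := p) hh))
  exact h1.im_inner_self_apply φ

end Hopping

/-! ### Mean and fluctuation at a single site; inverting `B` on mean zero functions. -/

section MeanProjection

variable {Ω : Type u} [MeasurableSpace Ω] {μ : Measure Ω} [IsProbabilityMeasure μ]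

/-- The orthogonal projection of `L²(μ)` onto the constants. -/
noncomputable def meanProj (μ : Measure Ω) [IsProbabilityMeasure μ] : Lp ℂ 2 μ →L[ℂ] Lp ℂ 2 μ :=
  (innerSL ℂ (oneL2 μ)).smulRight (oneL2 μ)

theorem meanProj_apply (f : Lp ℂ 2 μ) : meanProj μ f = inner ℂ (oneL2 μ) f • oneL2 μ := rfl

theorem inner_oneL2_self : inner ℂ (oneL2 μ) (oneL2 μ) = 1 := by
  rw [inner_self_eq_norm_sq_to_K, norm_oneL2]
  simp

theorem norm_meanProj_apply (f : Lp ℂ 2 μ) : ‖meanProj μ f‖ = ‖inner ℂ (oneL2 μ) f‖ := by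
  rw [meanProj_apply, norm_smul, norm_oneL2, mul_one]

theorem norm_meanProj_le : ‖meanProj μ‖ ≤ 1 := by
  refine ContinuousLinearMap.opNorm_le_bound _ zero_le_one fun f => ?_
  rw [norm_meanProj_apply]
  simpa [norm_oneL2] using norm_inner_le_norm (𝕜 := ℂ) (oneL2 μ) f

theorem inner_oneL2_meanProj (f : Lp ℂ 2 μ) :
    inner ℂ (oneL2 μ) (meanProj μ f) = inner ℂ (oneL2 μ) f := by
  rw [meanProj_apply, inner_smul_right, inner_oneL2_self, mul_one]

theorem norm_sq_eq_add_meanProj (f : Lp ℂ 2 μ) :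
    ‖f‖ ^ 2 = ‖f - meanProj μ f‖ ^ 2 + ‖meanProj μ f‖ ^ 2 := by
  have h0 : inner ℂ (oneL2 μ) (f - meanProj μ f) = 0 := by
    rw [inner_sub_right, inner_oneL2_meanProj, sub_self]
  have h : inner ℂ (f - meanProj μ f) (meanProj μ f) = 0 := by
    refine (inner_smul_right (f - meanProj μ f) (oneL2 μ) _).trans ?_
    rw [inner_eq_zero_symm.1 h0, mul_zero]
  have := norm_add_sq_eq_norm_sq_add_norm_sq_of_inner_eq_zero _ _ h
  rw [sub_add_cancel] at this
  simpa only [sq] using this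

theorem inner_meanProj_self (f : Lp ℂ 2 μ) :
    inner ℂ f (meanProj μ f) = ((‖meanProj μ f‖ ^ 2 : ℝ) : ℂ) := by
  refine (inner_smul_right f (oneL2 μ) (inner ℂ (oneL2 μ) f)).trans ?_
  rw [norm_meanProj_apply, ← inner_conj_symm f, Complex.mul_conj']
  norm_cast

theorem norm_one_sub_meanProj_le : ‖1 - meanProj μ‖ ≤ 1 := by
  refine ContinuousLinearMap.opNorm_le_bound _ zero_le_one fun f => ?_
  rw [one_mul]
  refine (sq_le_sq₀ (norm_nonneg _) (norm_nonneg _)).1 ?_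
  have := norm_sq_eq_add_meanProj f
  change ‖f - meanProj μ f‖ ^ 2 ≤ _
  nlinarith [sq_nonneg ‖meanProj μ f‖]

end MeanProjection

section SingleSite

variable {d : ℕ} {Ω : Type u} [TopologicalSpace Ω] [MeasurableSpace Ω] {μ : Measure Ω}
  [IsProbabilityMeasure μ] (M : MarkovEnvironment d μ)

theorem meanProj_koopman (ξ : Fin d → ℤ) (f : Lp ℂ 2 μ) :
    meanProj μ (M.koopman ξ f) = meanProj μ f := by
  rw [meanProj_apply, meanProj_apply, ← (M.koopman ξ).inner_map_map (oneL2 μ) f]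
  rfl

theorem koopman_oneL2 (ξ : Fin d → ℤ) : M.koopman ξ (oneL2 μ) = oneL2 μ := rfl

theorem koopman_meanProj (ξ : Fin d → ℤ) (f : Lp ℂ 2 μ) :
    M.koopman ξ (meanProj μ f) = meanProj μ f := by
  rw [meanProj_apply, map_smul, koopman_oneL2]

theorem B_oneL2 : ∃ h : oneL2 μ ∈ M.B.domain, M.B ⟨oneL2 μ, h⟩ = 0 := by
  refine exists_generator_eq ?_
  simp [M.semigroup_oneL2]

theorem inner_oneL2_B (f : M.B.domain) : inner ℂ (oneL2 μ) (M.B f) = 0 := by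
  have h := ((innerSL ℂ (oneL2 μ)).continuous.tendsto _).comp
    (generator_tendsto (S := M.semigroup) f)
  refine tendsto_nhds_unique h (tendsto_const_nhds.congr fun t => ?_)
  rw [Function.comp_apply, innerSL_apply_apply, inner_smul_right, inner_sub_right,
    M.inner_oneL2_semigroup, sub_self, mul_zero]

variable {M} {T : ℝ}

theorem gap_re_inner (hgap : M.HasGap T) (f : M.B.domain) :
    1 / T * ‖(f : Lp ℂ 2 μ) - meanProj μ f‖ ^ 2 ≤ (inner ℂ (f : Lp ℂ 2 μ) (M.B f)).re := by
  have := hgap f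
  rwa [const_eq_smul_oneL2, ← inner_oneL2, ← meanProj_apply] at this

/-- This is the bound `‖B⁻¹‖ ≤ T` on mean zero functions. -/
theorem norm_le_of_gap (hT : 0 < T) (hgap : M.HasGap T) (f : M.B.domain)
    (hf : inner ℂ (oneL2 μ) (f : Lp ℂ 2 μ) = 0) : ‖(f : Lp ℂ 2 μ)‖ ≤ T * ‖M.B f‖ := by
  have h := gap_re_inner hgap f
  rw [meanProj_apply, hf, zero_smul, sub_zero] at h
  have h2 : (inner ℂ (f : Lp ℂ 2 μ) (M.B f)).re ≤ ‖(f : Lp ℂ 2 μ)‖ * ‖M.B f‖ :=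
    re_inner_le_norm (𝕜 := ℂ) _ _
  rcases (norm_nonneg (f : Lp ℂ 2 μ)).eq_or_lt with h0 | h0
  · rw [← h0]; positivity
  · have h3 := h.trans h2
    rw [one_div, inv_mul_le_iff₀ hT] at h3
    refine le_of_mul_le_mul_left ?_ h0
    nlinarith

/-- On mean zero functions the generator is surjective. -/
theorem exists_B_eq [CompactSpace Ω] [T2Space Ω] [BorelSpace Ω] [μ.Regular] (hT : 0 < T)
    (hgap : M.HasGap T) {y : Lp ℂ 2 μ} (hy : inner ℂ (oneL2 μ) y = 0) :
    ∃ f : M.B.domain, inner ℂ (oneL2 μ) (f : Lp ℂ 2 μ) = 0 ∧ M.B f = y := by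
  -- Adding `T⁻¹` times the mean projection fills in the kernel of `B`, so the sum is bounded below
  -- by `T⁻¹` on all of `L²(Ω)`.
  have hlow : ∀ z : ℂ, z.re ≤ 0 → ∀ f : M.B.domain, T⁻¹ * ‖(f : Lp ℂ 2 μ)‖ ≤
      ‖M.B f + (((T⁻¹ : ℝ) : ℂ) • meanProj μ - z • (1 : Lp ℂ 2 μ →L[ℂ] Lp ℂ 2 μ)) f‖ := by
    intro z hz f
    set η := M.B f + (((T⁻¹ : ℝ) : ℂ) • meanProj μ - z • (1 : Lp ℂ 2 μ →L[ℂ] Lp ℂ 2 μ)) f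
      with hη
    have h1 := gap_re_inner hgap f
    have h2 : (inner ℂ (f : Lp ℂ 2 μ) η).re ≤ ‖(f : Lp ℂ 2 μ)‖ * ‖η‖ :=
      re_inner_le_norm (𝕜 := ℂ) _ _
    have h3 : (inner ℂ (f : Lp ℂ 2 μ) η).re = (inner ℂ (f : Lp ℂ 2 μ) (M.B f)).re +
        T⁻¹ * ‖meanProj μ f‖ ^ 2 - z.re * ‖(f : Lp ℂ 2 μ)‖ ^ 2 := by
      have h5 : inner ℂ (f : Lp ℂ 2 μ) (f : Lp ℂ 2 μ) = ((‖(f : Lp ℂ 2 μ)‖ ^ 2 : ℝ) : ℂ) := by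
        rw [inner_self_eq_norm_sq_to_K]; norm_cast
      rw [hη, inner_add_right, sub_apply, smul_apply, smul_apply, one_apply_eq_self,
        inner_sub_right, inner_smul_right, inner_smul_right, inner_meanProj_self, h5]
      simp only [Complex.add_re, Complex.sub_re, Complex.ofReal_re,
        Complex.re_mul_ofReal]
      ring
    have h6 := norm_sq_eq_add_meanProj (f : Lp ℂ 2 μ)
    rw [one_div] at h1
    rcases (norm_nonneg (f : Lp ℂ 2 μ)).eq_or_lt with h0 | h0
    · rw [← h0]; simp
    · refine le_of_mul_le_mul_left ?_ h0
      have h7 : z.re * ‖(f : Lp ℂ 2 μ)‖ ^ 2 ≤ 0 := mul_nonpos_of_nonpos_of_nonneg hz (by positivity)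
      have h8 : T⁻¹ * ‖(f : Lp ℂ 2 μ)‖ ^ 2 =
          T⁻¹ * ‖(f : Lp ℂ 2 μ) - meanProj μ f‖ ^ 2 + T⁻¹ * ‖meanProj μ f‖ ^ 2 := by
        rw [h6]; ring
      nlinarith
  obtain ⟨f, hf'⟩ : ∃ f : M.B.domain, M.B f + (((T⁻¹ : ℝ) : ℂ) • meanProj μ) f = y := by
    simpa using! M.isContractionSemigroup.surjective_of_uniform_lower_bound
      (((T⁻¹ : ℝ) : ℂ) • meanProj μ) (inv_pos.2 hT) hlow (z := 0) le_rfl y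
  -- Pairing with `1` shows that the solution has mean zero, so the added term vanishes on it.
  have h1 := congrArg (inner ℂ (oneL2 μ)) hf'
  rw [inner_add_right, inner_oneL2_B, smul_apply, inner_smul_right, inner_oneL2_meanProj, hy,
    zero_add, mul_eq_zero, Complex.ofReal_eq_zero] at h1
  have h2 := h1.resolve_left (inv_pos.2 hT).ne'
  refine ⟨f, h2, ?_⟩
  rw [smul_apply, meanProj_apply, h2, zero_smul, smul_zero, add_zero] at hf'
  exact hf'

end SingleSite

/-! ### Multiplication by the random potential. -/

section Multiplication

variable {Ω : Type u} [MeasurableSpace Ω] {μ : Measure Ω}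

theorem coeFn_mulOp (a : Lp ℝ ∞ μ) (f : Lp ℂ 2 μ) :
    mulOp a f =ᵐ[μ] fun ω => (a ω : ℂ) * f ω := by
  filter_upwards [Lp.coeFn_lpSMul (r := 2) a f] with ω hω
  exact hω.trans (Complex.real_smul)

theorem im_inner_mulOp (a : Lp ℝ ∞ μ) (f : Lp ℂ 2 μ) : (inner ℂ f (mulOp a f)).im = 0 := by
  rw [L2.inner_def]
  have h : (fun ω => inner ℂ (f ω) (mulOp a f ω)) =ᵐ[μ]
      fun ω => ((a ω * ‖f ω‖ ^ 2 : ℝ) : ℂ) := by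
    filter_upwards [coeFn_mulOp a f] with ω hω
    rw [hω, RCLike.inner_apply, mul_assoc, Complex.mul_conj']
    push_cast
    ring
  rw [integral_congr_ae h, integral_complex_ofReal, Complex.ofReal_im]

variable [IsProbabilityMeasure μ]

theorem coeFn_mulOp_oneL2 (a : Lp ℝ ∞ μ) :
    mulOp a (oneL2 μ) =ᵐ[μ] fun ω => (a ω : ℂ) := by
  filter_upwards [coeFn_mulOp a (oneL2 μ), Lp.coeFn_const (p := 2) (μ := μ) (1 : ℂ)] with ω h1 h2
  rw [h1]
  have : oneL2 μ ω = 1 := h2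
  rw [this, mul_one]

theorem inner_oneL2_mulOp_oneL2 (a : Lp ℝ ∞ μ) :
    inner ℂ (oneL2 μ) (mulOp a (oneL2 μ)) = ((∫ ω, a ω ∂μ : ℝ) : ℂ) := by
  rw [inner_oneL2, integral_congr_ae (coeFn_mulOp_oneL2 a), integral_complex_ofReal]

end Multiplication

section Potential

variable {d : ℕ} {Ω : Type u} [TopologicalSpace Ω] [MeasurableSpace Ω] {μ : Measure Ω}
  (M : MarkovEnvironment d μ) (v : Lp ℝ ∞ μ)

/-- The potential difference `v ∘ τ_x - v`. -/
noncomputable def potDiff (x : Fin d → ℤ) : Lp ℝ ∞ μ :=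
  Lp.compMeasurePreserving (M.τ x) (M.τ_measurePreserving x) v - v

theorem coeFn_potDiff (x : Fin d → ℤ) : potDiff M v x =ᵐ[μ] fun ω => v (M.τ x ω) - v ω := by
  filter_upwards [Lp.coeFn_sub (Lp.compMeasurePreserving (M.τ x) (M.τ_measurePreserving x) v) v,
    Lp.coeFn_compMeasurePreserving v (M.τ_measurePreserving x)] with ω h1 h2
  exact h1.trans (by rw [Pi.sub_apply, h2, Function.comp_apply])

theorem integral_potDiff [IsFiniteMeasure μ] (x : Fin d → ℤ) : ∫ ω, potDiff M v x ω ∂μ = 0 := by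
  have hv : Integrable v μ := (Lp.memLp v).integrable le_top
  have h1 : Integrable (fun ω => v (M.τ x ω)) μ :=
    (M.τ_measurePreserving x).integrable_comp_of_integrable hv
  rw [integral_congr_ae (coeFn_potDiff M v x), integral_sub h1 hv, sub_eq_zero]
  have h2 := integral_map (M.τ_measurePreserving x).measurable.aemeasurable (f := v)
    (by rw [(M.τ_measurePreserving x).map_eq]; exact Lp.aestronglyMeasurable v)
  rw [(M.τ_measurePreserving x).map_eq] at h2
  exact h2.symm

theorem mulOp_potDiff_zero (f : Lp ℂ 2 μ) : mulOp (potDiff M v 0) f = 0 := by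
  apply Lp.ext
  filter_upwards [coeFn_mulOp (potDiff M v 0) f, coeFn_potDiff M v 0,
    Lp.coeFn_zero ℂ 2 μ] with ω h1 h2 h3
  rw [h1, h2, h3, M.τ_zero]
  simp

variable [IsProbabilityMeasure μ] {M v} {χ T : ℝ}

theorem exists_B_eq_potDiff [CompactSpace Ω] [T2Space Ω] [BorelSpace Ω] [μ.Regular] (hT : 0 < T)
    (hgap : M.HasGap T) (hv : M.IsNondegeneratePotential v χ) {x : Fin d → ℤ} (hx : x ≠ 0) :
    ∃ f : M.B.domain, inner ℂ (oneL2 μ) (f : Lp ℂ 2 μ) = 0 ∧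
      M.B f = mulOp (potDiff M v x) (oneL2 μ) ∧ χ ≤ ‖(f : Lp ℂ 2 μ)‖ := by
  obtain ⟨f, hf, hBf⟩ := exists_B_eq hT hgap (y := mulOp (potDiff M v x) (oneL2 μ))
    (by rw [inner_oneL2_mulOp_oneL2, integral_potDiff, Complex.ofReal_zero])
  refine ⟨f, hf, hBf, hv.nondegenerate x 0 hx f (by rw [← inner_oneL2, hf]) ?_⟩
  rw [hBf]
  filter_upwards [coeFn_mulOp_oneL2 (potDiff M v x), coeFn_potDiff M v x] with ω h1 h2
  rw [h1, h2, M.τ_zero]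
  rfl

end Potential

/-! ### Projections, ground state and the terms of the fibre operator. -/

section FibreOperators

variable {d : ℕ} (p : Fin d → ℕ) {Ω : Type u} [MeasurableSpace Ω] (μ : Measure Ω)

section Projections

variable [IsProbabilityMeasure μ]

/-- The projection of the fibre space onto `ω`-independent functions. -/
noncomputable def meanHat : FibreSpace p μ →L[ℂ] FibreSpace p μ :=
  lp.mapCLM 2 (fun _ => meanProj μ) zero_le_one (fun _ => norm_meanProj_le)

/-- The projection of the fibre space onto functions of mean zero in `ω`. -/
noncomputable def fluctHat : FibreSpace p μ →L[ℂ] FibreSpace p μ :=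
  lp.mapCLM 2 (fun _ => 1 - meanProj μ) zero_le_one (fun _ => norm_one_sub_meanProj_le)

theorem meanHat_apply (φ : FibreSpace p μ) (i : (Fin d → ℤ) × Cell p) :
    meanHat p μ φ i = inner ℂ (oneL2 μ) (φ i) • oneL2 μ := rfl

theorem fluctHat_apply (φ : FibreSpace p μ) (i : (Fin d → ℤ) × Cell p) :
    fluctHat p μ φ i = φ i - inner ℂ (oneL2 μ) (φ i) • oneL2 μ := rfl

theorem norm_meanHat_le (φ : FibreSpace p μ) : ‖meanHat p μ φ‖ ≤ ‖φ‖ := by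
  simpa using (meanHat p μ).le_of_opNorm_le (lp.norm_mapCLM_le _ _ _ _) φ

theorem norm_fluctHat_le (φ : FibreSpace p μ) : ‖fluctHat p μ φ‖ ≤ ‖φ‖ := by
  simpa using (fluctHat p μ).le_of_opNorm_le (lp.norm_mapCLM_le _ _ _ _) φ

theorem meanHat_add_fluctHat (φ : FibreSpace p μ) : meanHat p μ φ + fluctHat p μ φ = φ :=
  lp.ext (funext fun _ => add_sub_cancel _ _)

theorem meanHat_meanHat (φ : FibreSpace p μ) : meanHat p μ (meanHat p μ φ) = meanHat p μ φ := by
  refine lp.ext (funext fun i => ?_)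
  rw [meanHat_apply, meanHat_apply, inner_smul_right, inner_oneL2_self, mul_one]

theorem fluctHat_meanHat (φ : FibreSpace p μ) : fluctHat p μ (meanHat p μ φ) = 0 := by
  have := meanHat_add_fluctHat p μ (meanHat p μ φ)
  rwa [meanHat_meanHat, add_eq_left] at this

theorem fluctHat_of_meanHat_eq_zero {φ : FibreSpace p μ} (h : meanHat p μ φ = 0) :
    fluctHat p μ φ = φ := by
  have := meanHat_add_fluctHat p μ φ
  rwa [h, zero_add] at this

end Projections

/-- The restriction of a function on the fibre space to `x = 0`. -/
noncomputable def originHat : FibreSpace p μ →L[ℂ] FibreSpace p μ :=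
  lp.mapCLM 2 (fun i : (Fin d → ℤ) × Cell p => if i.1 = 0 then 1 else 0) zero_le_one (fun i => by
    split_ifs
    · exact ContinuousLinearMap.norm_id_le
    · simp)

/-- The restriction of a function on the fibre space to `x ≠ 0`. -/
noncomputable def awayHat : FibreSpace p μ →L[ℂ] FibreSpace p μ :=
  lp.mapCLM 2 (fun i : (Fin d → ℤ) × Cell p => if i.1 = 0 then 0 else 1) zero_le_one (fun i => by
    split_ifs
    · simp
    · exact ContinuousLinearMap.norm_id_le)

theorem originHat_apply (φ : FibreSpace p μ) (i : (Fin d → ℤ) × Cell p) :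
    originHat p μ φ i = if i.1 = 0 then φ i else 0 := by
  change (if i.1 = 0 then (1 : Lp ℂ 2 μ →L[ℂ] Lp ℂ 2 μ) else 0) (φ i) = _
  split_ifs <;> rfl

theorem awayHat_apply (φ : FibreSpace p μ) (i : (Fin d → ℤ) × Cell p) :
    awayHat p μ φ i = if i.1 = 0 then 0 else φ i := by
  change (if i.1 = 0 then (0 : Lp ℂ 2 μ →L[ℂ] Lp ℂ 2 μ) else 1) (φ i) = _
  split_ifs <;> rfl

theorem norm_awayHat_le (φ : FibreSpace p μ) : ‖awayHat p μ φ‖ ≤ ‖φ‖ := by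
  refine lp_norm_le_of_le fun i => ?_
  rw [awayHat_apply]
  split_ifs <;> simp

theorem originHat_add_awayHat (φ : FibreSpace p μ) : originHat p μ φ + awayHat p μ φ = φ := by
  refine lp.ext (funext fun i => ?_)
  rw [lp.coeFn_add, Pi.add_apply, originHat_apply, awayHat_apply]
  split_ifs <;> simp

section Ground

variable [IsProbabilityMeasure μ] [∀ j, NeZero (p j)]

/-- The (unnormalised) ground state `δ₀ ⊗ 1 ⊗ 1`. -/
noncomputable def groundState : FibreSpace p μ :=
  ∑ σ : Cell p, lp.single 2 ((0, σ) : (Fin d → ℤ) × Cell p) (oneL2 μ)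

theorem groundState_apply (x : Fin d → ℤ) (σ : Cell p) :
    groundState p μ (x, σ) = if x = 0 then oneL2 μ else 0 := by
  rw [groundState, lp.coeFn_sum, Finset.sum_apply]
  simp only [lp.single_apply]
  split_ifs with hx
  · subst hx
    rw [Finset.sum_eq_single σ]
    · simp
    · intro τ _ hτ
      rw [Pi.single_eq_of_ne]
      simpa using hτ.symm
    · simp
  · refine Finset.sum_eq_zero fun τ _ => ?_
    rw [Pi.single_eq_of_ne]
    simpa using fun h => absurd h hx

theorem inner_groundState (φ : FibreSpace p μ) :
    inner ℂ (groundState p μ) φ = ∑ σ, inner ℂ (oneL2 μ) (φ (0, σ)) := by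
  rw [groundState, sum_inner]
  simp only [lp.inner_single_left]

theorem groundState_ne_zero : groundState p μ ≠ 0 := by
  intro h
  have h1 := congrArg (fun φ : FibreSpace p μ => φ (0, 0)) h
  have h2 : groundState p μ (0, 0) = 0 := h1
  rw [groundState_apply, if_pos rfl] at h2
  have h3 := norm_oneL2 (μ := μ)
  rw [h2, norm_zero] at h3
  exact zero_ne_one h3

theorem originHat_meanHat_groundState :
    originHat p μ (meanHat p μ (groundState p μ)) = groundState p μ := by
  refine lp.ext (funext fun ⟨x, σ⟩ => ?_)
  rw [originHat_apply, meanHat_apply, groundState_apply]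
  split_ifs with hx
  · rw [inner_oneL2_self, one_smul]
  · rfl

end Ground

variable {μ}

section PeriodicPotential

variable {p} [∀ j, NeZero (p j)] (u : PeriodicPotential p)

theorem uHat_apply (φ : FibreSpace p μ) (i : (Fin d → ℤ) × Cell p) :
    uHat u φ i = ((u.toFun (i.1 - ofCell i.2) - u.toFun (-ofCell i.2) : ℝ) : ℂ) • φ i := rfl

theorem norm_uHat_le : ‖(uHat u : FibreSpace p μ →L[ℂ] FibreSpace p μ)‖ ≤ 2 * u.supNorm :=
  lp.norm_mapCLM_le _ _ _ _

theorem im_inner_uHat (φ : FibreSpace p μ) : (inner ℂ φ (uHat u φ)).im = 0 := by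
  refine im_inner_mapCLM_eq_zero _ _ (fun i f => ?_) φ
  rw [smul_apply, inner_smul_right, Complex.im_ofReal_mul]
  have : (inner ℂ f f).im = 0 := inner_self_im (𝕜 := ℂ) f
  exact mul_eq_zero_of_right _ this

theorem uHat_originHat (φ : FibreSpace p μ) : uHat u (originHat p μ φ) = 0 := by
  refine lp.ext (funext fun i => ?_)
  rw [uHat_apply, originHat_apply]
  split_ifs with h
  · rw [h, zero_sub, sub_self, Complex.ofReal_zero, zero_smul]
    rfl
  · rw [smul_zero]
    rfl

theorem meanHat_uHat [IsProbabilityMeasure μ] (φ : FibreSpace p μ) :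
    meanHat p μ (uHat u φ) = uHat u (meanHat p μ φ) := by
  refine lp.ext (funext fun i => ?_)
  rw [meanHat_apply, uHat_apply, uHat_apply, meanHat_apply, inner_smul_right, mul_smul]

end PeriodicPotential

variable [TopologicalSpace Ω] (M : MarkovEnvironment d μ)

section RandomPotential

variable (v : Lp ℝ ∞ μ)

theorem vHat_apply (φ : FibreSpace p μ) (i : (Fin d → ℤ) × Cell p) :
    vHat M p v φ i = mulOp (potDiff M v i.1) (φ i) := rfl

theorem norm_vHat_le : ‖vHat M p v‖ ≤ 2 * ‖v‖ := lp.norm_mapCLM_le _ _ _ _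

theorem norm_smul_vHat_apply_le {M : MarkovEnvironment d μ} {p : Fin d → ℕ}
    {v : Lp ℝ ∞ μ} (hv : ‖v‖ = 1) {lam : ℝ} (hlam : 0 < lam)
    (φ : FibreSpace p μ) :
    ‖(lam : ℂ) • vHat M p v φ‖ ≤ 2 * lam * ‖φ‖ := by
  have h1 := (vHat M p v).le_of_opNorm_le (norm_vHat_le p M v) φ
  rw [hv, mul_one] at h1
  rw [norm_smul, Complex.norm_real, Real.norm_eq_abs, abs_of_pos hlam]
  nlinarith

theorem im_inner_vHat (φ : FibreSpace p μ) : (inner ℂ φ (vHat M p v φ)).im = 0 :=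
  im_inner_mapCLM_eq_zero _ _ (fun _ f => im_inner_mulOp _ f) φ

theorem vHat_originHat (φ : FibreSpace p μ) : vHat M p v (originHat p μ φ) = 0 := by
  refine lp.ext (funext fun i => ?_)
  rw [vHat_apply, originHat_apply]
  split_ifs with h
  · rw [h, mulOp_potDiff_zero]
    rfl
  · rw [map_zero]
    rfl

variable [IsProbabilityMeasure μ]

theorem vHat_meanHat_apply (φ : FibreSpace p μ) (i : (Fin d → ℤ) × Cell p) :
    vHat M p v (meanHat p μ φ) i =
      inner ℂ (oneL2 μ) (φ i) • mulOp (potDiff M v i.1) (oneL2 μ) := by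
  rw [vHat_apply, meanHat_apply, map_smul]

/-- The potential differences have mean zero, so `V̂` couples the constants only to fluctuations;
this is why the gap is of second order in `λ`. -/
theorem meanHat_vHat_meanHat (φ : FibreSpace p μ) :
    meanHat p μ (vHat M p v (meanHat p μ φ)) = 0 := by
  refine lp.ext (funext fun i => ?_)
  rw [meanHat_apply, vHat_meanHat_apply, inner_smul_right, inner_oneL2_mulOp_oneL2,
    integral_potDiff, Complex.ofReal_zero, mul_zero, zero_smul]
  rfl

end RandomPotential

section Kinetic

variable [IsProbabilityMeasure μ] {p} {h : (Fin d → ℤ) → ℂ}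

/-- Averaging over `ω` absorbs the measure-preserving twist `τ_ξ`. -/
theorem meanHat_kHat (hs : Summable fun ξ => ‖h ξ‖) (φ : FibreSpace p μ) :
    meanHat p μ (kHat M p h φ) = kHat M p h (meanHat p μ φ) := by
  refine lp.ext (funext fun ⟨x, σ⟩ => ?_)
  have h1 := (hasSum_kHat_apply M hs φ x σ).mapL (meanProj μ)
  have h2 := hasSum_kHat_apply M hs (meanHat p μ φ) x σ
  refine h1.unique (h2.congr_fun fun ξ => ?_)
  rw [map_smul, map_sub, meanProj_koopman]
  change _ = h ξ • (meanProj μ _ - M.koopman ξ (meanProj μ _))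
  rw [koopman_meanProj]

/-- Action of the hopping operator on functions concentrated at `x = 0` and constant in `ω`. -/
theorem kHat_originHat_meanHat_apply (hs : Summable fun ξ => ‖h ξ‖) (φ : FibreSpace p μ)
    (x : Fin d → ℤ) (σ : Cell p) :
    kHat M p h (originHat p μ (meanHat p μ φ)) (x, σ) =
      (h x * (inner ℂ (oneL2 μ) (φ (0, σ)) - inner ℂ (oneL2 μ) (φ (0, σ - toCell p x)))) •
        oneL2 μ := by
  have h1 := hasSum_kHat_apply M hs (originHat p μ (meanHat p μ φ)) x σ
  refine h1.unique ?_
  convert hasSum_single x fun ξ hξ => ?_ using 1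
  · rw [originHat_apply, originHat_apply, sub_self, if_pos rfl, if_pos rfl, meanHat_apply,
      meanHat_apply, map_smul, koopman_oneL2, ← sub_smul, smul_smul]
  · have : x - ξ ≠ 0 := fun h => hξ (sub_eq_zero.1 h).symm
    rw [originHat_apply, originHat_apply, if_neg this, if_neg this, map_zero, sub_zero, smul_zero]

theorem awayHat_kHat_originHat_meanHat (hh : IsHoppingKernel h) (φ : FibreSpace p μ) :
    awayHat p μ (kHat M p h (originHat p μ (meanHat p μ φ))) =
      kHat M p h (originHat p μ (meanHat p μ φ)) := by
  refine lp.ext (funext fun ⟨x, σ⟩ => ?_)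
  rw [awayHat_apply]
  split_ifs with hx
  · change x = 0 at hx
    rw [kHat_originHat_meanHat_apply M hh.summable_norm, hx, hh.zero, zero_mul, zero_smul]
  · rfl

theorem kHat_groundState [∀ j, NeZero (p j)]
    (hs : Summable fun ξ => ‖h ξ‖) : kHat M p h (groundState p μ) = 0 := by
  refine lp.ext (funext fun ⟨x, σ⟩ => ?_)
  rw [← originHat_meanHat_groundState, kHat_originHat_meanHat_apply M hs, groundState_apply,
    groundState_apply, sub_self, mul_zero, zero_smul]
  rfl

end Kinetic

section Generator

theorem bHat_apply (φ : (bHat M p).domain) (i : (Fin d → ℤ) × Cell p) :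
    ∃ hi : (φ : FibreSpace p μ) i ∈ M.B.domain,
      M.B ⟨(φ : FibreSpace p μ) i, hi⟩ = bHat M p φ i :=
  lift_generator_apply (S := M.semigroup) φ i

variable [IsProbabilityMeasure μ]

theorem meanHat_bHat (φ : (bHat M p).domain) : meanHat p μ (bHat M p φ) = 0 := by
  refine lp.ext (funext fun i => ?_)
  obtain ⟨hi, h⟩ := bHat_apply p M φ i
  rw [meanHat_apply, ← h, inner_oneL2_B, zero_smul]
  rfl

theorem bHat_groundState [∀ j, NeZero (p j)] : ∃ hg : groundState p μ ∈ (bHat M p).domain,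
    bHat M p ⟨groundState p μ, hg⟩ = 0 := by
  refine exists_generator_eq ?_
  have h : ∀ t, liftedSemigroup M p t (groundState p μ) = groundState p μ := fun t => by
    refine lp.ext (funext fun ⟨x, σ⟩ => ?_)
    change M.semigroup t (groundState p μ (x, σ)) = _
    rw [groundState_apply]
    split_ifs
    · exact M.semigroup_oneL2 t
    · exact map_zero _
  simp [h]

theorem inner_groundState_bHat [∀ j, NeZero (p j)]
    (φ : (bHat M p).domain) :
    inner ℂ (groundState p μ) (bHat M p φ) = 0 := by
  rw [inner_groundState]
  refine Finset.sum_eq_zero fun σ _ => ?_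
  obtain ⟨hi, h⟩ := bHat_apply p M φ (0, σ)
  rw [← h, inner_oneL2_B]

theorem gap_re_inner_bHat {T : ℝ} (hgap : M.HasGap T) (φ : (bHat M p).domain) :
    1 / T * ‖fluctHat p μ φ‖ ^ 2 ≤ (inner ℂ (φ : FibreSpace p μ) (bHat M p φ)).re := by
  refine hasSum_le (fun i => ?_) ((hasSum_norm_sq (fluctHat p μ φ)).mul_left (1 / T))
    (Complex.hasSum_re (lp.hasSum_inner (𝕜 := ℂ) (φ : FibreSpace p μ) (bHat M p φ)))
  obtain ⟨hi, h⟩ := bHat_apply p M φ i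
  rw [← h]
  exact gap_re_inner hgap ⟨_, hi⟩

end Generator

end FibreOperators

/-! ### The hopping form and its lowest eigenvalue on `{1}^⊥`. -/

section HoppingForm

variable {d : ℕ} {p : Fin d → ℕ} [∀ j, NeZero (p j)] {h : (Fin d → ℤ) → ℂ}

/-- The quadratic form whose lowest eigenvalue on `{1}^⊥` is the hopping constant. -/
noncomputable def hopForm (p : Fin d → ℕ) [∀ j, NeZero (p j)] (h : (Fin d → ℤ) → ℂ)
    (w : Cell p → ℂ) : ℝ :=
  ∑' ξ, ‖h ξ‖ ^ 2 * ∑ σ, ‖w σ - w (σ - toCell p ξ)‖ ^ 2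

theorem hopForm_nonneg (w : Cell p → ℂ) : 0 ≤ hopForm p h w :=
  tsum_nonneg fun _ => by positivity

theorem summable_norm_sq (hs : Summable fun ξ => ‖h ξ‖) : Summable fun ξ => ‖h ξ‖ ^ 2 := by
  refine Summable.of_nonneg_of_le (fun _ => by positivity) (fun ξ => ?_)
    (hs.mul_left (∑' ξ, ‖h ξ‖))
  rw [sq]
  exact mul_le_mul_of_nonneg_right (hs.le_tsum ξ fun _ _ => norm_nonneg _) (norm_nonneg _)

theorem sum_norm_sub_sq_le (w : Cell p → ℂ) (τ : Cell p) :
    ∑ σ, ‖w σ - w (σ - τ)‖ ^ 2 ≤ 4 * ∑ σ, ‖w σ‖ ^ 2 := by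
  have h1 : ∑ σ, ‖w (σ - τ)‖ ^ 2 = ∑ σ, ‖w σ‖ ^ 2 :=
    (Equiv.subRight τ).sum_comp fun σ => ‖w σ‖ ^ 2
  calc ∑ σ, ‖w σ - w (σ - τ)‖ ^ 2 ≤ ∑ σ, (2 * ‖w σ‖ ^ 2 + 2 * ‖w (σ - τ)‖ ^ 2) := by
        refine Finset.sum_le_sum fun σ _ => ?_
        have h2 := pow_le_pow_left₀ (norm_nonneg _) (norm_sub_le (w σ) (w (σ - τ))) 2
        nlinarith [sq_nonneg (‖w σ‖ - ‖w (σ - τ)‖)]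
    _ = 4 * ∑ σ, ‖w σ‖ ^ 2 := by
        rw [Finset.sum_add_distrib, ← Finset.mul_sum, ← Finset.mul_sum, h1]
        ring

theorem summable_hopForm (hs : Summable fun ξ => ‖h ξ‖) (w : Cell p → ℂ) :
    Summable fun ξ => ‖h ξ‖ ^ 2 * ∑ σ, ‖w σ - w (σ - toCell p ξ)‖ ^ 2 := by
  refine Summable.of_nonneg_of_le (fun _ => by positivity) (fun ξ => ?_)
    ((summable_norm_sq hs).mul_right (4 * ∑ σ, ‖w σ‖ ^ 2))
  exact mul_le_mul_of_nonneg_left (sum_norm_sub_sq_le w _) (by positivity)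

/-- The periods of `w` form a subgroup of `ℤ^d`. If the form vanishes, this subgroup contains the
support of `h`, hence is everything. -/
theorem eq_of_hopForm_eq_zero (hh : IsHoppingKernel h) {w : Cell p → ℂ} (hw : hopForm p h w = 0)
    (σ : Cell p) : w σ = w 0 := by
  have h1 := (hasSum_zero_iff_of_nonneg (fun ξ => by positivity)).1
    (hw ▸ (summable_hopForm hh.summable_norm w).hasSum :
      HasSum (fun ξ => ‖h ξ‖ ^ 2 * ∑ σ, ‖w σ - w (σ - toCell p ξ)‖ ^ 2) 0)
  let N : AddSubgroup (Fin d → ℤ) :=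
    { carrier := {ξ | ∀ σ, w (σ - toCell p ξ) = w σ}
      zero_mem' := fun σ => by rw [toCell_zero, sub_zero]
      add_mem' := fun {ξ η} hξ hη σ => by
        rw [toCell_add, ← sub_sub, hη, hξ]
      neg_mem' := fun {ξ} hξ σ => by
        have h2 : toCell p (-ξ) = -toCell p ξ := by
          rw [eq_neg_iff_add_eq_zero, ← toCell_add, neg_add_cancel, toCell_zero]
        rw [h2, ← hξ (σ - -toCell p ξ), sub_neg_eq_add, add_sub_cancel_right] }
  have hN : N = ⊤ := by
    rw [eq_top_iff, ← hh.nondegenerate, AddSubgroup.closure_le]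
    intro ξ hξ σ
    have h2 := congrFun h1 ξ
    simp only [Pi.zero_apply, mul_eq_zero, pow_eq_zero_iff, ne_eq, OfNat.ofNat_ne_zero,
      not_false_eq_true, norm_eq_zero] at h2
    have h3 := h2.resolve_left hξ
    rw [Finset.sum_eq_zero_iff_of_nonneg fun _ _ => by positivity] at h3
    have h4 := h3 σ (Finset.mem_univ σ)
    simp only [pow_eq_zero_iff, ne_eq, OfNat.ofNat_ne_zero, not_false_eq_true,
      norm_eq_zero] at h4
    exact (sub_eq_zero.1 h4).symm
  have h5 : ofCell σ ∈ N := hN ▸ AddSubgroup.mem_top _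
  have h6 : toCell p (ofCell σ) = σ := by
    ext j
    simp [toCell, ofCell]
  have h7 := h5 σ
  rw [h6, sub_self] at h7
  exact h7.symm

/-- The infimum is attained on a compact sphere. A minimiser of value zero would be constant with
zero sum, hence zero, against its normalisation. -/
theorem hoppingConstant_pos (hh : IsHoppingKernel h)
    (hne : Nonempty {w : Cell p → ℂ // ∑ σ, w σ = 0 ∧ ∑ σ, ‖w σ‖ ^ 2 = 1}) :
    0 < hoppingConstant p h := by
  set S : Set (Cell p → ℂ) := {w | ∑ σ, w σ = 0 ∧ ∑ σ, ‖w σ‖ ^ 2 = 1} with hS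
  have hle : ∀ w ∈ S, ∀ σ, ‖w σ‖ ≤ 1 := fun w hw σ => by
    have h1 : ‖w σ‖ ^ 2 ≤ 1 := hw.2 ▸
      Finset.single_le_sum (f := fun σ => ‖w σ‖ ^ 2) (fun _ _ => by positivity) (Finset.mem_univ σ)
    exact (sq_le_one_iff₀ (norm_nonneg _)).1 h1
  have hcomp : IsCompact S := by
    refine Metric.isCompact_of_isClosed_isBounded ?_ ?_
    · exact (isClosed_eq (by fun_prop) continuous_const).inter
        (isClosed_eq (by fun_prop) continuous_const)
    · refine (Metric.isBounded_closedBall (x := (0 : Cell p → ℂ)) (r := 1)).subset fun w hw => ?_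
      rw [mem_closedBall_zero_iff]
      exact (pi_norm_le_iff_of_nonneg zero_le_one).2 (hle w hw)
  have hcont : ContinuousOn (hopForm p h) S := by
    refine continuousOn_tsum (fun ξ => by fun_prop) ((summable_norm_sq hh.summable_norm).mul_right 4)
      fun ξ w hw => ?_
    rw [Real.norm_eq_abs, abs_of_nonneg (by positivity)]
    refine mul_le_mul_of_nonneg_left ?_ (by positivity)
    simpa [hw.2] using sum_norm_sub_sq_le w (toCell p ξ)
  obtain ⟨⟨w₁, hw₁⟩⟩ := hne
  obtain ⟨w₀, hw₀, hmin⟩ := hcomp.exists_isMinOn ⟨w₁, hw₁⟩ hcont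
  have hpos : 0 < hopForm p h w₀ := by
    refine lt_of_le_of_ne (hopForm_nonneg w₀) fun h0 => ?_
    have h1 := eq_of_hopForm_eq_zero hh h0.symm
    have h2 := hw₀.1
    simp_rw [h1] at h2
    rw [Finset.sum_const, smul_eq_zero] at h2
    have h3 : w₀ 0 = 0 := h2.resolve_left Finset.univ_nonempty.card_ne_zero
    have h4 := hw₀.2
    simp_rw [h1, h3] at h4
    simp at h4
  refine hpos.trans_le ?_
  have : Nonempty {w : Cell p → ℂ // ∑ σ, w σ = 0 ∧ ∑ σ, ‖w σ‖ ^ 2 = 1} := ⟨⟨w₁, hw₁⟩⟩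
  exact le_ciInf fun w => hmin w.2

/-- The hopping constant, with the irrelevant value for `p = (1, …, 1)` replaced by `1`. -/
noncomputable def posConst (c : ℝ) : ℝ := if 0 < c then c else 1

theorem posConst_pos (c : ℝ) : 0 < posConst c := by
  unfold posConst
  split_ifs with hc
  · exact hc
  · exact one_pos

theorem posConst_mul_le_hopForm (hh : IsHoppingKernel h) {w : Cell p → ℂ} (hw : ∑ σ, w σ = 0) :
    posConst (hoppingConstant p h) * ∑ σ, ‖w σ‖ ^ 2 ≤ hopForm p h w := by
  set s := ∑ σ, ‖w σ‖ ^ 2 with hs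
  rcases (show 0 ≤ s from Finset.sum_nonneg fun σ _ => by positivity).eq_or_lt with h0 | h0
  · rw [← h0, mul_zero]
    exact hopForm_nonneg w
  set r : ℝ := (√s)⁻¹ with hr
  have hr2 : r ^ 2 * s = 1 := by
    rw [hr, inv_pow, Real.sq_sqrt h0.le, inv_mul_cancel₀ h0.ne']
  have hmem : ∑ σ, ((r : ℂ) * w σ) = 0 ∧ ∑ σ, ‖(r : ℂ) * w σ‖ ^ 2 = 1 := by
    constructor
    · rw [← Finset.mul_sum, hw, mul_zero]
    · simp_rw [norm_mul, mul_pow, Complex.norm_real, Real.norm_eq_abs, sq_abs]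
      rw [← Finset.mul_sum, hr2]
  -- The normalised vector shows that the constraint set is not empty, so here `posConst` is the
  -- true hopping constant. Over an empty set the real infimum is `0`, and `posConst` substitutes
  -- `1`.
  have hpos := hoppingConstant_pos hh ⟨⟨_, hmem⟩⟩
  have hle : hoppingConstant p h ≤ hopForm p h fun σ => (r : ℂ) * w σ :=
    ciInf_le (f := fun w : {w : Cell p → ℂ // ∑ σ, w σ = 0 ∧ ∑ σ, ‖w σ‖ ^ 2 = 1} =>
      hopForm p h w.1) ⟨0, by rintro _ ⟨w, rfl⟩; exact hopForm_nonneg _⟩ ⟨_, hmem⟩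
  have hscale : hopForm p h (fun σ => (r : ℂ) * w σ) = r ^ 2 * hopForm p h w := by
    rw [hopForm, hopForm, ← tsum_mul_left]
    refine tsum_congr fun ξ => ?_
    simp_rw [← mul_sub, norm_mul, mul_pow, Complex.norm_real, Real.norm_eq_abs, sq_abs]
    rw [← Finset.mul_sum]
    ring
  rw [posConst, if_pos hpos]
  calc hoppingConstant p h * s ≤ r ^ 2 * hopForm p h w * s := by
        rw [← hscale]; gcongr
    _ = (r ^ 2 * s) * hopForm p h w := by ring
    _ = hopForm p h w := by rw [hr2, one_mul]

variable {Ω : Type u} [TopologicalSpace Ω] [MeasurableSpace Ω] {μ : Measure Ω}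
  [IsProbabilityMeasure μ] (M : MarkovEnvironment d μ)

/-- The hopping operator moves mass away from `x = 0`. -/
theorem norm_kHat_originHat_meanHat_ge (hh : IsHoppingKernel h) {φ : FibreSpace p μ}
    (hφ : inner ℂ (groundState p μ) φ = 0) :
    √(posConst (hoppingConstant p h)) * ‖originHat p μ (meanHat p μ φ)‖ ≤
      ‖kHat M p h (originHat p μ (meanHat p μ φ))‖ := by
  set w : Cell p → ℂ := fun σ => inner ℂ (oneL2 μ) (φ (0, σ)) with hw
  -- The only use of orthogonality to the ground state in the coercive estimates.
  have hw0 : ∑ σ, w σ = 0 := by rw [← hφ, inner_groundState]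
  have h1 : ‖originHat p μ (meanHat p μ φ)‖ ^ 2 = ∑ σ, ‖w σ‖ ^ 2 := by
    have h2 := (hasSum_norm_sq (originHat p μ (meanHat p μ φ))).prod_fiberwise
      (g := fun x => if x = 0 then ∑ σ, ‖w σ‖ ^ 2 else 0) (fun x => by
        have e : (if x = 0 then ∑ σ, ‖w σ‖ ^ 2 else 0) =
            ∑ σ, ‖originHat p μ (meanHat p μ φ) (x, σ)‖ ^ 2 := ?_
        · exact e ▸ hasSum_fintype _
        simp only [originHat_apply, meanHat_apply]
        split_ifs with hx
        · simp only [norm_smul, norm_oneL2, mul_one, hx, hw]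
        · simp)
    exact h2.unique (hasSum_ite_eq 0 _)
  have h3 : ‖kHat M p h (originHat p μ (meanHat p μ φ))‖ ^ 2 = hopForm p h w := by
    have h2 := (hasSum_norm_sq (kHat M p h (originHat p μ (meanHat p μ φ)))).prod_fiberwise
      (g := fun x => ‖h x‖ ^ 2 * ∑ σ, ‖w σ - w (σ - toCell p x)‖ ^ 2) (fun x => by
        have e : ‖h x‖ ^ 2 * ∑ σ, ‖w σ - w (σ - toCell p x)‖ ^ 2 =
            ∑ σ, ‖kHat M p h (originHat p μ (meanHat p μ φ)) (x, σ)‖ ^ 2 := ?_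
        · exact e ▸ hasSum_fintype _
        simp only [kHat_originHat_meanHat_apply M hh.summable_norm, norm_smul, norm_oneL2, mul_one,
          norm_mul, mul_pow, hw]
        rw [Finset.mul_sum])
    exact h2.tsum_eq.symm
  have h4 := posConst_mul_le_hopForm hh hw0
  rw [← h1, ← h3] at h4
  refine (sq_le_sq₀ (by positivity) (norm_nonneg _)).1 ?_
  rwa [mul_pow, Real.sq_sqrt (posConst_pos _).le]

end HoppingForm

/-! ### The resolvent equation and control of the mean part by the fluctuations. -/

section Coercivity

variable {d : ℕ} {p : Fin d → ℕ} [∀ j, NeZero (p j)] {Ω : Type u} [TopologicalSpace Ω]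
  [MeasurableSpace Ω] {μ : Measure Ω} (M : MarkovEnvironment d μ) (h : (Fin d → ℤ) → ℂ)
  (u : PeriodicPotential p) (v : Lp ℝ ∞ μ) (lam : ℝ)

/-- The bounded self-adjoint part `K̂₀ + Û + lam V̂` of the fibre operator. -/
noncomputable def hamiltonian : FibreSpace p μ →L[ℂ] FibreSpace p μ :=
  kHat M p h + uHat u + (lam : ℂ) • vHat M p v

theorem hamiltonian_apply (φ : FibreSpace p μ) :
    hamiltonian M h u v lam φ = kHat M p h φ + uHat u φ + (lam : ℂ) • vHat M p v φ := rfl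

variable {M h u v lam}

theorem im_inner_hamiltonian (hh : IsHoppingKernel h) (φ : FibreSpace p μ) :
    (inner ℂ φ (hamiltonian M h u v lam φ)).im = 0 := by
  rw [hamiltonian_apply, inner_add_right, inner_add_right, inner_smul_right, Complex.add_im,
    Complex.add_im, Complex.im_ofReal_mul, im_inner_kHat M hh, im_inner_uHat, im_inner_vHat]
  simp

theorem norm_kHat_add_uHat_apply_le (hs : Summable fun ξ => ‖h ξ‖) (φ : FibreSpace p μ) :
    ‖kHat M p h φ + uHat u φ‖ ≤ (2 * hopNorm h + 2 * u.supNorm) * ‖φ‖ := by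
  rw [add_mul]
  exact (norm_add_le _ _).trans (add_le_add ((kHat M p h).le_of_opNorm_le (norm_kHat_le M hs) φ)
    ((uHat u).le_of_opNorm_le (norm_uHat_le u) φ))

theorem norm_hamiltonian_apply_le (hs : Summable fun ξ => ‖h ξ‖) (hv : ‖v‖ = 1) (hlam : 0 < lam)
    (φ : FibreSpace p μ) :
    ‖hamiltonian M h u v lam φ‖ ≤ (2 * hopNorm h + 2 * u.supNorm + 2 * lam) * ‖φ‖ := by
  rw [hamiltonian_apply, add_mul]
  exact (norm_add_le _ _).trans (add_le_add (norm_kHat_add_uHat_apply_le hs φ)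
    (norm_smul_vHat_apply_le hv hlam φ))

variable [IsProbabilityMeasure μ]

/-- The part of the resolvent equation that is constant in `ω`. -/
theorem meanHat_resolvent_eq (hs : Summable fun ξ => ‖h ξ‖) {φ : (bHat M p).domain} {z : ℂ}
    {η : FibreSpace p μ} (hη : bHat M p φ + (Complex.I • hamiltonian M h u v lam - z • 1) φ = η) :
    meanHat p μ η = Complex.I • (kHat M p h (meanHat p μ φ) + uHat u (meanHat p μ φ)) +
      Complex.I • meanHat p μ ((lam : ℂ) • vHat M p v (fluctHat p μ φ)) - z • meanHat p μ φ := by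
  have h1 : meanHat p μ (vHat M p v φ) = meanHat p μ (vHat M p v (fluctHat p μ φ)) := by
    conv_lhs => rw [← meanHat_add_fluctHat p μ φ]
    rw [map_add, map_add, meanHat_vHat_meanHat, zero_add]
  rw [← hη, map_add, meanHat_bHat, zero_add, sub_apply, smul_apply, smul_apply, one_apply_eq_self,
    hamiltonian_apply, map_sub, map_smul, map_smul, map_add, map_add, meanHat_kHat M hs,
    meanHat_uHat, map_smul, map_smul, h1, smul_add]

/-- The part of the resolvent equation that has mean zero in `ω`. -/
theorem fluctHat_resolvent_eq (hs : Summable fun ξ => ‖h ξ‖) {φ : (bHat M p).domain} {z : ℂ}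
    {η : FibreSpace p μ} (hη : bHat M p φ + (Complex.I • hamiltonian M h u v lam - z • 1) φ = η) :
    bHat M p φ + (Complex.I * lam) • vHat M p v (meanHat p μ φ) =
      fluctHat p μ (η - Complex.I • hamiltonian M h u v lam (fluctHat p μ φ) +
        z • fluctHat p μ φ) := by
  have h1 : fluctHat p μ (fluctHat p μ φ) = fluctHat p μ φ := by
    have := congrArg (fluctHat p μ) (meanHat_add_fluctHat p μ (φ : FibreSpace p μ))
    rwa [map_add, fluctHat_meanHat, zero_add] at this
  have h2 : hamiltonian M h u v lam φ = hamiltonian M h u v lam (meanHat p μ φ) +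
      hamiltonian M h u v lam (fluctHat p μ φ) := by
    rw [← map_add, meanHat_add_fluctHat]
  have h3 : fluctHat p μ (hamiltonian M h u v lam (meanHat p μ φ)) =
      (lam : ℂ) • vHat M p v (meanHat p μ φ) := by
    rw [hamiltonian_apply, map_add, map_add, ← meanHat_kHat M hs, ← meanHat_uHat,
      fluctHat_meanHat, fluctHat_meanHat, map_smul,
      fluctHat_of_meanHat_eq_zero p μ (meanHat_vHat_meanHat p M v φ), zero_add, zero_add]
  have h4 : fluctHat p μ (bHat M p φ) = bHat M p φ :=
    fluctHat_of_meanHat_eq_zero p μ (meanHat_bHat p M φ)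
  rw [← hη, sub_apply, smul_apply, smul_apply, one_apply_eq_self, h2]
  simp only [map_add, map_sub, map_smul, h1, h3, h4, smul_add]
  rw [mul_smul]
  abel

/-- In the mean part of the equation, `z` exceeds the norm bound of `K̂₀ + Û` by at least `1`, so it
can be solved for the mean. The only other sources are `λV̂` on the fluctuations and `η`. -/
theorem norm_meanHat_le_of_large (hs : Summable fun ξ => ‖h ξ‖) (hv : ‖v‖ = 1) (hlam : 0 < lam)
    {φ : (bHat M p).domain} {z : ℂ} (hz : 2 * hopNorm h + 2 * u.supNorm + 1 ≤ ‖z‖)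
    {η : FibreSpace p μ} (hη : bHat M p φ + (Complex.I • hamiltonian M h u v lam - z • 1) φ = η) :
    ‖meanHat p μ φ‖ ≤ 2 * lam * ‖fluctHat p μ φ‖ + ‖η‖ := by
  have h1 := meanHat_resolvent_eq hs hη
  have h2 : z • meanHat p μ φ = Complex.I • (kHat M p h (meanHat p μ φ) + uHat u (meanHat p μ φ)) +
      Complex.I • meanHat p μ ((lam : ℂ) • vHat M p v (fluctHat p μ φ)) - meanHat p μ η := by
    rw [h1]; abel
  have h3 := congrArg norm h2
  have h4 := (norm_sub_le (Complex.I • (kHat M p h (meanHat p μ φ) + uHat u (meanHat p μ φ)) +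
    Complex.I • meanHat p μ ((lam : ℂ) • vHat M p v (fluctHat p μ φ))) (meanHat p μ η)).trans
    (add_le_add_left (norm_add_le _ _) _)
  rw [← h3] at h4
  simp only [norm_smul z, norm_smul Complex.I, Complex.norm_I, one_mul] at h4
  have h5 := norm_kHat_add_uHat_apply_le (M := M) (u := u) hs (meanHat p μ φ)
  have h6 := (norm_meanHat_le p μ _).trans
    (norm_smul_vHat_apply_le (M := M) (v := v) hv hlam (fluctHat p μ φ))
  have h7 := norm_meanHat_le p μ η
  nlinarith [norm_nonneg (meanHat p μ (φ : FibreSpace p μ))]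

/-- The mean part of the equation is restricted to `x ≠ 0`. Since `h 0 = 0`, the hopping of `f₀`
lives entirely there, while `z f₀` and `Û f₀` drop out; so `K̂₀ f₀` is expressed through `f₁`, the
fluctuations and `η`. -/
theorem norm_originHat_meanHat_le (hh : IsHoppingKernel h) (hv : ‖v‖ = 1) (hlam : 0 < lam)
    {φ : (bHat M p).domain} (hφ : inner ℂ (groundState p μ) (φ : FibreSpace p μ) = 0) {z : ℂ}
    {η : FibreSpace p μ} (hη : bHat M p φ + (Complex.I • hamiltonian M h u v lam - z • 1) φ = η) :
    √(posConst (hoppingConstant p h)) * ‖originHat p μ (meanHat p μ φ)‖ ≤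
      ‖η‖ + (2 * hopNorm h + 2 * u.supNorm + ‖z‖) * ‖awayHat p μ (meanHat p μ φ)‖ +
        2 * lam * ‖fluctHat p μ φ‖ := by
  have h1 := meanHat_resolvent_eq hh.summable_norm hη
  set f := meanHat p μ (φ : FibreSpace p μ) with hf
  set f₀ := originHat p μ f with hf₀
  set f₁ := awayHat p μ f with hf₁
  set q := meanHat p μ ((lam : ℂ) • vHat M p v (fluctHat p μ φ)) with hq
  have hK : kHat M p h f = kHat M p h f₀ + kHat M p h f₁ := by
    rw [← map_add, hf₀, hf₁, originHat_add_awayHat]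
  have hU : uHat u f = uHat u f₁ := by
    conv_lhs => rw [← originHat_add_awayHat p μ f]
    rw [map_add, uHat_originHat, zero_add]
  have h2 : Complex.I • kHat M p h f₀ = awayHat p μ (meanHat p μ η) -
      Complex.I • awayHat p μ (kHat M p h f₁ + uHat u f₁) - Complex.I • awayHat p μ q +
        z • f₁ := by
    rw [h1, hK, hU]
    simp only [map_sub, map_add, map_smul, smul_add]
    rw [hf₀, hf, awayHat_kHat_originHat_meanHat M hh, ← hf, ← hf₀, ← hf₁]
    abel
  have h3 : ‖kHat M p h f₀‖ ≤ ‖η‖ + (2 * hopNorm h + 2 * u.supNorm) * ‖f₁‖ +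
      2 * lam * ‖fluctHat p μ φ‖ + ‖z‖ * ‖f₁‖ := by
    have h4 := congrArg norm h2
    rw [norm_smul, Complex.norm_I, one_mul] at h4
    rw [h4]
    refine (norm_add_le _ _).trans (add_le_add ((norm_sub_le _ _).trans (add_le_add
      ((norm_sub_le _ _).trans (add_le_add ?_ ?_)) ?_)) (norm_smul_le _ _))
    · exact (norm_awayHat_le p μ _).trans (norm_meanHat_le p μ _)
    · rw [norm_smul, Complex.norm_I, one_mul]
      exact (norm_awayHat_le p μ _).trans (norm_kHat_add_uHat_apply_le hh.summable_norm _)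
    · rw [norm_smul, Complex.norm_I, one_mul]
      exact (norm_awayHat_le p μ _).trans
        ((norm_meanHat_le p μ _).trans (norm_smul_vHat_apply_le hv hlam _))
  refine (norm_kHat_originHat_meanHat_ge M hh hφ).trans (h3.trans_eq ?_)
  ring

/-- At each site the equation reads `B φ_i + iλc(v∘τ_x - v) = ρ_i`, with `c` the mean of `φ_i`.
Inverting `B` gives `‖ψ_i + iλcG‖ ≤ T‖ρ_i‖` with `‖G‖ ≥ χ`, which bounds `λχ|c|`. The unbounded term
`Bφ` is inverted and never estimated. -/
theorem norm_awayHat_meanHat_le [CompactSpace Ω] [T2Space Ω] [BorelSpace Ω] [μ.Regular] {T χ : ℝ}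
    (hT : 0 < T) (hgap : M.HasGap T) (hχ : 0 < χ) (hv : M.IsNondegeneratePotential v χ)
    (hs : Summable fun ξ => ‖h ξ‖) (hlam : 0 < lam) {φ : (bHat M p).domain} {z : ℂ}
    {η : FibreSpace p μ} (hη : bHat M p φ + (Complex.I • hamiltonian M h u v lam - z • 1) φ = η) :
    lam * χ * ‖awayHat p μ (meanHat p μ φ)‖ ≤ 2 * (‖fluctHat p μ φ‖ + T * (‖η‖ +
      (2 * hopNorm h + 2 * u.supNorm + 2 * lam + ‖z‖) * ‖fluctHat p μ φ‖)) := by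
  have h1 := fluctHat_resolvent_eq hs hη
  set ψ := fluctHat p μ (φ : FibreSpace p μ) with hψ
  set ρ := fluctHat p μ (η - Complex.I • hamiltonian M h u v lam ψ + z • ψ) with hρ
  have hρn : ‖ρ‖ ≤ ‖η‖ + (2 * hopNorm h + 2 * u.supNorm + 2 * lam + ‖z‖) * ‖ψ‖ := by
    refine (norm_fluctHat_le p μ _).trans ((norm_add_le _ _).trans ?_)
    rw [add_mul, ← add_assoc]
    refine add_le_add ((norm_sub_le _ _).trans (add_le_add le_rfl ?_)) (norm_smul_le _ _)
    rw [norm_smul, Complex.norm_I, one_mul]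
    exact norm_hamiltonian_apply_le hs hv.norm_eq_one hlam ψ
  refine (lp_norm_le_two_mul_add (ψ := ψ) (ρ := ρ) (mul_pos hlam hχ).le hT.le fun i => ?_).trans
    (by gcongr)
  rw [awayHat_apply]
  split_ifs with hx
  · rw [norm_zero, mul_zero]
    positivity
  obtain ⟨G, hG0, hBG, hGχ⟩ := exists_B_eq_potDiff hT hgap hv hx
  obtain ⟨hi, hBi⟩ := bHat_apply p M φ i
  obtain ⟨h1d, hB1⟩ := B_oneL2 M
  set c : ℂ := inner ℂ (oneL2 μ) ((φ : FibreSpace p μ) i) with hc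
  -- The mean is subtracted at no cost, as `B 1 = 0`, and the potential term is absorbed into `B`.
  -- Thus `w` has mean zero and `B w = ρ i`.
  set w : M.B.domain := ⟨_, hi⟩ - c • ⟨_, h1d⟩ + (Complex.I * lam * c) • G with hw
  have hwψ : (w : Lp ℂ 2 μ) = ψ i + (Complex.I * lam * c) • (G : Lp ℂ 2 μ) := rfl
  have hBw : M.B w = ρ i := by
    rw [hw, M.B.map_add, M.B.map_sub, M.B.map_smul, M.B.map_smul, hBi, hB1, hBG, smul_zero,
      sub_zero, ← h1, lp.coeFn_add, Pi.add_apply, lp.coeFn_smul, Pi.smul_apply,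
      vHat_meanHat_apply, mul_smul (Complex.I * lam)]
  have hw0 : inner ℂ (oneL2 μ) (w : Lp ℂ 2 μ) = 0 := by
    rw [hwψ, inner_add_right, inner_smul_right, hG0, mul_zero, add_zero, hψ, fluctHat_apply,
      inner_sub_right, inner_smul_right, inner_oneL2_self, mul_one, sub_self]
  have h2 := norm_le_of_gap hT hgap w hw0
  rw [hBw] at h2
  have h3 : ‖(Complex.I * lam * c) • (G : Lp ℂ 2 μ)‖ ≤ ‖ψ i‖ + T * ‖ρ i‖ := by
    have h4 : (Complex.I * lam * c) • (G : Lp ℂ 2 μ) = w - ψ i := by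
      rw [hwψ, add_sub_cancel_left]
    rw [h4, add_comm]
    exact (norm_sub_le _ _).trans (add_le_add_left h2 _)
  rw [norm_smul, norm_mul, norm_mul, Complex.norm_I, one_mul, Complex.norm_real, Real.norm_eq_abs,
    abs_of_pos hlam] at h3
  rw [meanHat_apply, norm_smul, norm_oneL2, mul_one]
  refine le_trans ?_ h3
  rw [mul_assoc, mul_assoc]
  refine mul_le_mul_of_nonneg_left ?_ hlam.le
  rw [mul_comm]
  exact mul_le_mul_of_nonneg_left hGχ (norm_nonneg _)

end Coercivity

/-! ### From a lower bound on `e^⊥` to the spectrum. -/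

section SpectralGap

variable {E : Type*} [NormedAddCommGroup E] [InnerProductSpace ℂ E]

theorem zero_mem_spectrum_of_eigenvalue {A : E →ₗ.[ℂ] E} (h : IsNondegenerateEigenvalue A 0) :
    (0 : ℂ) ∈ unboundedSpectrum A := by
  obtain ⟨φ, hφ, hA, -, -⟩ := h
  rintro ⟨R, -, hR⟩
  have h1 := hR φ
  rw [hA, sub_self, map_zero] at h1
  exact hφ (Subtype.ext h1.symm)

variable [CompleteSpace E] {S : ℝ≥0 → E →L[ℂ] E} {A : E →L[ℂ] E} {e : (generator S).domain}
  {g δ : ℝ}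

/-- If `e` is an eigenvector of the generator and its adjoint, and `generator S + A - z` is bounded
below on `e^⊥` for `Re z ≤ g`, then `0` is a simple eigenvalue, separated by a gap `g` from the
rest of the spectrum. -/
theorem IsContractionSemigroup.spectral_gap (hS : IsContractionSemigroup S) (hg : 0 ≤ g)
    (hδ : 0 < δ) (he : ‖(e : E)‖ = 1) (hBe : generator S e = 0) (hAe : A e = 0)
    (hB : ∀ φ : (generator S).domain, inner ℂ (e : E) (generator S φ) = 0)
    (hA : ∀ φ, inner ℂ (e : E) (A φ) = 0)
    (hlow : ∀ φ : (generator S).domain, inner ℂ (e : E) (φ : E) = 0 → ∀ z : ℂ, z.re ≤ g →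
      δ * ‖(φ : E)‖ ≤ ‖generator S φ + (A - z • (1 : E →L[ℂ] E)) φ‖) :
    IsNondegenerateEigenvalue (A.toLinearMap +ᵥ generator S) 0 ∧
      ∀ z : ℂ, z.re ≤ g → z ≠ 0 → InResolventSet (A.toLinearMap +ᵥ generator S) z := by
  have hee : inner ℂ (e : E) (e : E) = 1 := by
    rw [inner_self_eq_norm_sq_to_K, he]; simp
  have hzero : ∀ φ : (generator S).domain, inner ℂ (e : E) (φ : E) = 0 → ∀ z : ℂ, z.re ≤ g →
      generator S φ + (A - z • (1 : E →L[ℂ] E)) φ = 0 → φ = 0 := by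
    intro φ hφ z hz h0
    have h1 := hlow φ hφ z hz
    rw [h0, norm_zero] at h1
    have h2 : ‖(φ : E)‖ ≤ 0 := le_of_mul_le_mul_left (by simpa using h1) hδ
    exact Subtype.ext (norm_le_zero_iff.1 h2)
  refine ⟨⟨e, ?_, ?_, ?_, ?_⟩, ?_⟩
  · intro h
    rw [h] at he
    simp at he
  · change A e + generator S e = (0 : ℂ) • (e : E)
    rw [hAe, hBe, zero_smul, add_zero]
  · intro ψ hψ
    change A ψ + generator S ψ = (0 : ℂ) • (ψ : E) at hψ
    refine ⟨inner ℂ (e : E) (ψ : E), sub_eq_zero.1 (hzero (ψ - inner ℂ (e : E) (ψ : E) • e) ?_ 0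
      hg ?_)⟩
    · rw [Submodule.coe_sub, Submodule.coe_smul, inner_sub_right, inner_smul_right, hee, mul_one,
        sub_self]
    · rw [(generator S).map_sub, (generator S).map_smul, hBe, smul_zero, sub_zero, zero_smul,
        sub_zero, Submodule.coe_sub, Submodule.coe_smul, map_sub, map_smul, hAe, smul_zero,
        sub_zero, add_comm]
      simpa using hψ
  -- The range of the operator is orthogonal to `e`, which rules out a generalised eigenvector.
  · intro ψ hψ
    have h1 := congrArg (inner ℂ (e : E)) hψ
    change inner ℂ (e : E) (A ψ + generator S ψ - (0 : ℂ) • (ψ : E)) = _ at h1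
    rw [zero_smul, sub_zero, inner_add_right, hA, hB, hee, add_zero] at h1
    exact zero_ne_one h1
  · intro z hz hz0
    -- Adding `k Q`, with `Q` the projection onto `e`, moves the eigenvalue `0` to `g + 1`, outside
    -- the half-plane; the lower bound then holds on the whole space.
    set k : ℂ := ((g + 1 : ℝ) : ℂ) with hk
    set Q : E →L[ℂ] E := (innerSL ℂ (e : E)).smulRight (e : E) with hQ
    have hQa : ∀ φ, Q φ = inner ℂ (e : E) φ • (e : E) := fun _ => rfl
    have hkz : ∀ z : ℂ, z.re ≤ g → 1 ≤ ‖k - z‖ := fun z hz => by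
      refine le_trans ?_ (Complex.re_le_norm (k - z))
      rw [hk, Complex.sub_re, Complex.ofReal_re]
      linarith
    have hlow' : ∀ z : ℂ, z.re ≤ g → ∀ φ : (generator S).domain, (1 + 2 / δ)⁻¹ * ‖(φ : E)‖ ≤
        ‖generator S φ + (A + k • Q - z • (1 : E →L[ℂ] E)) φ‖ := by
      intro z hz φ
      set η := generator S φ + (A + k • Q - z • (1 : E →L[ℂ] E)) φ with hη
      set a := inner ℂ (e : E) (φ : E) with ha
      set φ' : (generator S).domain := φ - a • e with hφ'
      have h1 : inner ℂ (e : E) η = (k - z) * a := by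
        rw [hη, sub_apply, add_apply, smul_apply, smul_apply, one_apply_eq_self, hQa,
          inner_add_right, inner_sub_right, inner_add_right, hB, hA, inner_smul_right,
          inner_smul_right, inner_smul_right, hee]
        ring
      have h2 : ‖(k - z) * a‖ ≤ ‖η‖ := by
        rw [← h1]
        simpa [he] using norm_inner_le_norm (𝕜 := ℂ) (e : E) η
      have h3 : ‖a‖ ≤ ‖η‖ := by
        refine le_trans ?_ h2
        rw [norm_mul]
        exact le_mul_of_one_le_left (norm_nonneg _) (hkz z hz)
      have hφe : inner ℂ (e : E) (φ' : E) = 0 := by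
        rw [hφ', Submodule.coe_sub, Submodule.coe_smul, inner_sub_right, inner_smul_right, hee,
          mul_one, sub_self]
      have h4 : generator S φ' + (A - z • (1 : E →L[ℂ] E)) φ' = η - ((k - z) * a) • (e : E) := by
        rw [hφ', (generator S).map_sub, (generator S).map_smul, hBe, hη, Submodule.coe_sub,
          Submodule.coe_smul]
        simp only [sub_apply, add_apply, smul_apply, one_apply_eq_self, map_sub, map_smul, hAe,
          hQa, ← ha]
        module
      have h5 := hlow φ' hφe z hz
      rw [h4] at h5
      have h6 : ‖η - ((k - z) * a) • (e : E)‖ ≤ 2 * ‖η‖ := by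
        refine (norm_sub_le _ _).trans ?_
        rw [norm_smul, he, mul_one]
        linarith
      have h7 : ‖(φ' : E)‖ ≤ 2 / δ * ‖η‖ := by
        rw [div_mul_eq_mul_div, le_div_iff₀ hδ]
        linarith
      have h8 : ‖(φ : E)‖ ≤ ‖(φ' : E)‖ + ‖a‖ := by
        have h9 : (φ : E) = φ' + a • (e : E) := by
          rw [hφ', Submodule.coe_sub, Submodule.coe_smul, sub_add_cancel]
        calc ‖(φ : E)‖ = ‖(φ' : E) + a • (e : E)‖ := by rw [← h9]
          _ ≤ ‖(φ' : E)‖ + ‖a • (e : E)‖ := norm_add_le _ _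
          _ = ‖(φ' : E)‖ + ‖a‖ := by rw [norm_smul, he, mul_one]
      rw [inv_mul_le_iff₀ (by positivity)]
      linarith
    obtain ⟨R', hR', -, -⟩ := exists_bounded_inverse (by positivity) (hlow' z hz)
      (fun y => hS.surjective_of_uniform_lower_bound (A + k • Q) (by positivity) hlow' hz y)
    -- If `r` solves the perturbed equation, then `r - (k/z)Qr` solves the original one, because the
    -- original operator minus `z` acts on `e` as `-z`. This needs `z ≠ 0`.
    have key : ∀ y, ∃ hy : (R' - (k / z) • (Q * R')) y ∈ (generator S).domain,
        A ((R' - (k / z) • (Q * R')) y) + generator S ⟨_, hy⟩ -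
          z • (R' - (k / z) • (Q * R')) y = y := by
      intro y
      obtain ⟨hy, hy'⟩ := hR' y
      set r : (generator S).domain := ⟨R' y, hy⟩ with hr
      have h1 : (R' - (k / z) • (Q * R')) y =
          ((r - ((k / z) * inner ℂ (e : E) (R' y)) • e : (generator S).domain) : E) := by
        rw [sub_apply, smul_apply, mul_apply_eq_comp, hQa, smul_smul]
        rfl
      refine ⟨h1 ▸ Subtype.property _, ?_⟩
      have h2 : (⟨(R' - (k / z) • (Q * R')) y, h1 ▸ Subtype.property _⟩ : (generator S).domain) =
          r - ((k / z) * inner ℂ (e : E) (R' y)) • e := Subtype.ext h1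
      rw [h2, h1, (generator S).map_sub, (generator S).map_smul, hBe, Submodule.coe_sub,
        Submodule.coe_smul, map_sub, map_smul, hAe]
      refine Eq.trans ?_ hy'
      simp only [sub_apply, add_apply, smul_apply, one_apply_eq_self, hQa, smul_sub, smul_zero,
        sub_zero, smul_smul]
      rw [← mul_assoc, mul_div_cancel₀ _ hz0]
      abel
    refine ⟨R' - (k / z) • (Q * R'), key, fun x => ?_⟩
    obtain ⟨hy, hy'⟩ := key ((A.toLinearMap +ᵥ generator S) x - z • (x : E))
    set y : (generator S).domain := ⟨_, hy⟩ with hyd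
    have h1 : generator S (y - x) + (A - z • (1 : E →L[ℂ] E)) ((y - x : (generator S).domain) : E)
        = 0 := by
      change A (y : E) + generator S y - z • (y : E) =
        A (x : E) + generator S x - z • (x : E) at hy'
      rw [(generator S).map_sub, Submodule.coe_sub, map_sub]
      simp only [sub_apply, smul_apply, one_apply_eq_self]
      rw [← sub_eq_zero] at hy'
      rw [← hy']
      abel
    have h2 : inner ℂ (e : E) ((y - x : (generator S).domain) : E) = 0 := by
      have h3 := congrArg (inner ℂ (e : E)) h1
      rw [sub_apply, smul_apply, one_apply_eq_self, inner_add_right, inner_sub_right, hB, hA,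
        inner_smul_right, inner_zero_right, zero_add, zero_sub, neg_eq_zero, mul_eq_zero] at h3
      exact h3.resolve_left hz0
    exact congrArg Subtype.val (sub_eq_zero.1 (hzero (y - x) h2 z hz h1))

end SpectralGap

/-! ### Scalar inequalities and the choice of constants. -/

section Constants

/-- The constant in the hypocoercive estimate. -/
noncomputable def couplingConst (hop U T χ c₀ lam : ℝ) : ℝ :=
  let K := 4 * hop + 4 * U + 4 * lam + 1
  let D := 2 * (1 + T * (1 + K)) / χ
  2 * lam + 2 * lam ^ 2 + D + (lam + K * D + 2 * lam ^ 2) / √(posConst c₀)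

theorem couplingConst_pos {hop U T χ lam : ℝ} (c₀ : ℝ) (hhop : 0 ≤ hop) (hU : 0 ≤ U) (hT : 0 < T)
    (hχ : 0 < χ) (hlam : 0 < lam) : 0 < couplingConst hop U T χ c₀ lam := by
  have := posConst_pos c₀
  unfold couplingConst
  positivity

/-- Here `a`, `n`, `f`, `m` stand for the norms of the fluctuation, the residual `η`, the mean part
and the whole vector. The bound `Λ ≥ lam` keeps the constant independent of small `lam`. -/
theorem mul_le_couplingConst_of_large {hop U T χ c₀ lam Λ a n f m : ℝ} (hhop : 0 ≤ hop)
    (hU : 0 ≤ U) (hT : 0 < T) (hχ : 0 < χ) (hlam : 0 < lam) (hΛ : lam ≤ Λ) (ha : 0 ≤ a)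
    (hn : 0 ≤ n) (hm : m ≤ f + a) (hf : f ≤ 2 * lam * a + n) :
    lam * m ≤ couplingConst hop U T χ c₀ Λ * (a + n) := by
  have hΛ0 : 0 < Λ := hlam.trans_le hΛ
  have hpos := posConst_pos c₀
  have hsn : lam * (a + n) ≤ Λ * (a + n) := mul_le_mul_of_nonneg_right hΛ (by positivity)
  have h1 : 2 * lam ^ 2 * a ≤ 2 * Λ ^ 2 * (a + n) := by
    refine mul_le_mul (by gcongr) (by linarith) ha (by positivity)
  have h2 : lam * m ≤ lam * (2 * lam * a + n + a) := by
    refine mul_le_mul_of_nonneg_left ?_ hlam.le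
    linarith
  have h3 : lam * m ≤ (2 * Λ + 2 * Λ ^ 2) * (a + n) := by
    have h4 : 0 ≤ Λ * (a + n) := by positivity
    calc lam * m ≤ lam * (2 * lam * a + n + a) := h2
      _ = 2 * lam ^ 2 * a + lam * (a + n) := by ring
      _ ≤ 2 * Λ ^ 2 * (a + n) + Λ * (a + n) := add_le_add h1 hsn
      _ ≤ (2 * Λ + 2 * Λ ^ 2) * (a + n) := by linarith
  refine h3.trans (mul_le_mul_of_nonneg_right ?_ (by positivity))
  rw [couplingConst, add_assoc (2 * Λ + 2 * Λ ^ 2)]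
  exact le_add_of_nonneg_right (by positivity)

theorem mul_le_couplingConst_of_small {hop U T χ c₀ lam Λ a n f₁ f₀ m ζ : ℝ} (hhop : 0 ≤ hop)
    (hU : 0 ≤ U) (hT : 0 < T) (hχ : 0 < χ) (hlam : 0 < lam) (hΛ : lam ≤ Λ) (ha : 0 ≤ a)
    (hn : 0 ≤ n) (hf₁ : 0 ≤ f₁) (hζ : ζ ≤ 2 * hop + 2 * U + 1) (hm : m ≤ f₀ + f₁ + a)
    (h₁ : lam * χ * f₁ ≤ 2 * (a + T * (n + (2 * hop + 2 * U + 2 * lam + ζ) * a)))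
    (h₀ : √(posConst c₀) * f₀ ≤ n + (2 * hop + 2 * U + ζ) * f₁ + 2 * lam * a) :
    lam * m ≤ couplingConst hop U T χ c₀ Λ * (a + n) := by
  have hΛ0 : 0 < Λ := hlam.trans_le hΛ
  have hs := Real.sqrt_pos.2 (posConst_pos c₀)
  -- `K` dominates every operator norm that occurs, including `ζ = ‖z‖`. `D` bounds `lam * f₁`, and
  -- `D'` bounds `lam * f₀` through `h₀` multiplied by `lam`, so that only one power of `lam` is
  -- lost in all.
  obtain ⟨K, hK⟩ : ∃ K, K = 4 * hop + 4 * U + 4 * Λ + 1 := ⟨_, rfl⟩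
  obtain ⟨D, hD⟩ : ∃ D, D = 2 * (1 + T * (1 + K)) / χ := ⟨_, rfl⟩
  obtain ⟨D', hD'⟩ : ∃ D', D' = (Λ + K * D + 2 * Λ ^ 2) / √(posConst c₀) := ⟨_, rfl⟩
  have hc : couplingConst hop U T χ c₀ Λ = 2 * Λ + 2 * Λ ^ 2 + D + D' := by
    rw [hD', hD, hK, couplingConst]
  have hK0 : 0 < K := by rw [hK]; positivity
  have h2 : lam * f₁ ≤ D * (a + n) := by
    rw [hD, div_mul_eq_mul_div, le_div_iff₀ hχ]
    have h3 : (2 * hop + 2 * U + 2 * lam + ζ) * a ≤ K * (a + n) :=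
      (mul_le_mul_of_nonneg_right (by linarith) ha).trans
        (mul_le_mul_of_nonneg_left (by linarith : a ≤ a + n) hK0.le)
    have h4 : T * (n + (2 * hop + 2 * U + 2 * lam + ζ) * a) ≤ T * ((1 + K) * (a + n)) := by
      refine mul_le_mul_of_nonneg_left ?_ hT.le
      linarith
    linarith
  have h3 : lam * f₀ ≤ D' * (a + n) := by
    rw [hD', div_mul_eq_mul_div, le_div_iff₀ hs]
    have h4 : (2 * hop + 2 * U + ζ) * (lam * f₁) ≤ K * (D * (a + n)) :=
      (mul_le_mul_of_nonneg_right (by linarith) (mul_nonneg hlam.le hf₁)).trans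
        (mul_le_mul_of_nonneg_left h2 hK0.le)
    have h5 := mul_le_mul_of_nonneg_left h₀ hlam.le
    have h6 : lam * n ≤ Λ * (a + n) := mul_le_mul hΛ (by linarith) hn hΛ0.le
    have h7 : 2 * lam ^ 2 * a ≤ 2 * Λ ^ 2 * (a + n) :=
      mul_le_mul (by gcongr) (by linarith) ha (by positivity)
    linarith
  have h4 : lam * a ≤ Λ * (a + n) := mul_le_mul hΛ (by linarith) ha hΛ0.le
  have h5 := mul_le_mul_of_nonneg_left hm hlam.le
  have h6 : 0 ≤ (Λ + 2 * Λ ^ 2) * (a + n) := by positivity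
  rw [hc]
  linarith

/-- Squaring `h1` and inserting `h2`, the coefficient `lam² / (4D²T)` contributes exactly half of
`lam² m²`, which is absorbed on the left. What remains is `lam² m²/2 ≤ 2D²(Tnm + n²)`, which fails
when `n` is too small compared with `m`. -/
theorem lower_bound_of_hypocoercive {a n m lam D T : ℝ} (hn : 0 ≤ n) (hm : 0 ≤ m)
    (hlam : 0 < lam) (hD : 0 < D) (hT : 0 < T) (h1 : lam * m ≤ D * (a + n))
    (h2 : 1 / T * a ^ 2 ≤ n * m + lam ^ 2 / (4 * D ^ 2 * T) * m ^ 2) :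
    min 1 (lam ^ 2 / (4 * D ^ 2 * (T + 1))) * m ≤ n := by
  set δ := min 1 (lam ^ 2 / (4 * D ^ 2 * (T + 1))) with hδ
  have hδ0 : 0 < δ := by positivity
  by_contra hcon
  push Not at hcon
  have hm0 : 0 < m := by
    rcases hm.eq_or_lt with h0 | h0
    · rw [← h0, mul_zero] at hcon
      exact absurd hn (not_le.2 hcon)
    · exact h0
  have h3 : a ^ 2 ≤ T * n * m + lam ^ 2 / (4 * D ^ 2) * m ^ 2 := by
    rw [one_div, inv_mul_le_iff₀ hT] at h2
    refine h2.trans_eq ?_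
    field_simp
  have h4 : (lam * m) ^ 2 ≤ 2 * D ^ 2 * (a ^ 2 + n ^ 2) := by
    have h5 := pow_le_pow_left₀ (by positivity) h1 2
    nlinarith [mul_nonneg (sq_nonneg D) (sq_nonneg (a - n))]
  have h5 : 2 * D ^ 2 * (lam ^ 2 / (4 * D ^ 2) * m ^ 2) = lam ^ 2 * m ^ 2 / 2 := by
    field_simp
    ring
  have h6 : lam ^ 2 * m ^ 2 / 2 ≤ 2 * D ^ 2 * (T * n * m + n ^ 2) := by
    nlinarith [mul_le_mul_of_nonneg_left h3 (by positivity : 0 ≤ 2 * D ^ 2)]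
  have h7 : T * n * m + n ^ 2 < (T + 1) * δ * m ^ 2 := by
    have h8 : n ^ 2 ≤ n * m := by
      rw [sq]
      refine mul_le_mul_of_nonneg_left (hcon.le.trans ?_) hn
      exact mul_le_of_le_one_left hm (min_le_left _ _)
    have h9 : (T + 1) * n * m < (T + 1) * (δ * m) * m := by gcongr
    nlinarith
  have h8 : 2 * D ^ 2 * ((T + 1) * δ * m ^ 2) ≤ lam ^ 2 * m ^ 2 / 2 := by
    have h9 : δ ≤ lam ^ 2 / (4 * D ^ 2 * (T + 1)) := min_le_right _ _
    rw [le_div_iff₀ (by positivity)] at h9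
    nlinarith [mul_le_mul_of_nonneg_right h9 (sq_nonneg m)]
  have h9 := mul_lt_mul_of_pos_left h7 (by positivity : 0 < 2 * D ^ 2)
  linarith

end Constants

/-! ### The spectral gap of the fibre operator. -/

section Fibre

variable {d : ℕ} {p : Fin d → ℕ} [∀ j, NeZero (p j)] {Ω : Type u} [TopologicalSpace Ω]
  [MeasurableSpace Ω] {μ : Measure Ω} {M : MarkovEnvironment d μ} {h : (Fin d → ℤ) → ℂ}
  {u : PeriodicPotential p} {v : Lp ℝ ∞ μ} {lam : ℝ} [IsProbabilityMeasure μ]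

theorem hamiltonian_groundState (hs : Summable fun ξ => ‖h ξ‖) :
    hamiltonian M h u v lam (groundState p μ) = 0 := by
  have h1 : uHat u (groundState p μ) = 0 := by
    rw [← originHat_meanHat_groundState, uHat_originHat]
  have h2 : vHat M p v (groundState p μ) = 0 := by
    rw [← originHat_meanHat_groundState, vHat_originHat]
  rw [hamiltonian_apply, kHat_groundState M hs, h1, h2, smul_zero, add_zero, add_zero]

/-- A real quadratic form makes the bounded part symmetric, and the ground state is in its kernel.
-/
theorem inner_groundState_hamiltonian (hh : IsHoppingKernel h) (φ : FibreSpace p μ) :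
    inner ℂ (groundState p μ) (hamiltonian M h u v lam φ) = 0 := by
  have hsymm : ((hamiltonian M h u v lam : FibreSpace p μ →L[ℂ] FibreSpace p μ) :
      FibreSpace p μ →ₗ[ℂ] FibreSpace p μ).IsSymmetric := by
    refine (LinearMap.isSymmetric_iff_inner_map_self_real _).2 fun ψ => ?_
    rw [inner_conj_symm]
    have h1 := im_inner_hamiltonian (M := M) (u := u) (v := v) (lam := lam) hh ψ
    have h2 := inner_conj_symm (𝕜 := ℂ) (hamiltonian M h u v lam ψ) ψ
    rw [← Complex.conj_eq_iff_im, inner_conj_symm] at h1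
    exact h1.symm
  have h1 := hsymm (groundState p μ) φ
  rw [ContinuousLinearMap.coe_coe, hamiltonian_groundState hh.summable_norm, inner_zero_left] at h1
  exact h1.symm

variable [CompactSpace Ω] [T2Space Ω] [BorelSpace Ω] [μ.Regular] {T χ Λ : ℝ}

theorem mul_norm_le_couplingConst (hT : 0 < T) (hgap : M.HasGap T) (hχ : 0 < χ)
    (hv : M.IsNondegeneratePotential v χ) (hh : IsHoppingKernel h) (hlam : 0 < lam) (hΛ : lam ≤ Λ)
    {φ : (bHat M p).domain} (hφ : inner ℂ (groundState p μ) (φ : FibreSpace p μ) = 0) {z : ℂ}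
    {η : FibreSpace p μ} (hη : bHat M p φ + (Complex.I • hamiltonian M h u v lam - z • 1) φ = η) :
    lam * ‖(φ : FibreSpace p μ)‖ ≤
      couplingConst (hopNorm h) u.supNorm T χ (hoppingConstant p h) Λ *
        (‖fluctHat p μ φ‖ + ‖η‖) := by
  have hs := hh.summable_norm
  have hφn : ‖(φ : FibreSpace p μ)‖ ≤ ‖meanHat p μ φ‖ + ‖fluctHat p μ φ‖ :=
    (congrArg norm (meanHat_add_fluctHat p μ (φ : FibreSpace p μ)).symm).trans_le (norm_add_le _ _)
  rcases le_total (2 * hopNorm h + 2 * u.supNorm + 1) ‖z‖ with hz | hz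
  · exact mul_le_couplingConst_of_large (hopNorm_nonneg h) u.supNorm_nonneg hT hχ hlam hΛ
      (norm_nonneg _) (norm_nonneg _) hφn (norm_meanHat_le_of_large hs hv.norm_eq_one hlam hz hη)
  · have hf : ‖meanHat p μ φ‖ ≤ ‖originHat p μ (meanHat p μ φ)‖ + ‖awayHat p μ (meanHat p μ φ)‖ :=
      (congrArg norm (originHat_add_awayHat p μ (meanHat p μ φ)).symm).trans_le (norm_add_le _ _)
    exact mul_le_couplingConst_of_small (hopNorm_nonneg h) u.supNorm_nonneg hT hχ hlam hΛ
      (norm_nonneg _) (norm_nonneg _) (norm_nonneg _) hz (hφn.trans (add_le_add_left hf _))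
      (norm_awayHat_meanHat_le hT hgap hχ hv hs hlam hη)
      (norm_originHat_meanHat_le hh hv.norm_eq_one hlam hφ hη)

/-- The gap of the fibre operator. -/
noncomputable def fibreGap (hop U T χ c₀ lam : ℝ) : ℝ :=
  lam ^ 2 / (4 * couplingConst hop U T χ c₀ (max lam 1) ^ 2 * T)

/-- The real part of `⟨φ, η⟩` does not see `H`, so the gap of `B` controls the fluctuations up to
`Re z ‖φ‖²`. `mul_norm_le_couplingConst` then controls all of `φ` by the fluctuations and `η`. -/
theorem fibre_lower_bound (hT : 0 < T) (hgap : M.HasGap T) (hχ : 0 < χ)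
    (hv : M.IsNondegeneratePotential v χ) (hh : IsHoppingKernel h) (hlam : 0 < lam) :
    ∃ δ > 0, ∀ φ : (bHat M p).domain, inner ℂ (groundState p μ) (φ : FibreSpace p μ) = 0 →
      ∀ z : ℂ, z.re ≤ fibreGap (hopNorm h) u.supNorm T χ (hoppingConstant p h) lam →
        δ * ‖(φ : FibreSpace p μ)‖ ≤
          ‖bHat M p φ + (Complex.I • hamiltonian M h u v lam - z • 1) φ‖ := by
  set D := couplingConst (hopNorm h) u.supNorm T χ (hoppingConstant p h) (max lam 1) with hD
  have hD0 : 0 < D := couplingConst_pos _ (hopNorm_nonneg h) u.supNorm_nonneg hT hχ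
    (lt_max_of_lt_left hlam)
  refine ⟨min 1 (lam ^ 2 / (4 * D ^ 2 * (T + 1))), by positivity, fun φ hφ z hz => ?_⟩
  set η := bHat M p φ + (Complex.I • hamiltonian M h u v lam - z • 1) φ with hη
  refine lower_bound_of_hypocoercive (a := ‖fluctHat p μ (φ : FibreSpace p μ)‖) (norm_nonneg _)
    (norm_nonneg _) hlam hD0 hT
    (mul_norm_le_couplingConst hT hgap hχ hv hh hlam (le_max_left _ _) hφ hη.symm) ?_
  have h1 := gap_re_inner_bHat p M hgap φ
  have h2 : (inner ℂ (φ : FibreSpace p μ) η).re ≤ ‖(φ : FibreSpace p μ)‖ * ‖η‖ :=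
    re_inner_le_norm (𝕜 := ℂ) _ _
  have h3 : (inner ℂ (φ : FibreSpace p μ) η).re =
      (inner ℂ (φ : FibreSpace p μ) (bHat M p φ)).re - z.re * ‖(φ : FibreSpace p μ)‖ ^ 2 := by
    have h4 : inner ℂ (φ : FibreSpace p μ) (φ : FibreSpace p μ) =
        ((‖(φ : FibreSpace p μ)‖ ^ 2 : ℝ) : ℂ) := by
      rw [inner_self_eq_norm_sq_to_K]; norm_cast
    have h5 := im_inner_hamiltonian (M := M) (u := u) (v := v) (lam := lam) hh
      (φ : FibreSpace p μ)
    rw [hη, inner_add_right, sub_apply, smul_apply, smul_apply, one_apply_eq_self,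
      inner_sub_right, inner_smul_right, inner_smul_right, h4]
    simp only [Complex.add_re, Complex.sub_re, Complex.re_mul_ofReal, Complex.I_mul_re, h5]
    ring
  have h4 : z.re * ‖(φ : FibreSpace p μ)‖ ^ 2 ≤
      lam ^ 2 / (4 * D ^ 2 * T) * ‖(φ : FibreSpace p μ)‖ ^ 2 :=
    mul_le_mul_of_nonneg_right hz (by positivity)
  rw [mul_comm ‖η‖]
  linarith

theorem fibre_spectral_gap (hT : 0 < T) (hgap : M.HasGap T) (hχ : 0 < χ)
    (hv : M.IsNondegeneratePotential v χ) (hh : IsHoppingKernel h) (hlam : 0 < lam) :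
    IsNondegenerateEigenvalue (fibreL M h u v lam) 0 ∧
      ∀ z : ℂ, z.re ≤ fibreGap (hopNorm h) u.supNorm T χ (hoppingConstant p h) lam → z ≠ 0 →
        InResolventSet (fibreL M h u v lam) z := by
  obtain ⟨δ, hδ, hlow⟩ := fibre_lower_bound (u := u) hT hgap hχ hv hh hlam
  obtain ⟨hg, hBg⟩ := bHat_groundState p M
  set c : ℂ := ((‖groundState p μ‖⁻¹ : ℝ) : ℂ) with hc
  have hne : ‖groundState p μ‖ ≠ 0 := norm_ne_zero_iff.2 (groundState_ne_zero p μ)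
  have hc0 : c ≠ 0 := Complex.ofReal_ne_zero.2 (inv_ne_zero hne)
  have hinner : ∀ φ : FibreSpace p μ, inner ℂ (c • groundState p μ) φ =
      c * inner ℂ (groundState p μ) φ := fun φ => by
    rw [inner_smul_left, hc, Complex.conj_ofReal]
  refine (M.isContractionSemigroup.lift (I := (Fin d → ℤ) × Cell p)).spectral_gap
    (A := Complex.I • hamiltonian M h u v lam) (e := c • ⟨groundState p μ, hg⟩) (by
      unfold fibreGap; positivity) hδ ?_ ?_ ?_ ?_ ?_ ?_
  · change ‖c • groundState p μ‖ = 1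
    rw [norm_smul, hc, Complex.norm_real, norm_inv, norm_norm, inv_mul_cancel₀ hne]
  · exact ((bHat M p).map_smul c _).trans ((congrArg (c • ·) hBg).trans (smul_zero c))
  · change Complex.I • hamiltonian M h u v lam (c • groundState p μ) = 0
    rw [map_smul, hamiltonian_groundState hh.summable_norm, smul_zero, smul_zero]
  · intro φ
    exact (hinner _).trans ((congrArg (c * ·) (inner_groundState_bHat p M φ)).trans (mul_zero c))
  · intro φ
    refine (hinner _).trans ?_
    rw [smul_apply, inner_smul_right, inner_groundState_hamiltonian hh, mul_zero, mul_zero]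
  · intro φ hφ
    refine hlow φ ?_
    exact (mul_eq_zero.1 ((hinner φ).symm.trans hφ)).resolve_left hc0

end Fibre

end PeriodicMarkov

/-! ### The main statement. -/

theorem lemma4p4 (d : ℕ) (p : Fin d → ℕ) [∀ j, NeZero (p j)] :
    ∃ c lam₀ : ℝ → ℝ → ℝ → ℝ → ℝ → ℝ → ℝ → ℝ,
      ∀ (Ω : Type*) [TopologicalSpace Ω] [CompactSpace Ω] [T2Space Ω] [MeasurableSpace Ω]
        [BorelSpace Ω] (μ : MeasureTheory.Measure Ω) [MeasureTheory.IsProbabilityMeasure μ]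
        [μ.Regular] (M : MarkovEnvironment d μ) (b γ T χ : ℝ)
        (v : MeasureTheory.Lp ℝ ⊤ μ) (h : (Fin d → ℤ) → ℂ) (u : PeriodicPotential p),
        0 ≤ b → 0 ≤ γ → M.IsSectorial b γ → 0 < T → M.HasGap T →
        0 < χ → M.IsNondegeneratePotential v χ → IsHoppingKernel h →
        0 < c (hopNorm h) u.supNorm γ T b χ (hoppingConstant p h) ∧
        0 < lam₀ (hopNorm h) u.supNorm γ T b χ (hoppingConstant p h) ∧
        ∀ lam : ℝ, 0 < lam →
          IsNondegenerateEigenvalue (fibreL M h u v lam) 0 ∧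
          ∃ g : ℝ, 0 < g ∧
            (lam < lam₀ (hopNorm h) u.supNorm γ T b χ (hoppingConstant p h) →
              c (hopNorm h) u.supNorm γ T b χ (hoppingConstant p h) * lam ^ 2 ≤ g) ∧
            ∃ S : Set ℂ, S ⊆ {z | g < z.re} ∧
              unboundedSpectrum (fibreL M h u v lam) = {0} ∪ S := by
  -- For `lam < 1` the coupling constant in `fibreGap` is frozen at `max lam 1 = 1`, so the gap
  -- equals this constant times `lam ^ 2`.
  refine ⟨fun hop U _ T _ χ c₀ => 1 / (4 * couplingConst hop U T χ c₀ 1 ^ 2 * T),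
    fun _ _ _ _ _ _ _ => 1, ?_⟩
  intro Ω _ _ _ _ _ μ _ _ M b γ T χ v h u _ _ _ hT hgap hχ hv hh
  have hpos : ∀ lam : ℝ, 0 < lam →
      0 < couplingConst (hopNorm h) u.supNorm T χ (hoppingConstant p h) lam := fun lam hlam =>
    couplingConst_pos _ (hopNorm_nonneg h) u.supNorm_nonneg hT hχ hlam
  refine ⟨?_, one_pos, fun lam hlam => ?_⟩
  · have := hpos 1 one_pos
    positivity
  obtain ⟨heig, hres⟩ := fibre_spectral_gap (u := u) hT hgap hχ hv hh hlam
  refine ⟨heig, fibreGap (hopNorm h) u.supNorm T χ (hoppingConstant p h) lam, ?_, fun hlam1 => ?_,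
    unboundedSpectrum (fibreL M h u v lam) \ {0}, ?_, ?_⟩
  · have := hpos (max lam 1) (lt_max_of_lt_left hlam)
    unfold fibreGap
    positivity
  · have hmax : max lam 1 = 1 := max_eq_right (le_of_lt hlam1)
    change 1 / (4 * couplingConst (hopNorm h) u.supNorm T χ (hoppingConstant p h) 1 ^ 2 * T) *
      lam ^ 2 ≤ _
    rw [fibreGap, hmax, one_div, div_eq_inv_mul]
  · rintro z ⟨hz, hz0⟩
    by_contra hcon
    exact hz (hres z (not_lt.1 hcon) hz0)
  · rw [Set.union_sdiff_cancel]
    exact Set.singleton_subset_iff.2 (zero_mem_spectrum_of_eigenvalue heig)
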